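/- Let $a,b\neq0$, $m,n>0$, $m\ne1$, $\sigma=\pm1$. The $K(m,n)$ equation is $u_t+a(u^m)_x+b(u^n)_{xxx}=0$ and the $KP(m,n)$ equation is $(u_t+a(u^m)_x+b(u^n)_{xxx})_x+\sigma u_{yy}=0$. Put $U_c(\xi)=U(\xi)H(L-|\xi|)$, where $H$ is the Heaviside function and $L>0$, and consider $u=U_c(x-ct)$ with $g=c$ for $K(m,n)$, and $u=U_c(x+\mu y-\nu t)$ with $g=\nu-\sigma\mu^2$ for $KP(m,n)$. A power of a negative number is understood as the real power for an exponent that is a fraction with odd denominator. *Weak compacton:* $U_c$ is continuous with support $[-L,L]$, it satisfies $\int\big((-gU_c+aU_c^m)\phi'+bU_c^n\phi'''\big)d\xi=0$ (respectively $\int\big((-gU_c+aU_c^m)\phi''+bU_c^n\phi''''\big)d\xi=0$) for all test functions $\phi\in C_c^\infty(\mathbb R)$, and $u$ lies in $L^\infty_{loc}$ in $t$ with values $L^{\max(m,n)}_{loc}$ in space and satisfies $\iint(u\psi_t+au^m\psi_x+bu^n\psi_{xxx})\,dt\,dx=0$ (respectively $\iiint(u\psi_{tx}+\sigma u\psi_{yy}+au^m\psi_{xx}+bu^n\psi_{xxxx})\,dt\,dx\,dy=0$)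 for all test functions $\psi$. *Strong compacton:* $U_c$ has support $[-L,L]$, is $C^3$ (respectively $C^4$) on $\mathbb R$, so that $U_c$ and its derivatives up to order 3 (respectively 4) vanish at $\pm L$; $U_c^n$ is $C^2$; and $(-gU_c+aU_c^m+b(U_c^n)'')'=0$ (respectively $(-gU_c+aU_c^m+b(U_c^n)'')''=0$) at every point of $\mathbb R$. Let $\mathrm{cn}(z,k),\mathrm{sn}(z,k)$ be the Jacobi functions of modulus $k$, $\mathrm K(k)$ the complete elliptic integral, $\mathrm{arccn}(x,k)$ the inverse of cn with values in $[0,2\mathrm K(k)]$, $k_\pm=\frac{\sqrt2(\sqrt3\pm1)}4$. Consider the following families (U, L, relation between $m,n$, signs). 1. (zsq1) $U=\big(\tfrac{g(3n+1)}{2a(n+1)}\big)^{\frac2{n-1}}\big(1-\tfrac{a^2(n+1)(n-1)^2}{2gbn(3n+1)^2}\xi^2\big)^{\frac2{n-1}}$, $L=\tfrac{3n+1}{(n-1)|a|}\sqrt{\tfrac{2n|gb|}{n+1}}$, $m=\frac{n+1}2$, $\mathrm{sgn}\,g=\mathrm{sgn}\,a=\mathrm{sgn}\,b$. 2. (zsq2)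 $U=\big(\tfrac{a(n+1)}{2g}\big)^{\frac1{n-1}}\big(1+\tfrac{g^2(n-1)^2}{abn(n+1)^2}\xi^2\big)^{\frac1{n-1}}$, $L=\tfrac{(n+1)\sqrt{n|ab|}}{(n-1)|g|}$, $m=2-n$, $\mathrm{sgn}\,g=\mathrm{sgn}\,a=-\mathrm{sgn}\,b$. 3. (cos1) $U=\big(\tfrac{2ng}{(n+1)a}\big)^{\frac1{n-1}}\cos\big(\tfrac{n-1}{2n}\sqrt{\tfrac ab}\,\xi\big)^{\frac2{n-1}}$, $L=\tfrac n{n-1}\sqrt{\tfrac ba}\,\pi$, $m=n$, $\mathrm{sgn}\,g=\mathrm{sgn}\,a=\mathrm{sgn}\,b$. 4. (cos2) $U=\big(\tfrac{2a}{g(m+1)}\big)^{\frac1{1-m}}\cos\big(\sqrt{\tfrac{-g}{4b}}(1-m)\xi\big)^{\frac2{1-m}}$, $L=\tfrac1{1-m}\sqrt{\tfrac{|b|}{|g|}}\,\pi$, $n=1$, $\mathrm{sgn}\,g=\mathrm{sgn}\,a=-\mathrm{sgn}\,b$. 5. (cn1) $U=\big(\tfrac{a(n+1)}{g(3n-1)}\big)^{\frac1{2-2n}}\mathrm{cn}\big((1-n)\sqrt{\tfrac{-a}{nb}}\sqrt[4]{\tfrac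 g{a(3n-1)(n+1)}}\,\xi,\tfrac1{\sqrt2}\big)^{\frac2{1-n}}$, $L=\tfrac{\sqrt{n|b|}}{1-n}\sqrt[4]{\tfrac{(3n-1)(n+1)}{ag}}\,\mathrm K(\tfrac1{\sqrt2})$, $m=2n-1$, $\mathrm{sgn}\,g=\mathrm{sgn}\,a=-\mathrm{sgn}\,b$. 6. (cn2) $U=\big(\tfrac{g(3n-1)}{a(n+1)}\big)^{\frac1{2n-2}}\mathrm{cn}\big((n-1)\sqrt{\tfrac a{bn}}\sqrt[4]{\tfrac g{a(3n-1)(n+1)}}\,\xi,\tfrac1{\sqrt2}\big)^{\frac2{n-1}}$, $L=\tfrac{\sqrt{n|b|}}{n-1}\sqrt[4]{\tfrac{(3n-1)(n+1)}{ag}}\,\mathrm K(\tfrac1{\sqrt2})$, $m=2n-1$, $\mathrm{sgn}\,g=\mathrm{sgn}\,a=\mathrm{sgn}\,b$. 7. (sn1) $U=\big(\tfrac{a(n+1)}{g(3n-1)}\big)^{\frac1{2-2n}}\mathrm{sn}\big((1-n)\sqrt{\tfrac{-a}{2bn}}\sqrt[4]{\tfrac g{a(3n-1)(n+1)}}(\xi+L),i\big)^{\frac2{1-n}}$,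 $L=\tfrac{\sqrt{2n|b|}}{1-n}\sqrt[4]{\tfrac{(3n-1)(n+1)}{ag}}\,\mathrm K(i)$, $m=2n-1$, $\mathrm{sgn}\,g=\mathrm{sgn}\,a=-\mathrm{sgn}\,b$. 8. (sn2) $U=\big(\tfrac{g(3n-1)}{a(n+1)}\big)^{\frac1{2n-2}}\mathrm{sn}\big((n-1)\sqrt{\tfrac a{2bn}}\sqrt[4]{\tfrac g{a(3n-1)(n+1)}}(\xi+L),i\big)^{\frac2{n-1}}$, $L=\tfrac{\sqrt{2n|b|}}{n-1}\sqrt[4]{\tfrac{(3n-1)(n+1)}{ag}}\,\mathrm K(i)$, $m=2n-1$, $\mathrm{sgn}\,g=\mathrm{sgn}\,a=\mathrm{sgn}\,b$. In families 9 and 10 put $\beta=(n-1)\sqrt[6]{\tfrac{12\sqrt3\,ag^2}{b^3n^3(n+1)^2(2n-1)}}$, $X=\tfrac{(5+3\sqrt3)g(2n-1)}{-2a(n+1)}$, $L=\tfrac2{n-1}\sqrt[6]{\tfrac{b^3n^3(n+1)^2(2n-1)}{12\sqrt3\,ag^2}}\,\mathrm K(k_-)$, $m=3n-2$, $\mathrm{sgn}\,a=\mathrm{sgn}\,b$,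 and either $\mathrm{sgn}\,g=\mathrm{sgn}\,a$, or $\mathrm{sgn}\,g=-\mathrm{sgn}\,a$ and $n$ is a quotient of an even by an odd integer. 9. (ratcn1) $U=\Big(X^{\frac13}\,\tfrac{\mathrm{cn}(\beta(\xi+L),k_-)-1}{\mathrm{cn}(\beta(\xi+L),k_-)+\sqrt3+2}\Big)^{\frac1{n-1}}$. 10. (ratcn2) $U=\Big(X^{\frac13}\,\tfrac{\mathrm{cn}(\beta\xi,k_-)+1}{\mathrm{cn}(\beta\xi,k_-)-\sqrt3-2}\Big)^{\frac1{n-1}}$. 11. (ratcn3) $U=\big(\tfrac{(5+3\sqrt3)a(n+1)}{g(2n-1)}\big)^{\frac1{3-3n}}\Big(\tfrac{\mathrm{cn}(\beta\xi,k_+)+\sqrt3-2}{\mathrm{cn}(\beta\xi,k_+)+1}\Big)^{\frac1{1-n}}$, $\beta=(1-n)\sqrt[6]{\tfrac{-12\sqrt3\,ag^2}{b^3n^3(n+1)^2(2n-1)}}$, $L=\tfrac1{1-n}\sqrt[6]{\tfrac{|b|^3n^3(n+1)^2(2n-1)}{12\sqrt3|a|g^2}}\,\mathrm{arccn}(2-\sqrt3,k_+)$,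 $m=3n-2$, $\mathrm{sgn}\,g=\mathrm{sgn}\,a=-\mathrm{sgn}\,b$. In families 12 and 13 put $\beta=(1-n)\sqrt[6]{\tfrac{-3\sqrt3\,a^2g}{2b^3n^3(n+1)(5n-1)^2}}$, $Y=\tfrac{(5+3\sqrt3)a(n+1)}{-2g(5n-1)}$, $L=\tfrac2{1-n}\sqrt[6]{\tfrac{2|b|^3n^3(n+1)(5n-1)^2}{3\sqrt3\,a^2|g|}}\,\mathrm K(k_-)$, $m=\frac{3n-1}2$, $\mathrm{sgn}\,g=\mathrm{sgn}\,a=-\mathrm{sgn}\,b$. 12. (ratcn4) $U=\Big(Y^{\frac13}\,\tfrac{\mathrm{cn}(\beta(\xi+L),k_-)-1}{\mathrm{cn}(\beta(\xi+L),k_-)+\sqrt3+2}\Big)^{\frac2{1-n}}$. 13. (ratcn5) $U=\Big(Y^{\frac13}\,\tfrac{\mathrm{cn}(\beta\xi,k_-)+1}{\mathrm{cn}(\beta\xi,k_-)-\sqrt3-2}\Big)^{\frac2{1-n}}$. 14. (ratcn6) $U=\big(\tfrac{(5+3\sqrt3)g(5n-1)}{a(n+1)}\big)^{\frac2{3n-3}}\Big(\tfrac{\mathrm{cn}(\beta\xi,k_+)+\sqrt3-2}{\mathrm{cn}(\beta\xi,k_+)+1}\Big)^{\frac2{n-1}}$,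 $\beta=(n-1)\sqrt[6]{\tfrac{3\sqrt3\,a^2g}{2b^3n^3(n+1)(5n-1)^2}}$, $L=\tfrac1{n-1}\sqrt[6]{\tfrac{2|b|^3n^3(n+1)(5n-1)^2}{3\sqrt3\,a^2|g|}}\,\mathrm{arccn}(2-\sqrt3,k_+)$, $m=\frac{3n-1}2$, $\mathrm{sgn}\,g=\mathrm{sgn}\,a=\mathrm{sgn}\,b$. Then, under the stated relations and signs, $U_c$ is a weak (strong) compacton of $K(m,n)$ or of $KP(m,n)$ if and only if the condition in the following table holds; and whenever the condition in the weak column holds, $U_c$ is even and $U_c(\xi)\sim U_0(L-|\xi|)^p$ as $\xi\to\pm L$ inside $(-L,L)$, for some $U_0\ne0$. | families | $p$ | weak $K$ and weak $KP$ | strong $K$ | strong $KP$ | |---|---|---|---|---| | 1, 3, 6, 8, 9, 10, 14 | $\frac2{n-1}$ | $1<n$ | $1<n<\frac53$ | $1<n<\frac32$ | | 2 | $\frac1{n-1}$ | $1<n<2$ | $1<n<\frac43$ | $1<n<\frac54$ | | 4 | $\frac2{1-m}$ | $0<m<1$ | $\frac13<m<1$ | $\frac12<m<1$ | | 5, 7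 | $\frac2{1-n}$ | $\frac12<n<1$ | $\frac12<n<1$ | $\frac12<n<1$ | | 11 | $\frac1{1-n}$ | $\frac23<n<1$ | $\frac23<n<1$ | $\frac34<n<1$ | | 12, 13 | $\frac4{1-n}$ | $\frac13<n<1$ | $\frac13<n<1$ | $\frac13<n<1$ | In particular, let $n=2$, $\mathrm{sgn}\,a=\mathrm{sgn}\,b$ and $m\in\{\frac32,2,3,\frac52\}$. If $\mathrm{sgn}\,g=\mathrm{sgn}\,a$, then zsq1 ($m=\frac32$), cos1 ($m=2$), cn2 and sn2 ($m=3$), ratcn6 ($m=\frac52$) are weak compactons of both equations but not strong ones, and for no $g$ does any other listed family apply to these equations. Likewise, for $n=1$, $m=\frac14$, $\mathrm{sgn}\,g=\mathrm{sgn}\,a=-\mathrm{sgn}\,b$, cos2 is a weak but not a strong compacton of both equations. -/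

import Mathlib

open MeasureTheory Set Filter Topology
open scoped ContDiff

noncomputable section

namespace Compacton

/-! ### Real powers -/

/-- `r` is a fraction with odd denominator (in lowest terms). -/
def OddDen (r : ℝ) : Prop := ∃ q : ℚ, (q : ℝ) = r ∧ Odd q.den

/-- `r` is a fraction with odd denominator and even numerator (in lowest terms). -/
def EvenOverOdd (r : ℝ) : Prop := ∃ q : ℚ, (q : ℝ) = r ∧ Odd q.den ∧ Even q.num

/-- The real power `x ^ r` is meaningful: either `x` is nonnegative, or `r` is a fraction with odd
denominator. -/
def PowDefined (x r : ℝ) : Prop := 0 ≤ x ∨ OddDen r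

open Classical in
/-- The real power `x ^ r`: the usual one for `0 ≤ x`; for `x < 0` and `r = j / k` in lowest terms
with `k` odd it is the real number `(x ^ (1 / k)) ^ j`, built on the real odd root. Its remaining
values (where `PowDefined` fails) are never used. -/
def realPow (x r : ℝ) : ℝ :=
  if 0 ≤ x then x ^ r
  else if EvenOverOdd r then |x| ^ r
  else if OddDen r then -(|x| ^ r)
  else 0

/-! ### Jacobi elliptic functions

They are functions of the square `M = k ^ 2` of the modulus, so that the imaginary modulus
`k = i` is `M = -1`. All moduli in use have `M < 1`. -/

/-- Incomplete elliptic integral of the first kind, `∫₀^φ dθ / √(1 - k² sin² θ)`. -/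
def ellipticF (φ M : ℝ) : ℝ := ∫ θ in (0 : ℝ)..φ, 1 / √(1 - M * Real.sin θ ^ 2)

/-- Complete elliptic integral of the first kind. -/
def ellipticK (M : ℝ) : ℝ := ellipticF (Real.pi / 2) M

/-- Jacobi amplitude, the inverse of `φ ↦ ellipticF φ M` (a bijection of the line if `M < 1`). -/
def jacobiAm (z M : ℝ) : ℝ := Function.invFun (fun φ => ellipticF φ M) z

/-- Jacobi sn. -/
def jacobiSn (z M : ℝ) : ℝ := Real.sin (jacobiAm z M)

/-- Jacobi cn. -/
def jacobiCn (z M : ℝ) : ℝ := Real.cos (jacobiAm z M)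

/-- The inverse function of Jacobi cn with values in `[0, 2 K]`, for `-1 ≤ x ≤ 1`. -/
def jacobiArccn (x M : ℝ) : ℝ := ellipticF (Real.arccos x) M

/-! ### Weak solutions of the two equations -/

/-- Weak form of the travelling wave equation `(-g U + a U^m + b (U^n)'')' = 0`. -/
def IsWeakSolODE3 (a b g m n : ℝ) (U : ℝ → ℝ) : Prop :=
  ∀ φ : ℝ → ℝ, ContDiff ℝ ∞ φ → HasCompactSupport φ →
    Integrable (fun ξ => (-g * U ξ + a * realPow (U ξ) m) * deriv φ ξ
      + b * realPow (U ξ) n * iteratedDeriv 3 φ ξ) ∧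
    ∫ ξ, ((-g * U ξ + a * realPow (U ξ) m) * deriv φ ξ
      + b * realPow (U ξ) n * iteratedDeriv 3 φ ξ) = 0

/-- Weak form of the travelling wave equation `(-g U + a U^m + b (U^n)'')'' = 0`. -/
def IsWeakSolODE4 (a b g m n : ℝ) (U : ℝ → ℝ) : Prop :=
  ∀ φ : ℝ → ℝ, ContDiff ℝ ∞ φ → HasCompactSupport φ →
    Integrable (fun ξ => (-g * U ξ + a * realPow (U ξ) m) * iteratedDeriv 2 φ ξ
      + b * realPow (U ξ) n * iteratedDeriv 4 φ ξ) ∧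
    ∫ ξ, ((-g * U ξ + a * realPow (U ξ) m) * iteratedDeriv 2 φ ξ
      + b * realPow (U ξ) n * iteratedDeriv 4 φ ξ) = 0

/-- `u (t, x)` is a weak solution of `u_t + a (u^m)_x + b (u^n)_xxx = 0`: it is locally `L^∞` in `t`
with values locally `L^max(m, n)` in `x`, and
`∬ (u ψ_t + a u^m ψ_x + b u^n ψ_xxx) dt dx = 0` for all test functions `ψ (t, x)`. -/
def IsWeakSolK (a b m n : ℝ) (u : ℝ → ℝ → ℝ) : Prop :=
  (∀ t x, PowDefined (u t x) m ∧ PowDefined (u t x) n) ∧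
  AEStronglyMeasurable (fun p : ℝ × ℝ => u p.1 p.2) ∧
  (∀ R : ℝ, ∃ C : ℝ, ∀ᵐ t ∂(volume.restrict (Icc (-R) R)),
    ∫⁻ x in Icc (-R) R, ‖u t x‖ₑ ^ (max m n) ≤ ENNReal.ofReal C) ∧
  ∀ ψ : ℝ × ℝ → ℝ, ContDiff ℝ ∞ ψ → HasCompactSupport ψ →
    Integrable (fun p : ℝ × ℝ =>
      u p.1 p.2 * deriv (fun t => ψ (t, p.2)) p.1
      + a * realPow (u p.1 p.2) m * deriv (fun x => ψ (p.1, x)) p.2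
      + b * realPow (u p.1 p.2) n * iteratedDeriv 3 (fun x => ψ (p.1, x)) p.2) ∧
    ∫ p : ℝ × ℝ, (
      u p.1 p.2 * deriv (fun t => ψ (t, p.2)) p.1
      + a * realPow (u p.1 p.2) m * deriv (fun x => ψ (p.1, x)) p.2
      + b * realPow (u p.1 p.2) n * iteratedDeriv 3 (fun x => ψ (p.1, x)) p.2) = 0

/-- `u (t, x, y)` is a weak solution of `(u_t + a (u^m)_x + b (u^n)_xxx)_x + σ u_yy = 0`: it is
locally `L^∞` in `t` with values locally `L^max(m, n)` in `(x, y)`, and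
`∭ (u ψ_tx + σ u ψ_yy + a u^m ψ_xx + b u^n ψ_xxxx) dt dx dy = 0` for all test functions
`ψ (t, x, y)`. -/
def IsWeakSolKP (a b σ m n : ℝ) (u : ℝ → ℝ → ℝ → ℝ) : Prop :=
  (∀ t x y, PowDefined (u t x y) m ∧ PowDefined (u t x y) n) ∧
  AEStronglyMeasurable (fun p : ℝ × ℝ × ℝ => u p.1 p.2.1 p.2.2) ∧
  (∀ R : ℝ, ∃ C : ℝ, ∀ᵐ t ∂(volume.restrict (Icc (-R) R)),
    ∫⁻ q in Icc (-R) R ×ˢ Icc (-R) R, ‖u t q.1 q.2‖ₑ ^ (max m n) ≤ ENNReal.ofReal C) ∧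
  ∀ ψ : ℝ × ℝ × ℝ → ℝ, ContDiff ℝ ∞ ψ → HasCompactSupport ψ →
    Integrable (fun p : ℝ × ℝ × ℝ =>
      u p.1 p.2.1 p.2.2 * deriv (fun t => deriv (fun x => ψ (t, x, p.2.2)) p.2.1) p.1
      + σ * u p.1 p.2.1 p.2.2 * iteratedDeriv 2 (fun y => ψ (p.1, p.2.1, y)) p.2.2
      + a * realPow (u p.1 p.2.1 p.2.2) m * iteratedDeriv 2 (fun x => ψ (p.1, x, p.2.2)) p.2.1
      + b * realPow (u p.1 p.2.1 p.2.2) n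
        * iteratedDeriv 4 (fun x => ψ (p.1, x, p.2.2)) p.2.1) ∧
    ∫ p : ℝ × ℝ × ℝ, (
      u p.1 p.2.1 p.2.2 * deriv (fun t => deriv (fun x => ψ (t, x, p.2.2)) p.2.1) p.1
      + σ * u p.1 p.2.1 p.2.2 * iteratedDeriv 2 (fun y => ψ (p.1, p.2.1, y)) p.2.2
      + a * realPow (u p.1 p.2.1 p.2.2) m * iteratedDeriv 2 (fun x => ψ (p.1, x, p.2.2)) p.2.1
      + b * realPow (u p.1 p.2.1 p.2.2) n
        * iteratedDeriv 4 (fun x => ψ (p.1, x, p.2.2)) p.2.1) = 0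

/-! ### Compactons -/

/-- The function `U` is a continuous profile with support exactly `[-L, L]`, where `0 < L`. -/
def IsCompactProfile (L : ℝ) (U : ℝ → ℝ) : Prop :=
  0 < L ∧ Continuous U ∧ tsupport U = Icc (-L) L

/-- `u = U (x - c t)` is a weak compacton of the `K(m, n)` equation. -/
def IsWeakCompactonK (a b c m n L : ℝ) (U : ℝ → ℝ) : Prop :=
  IsCompactProfile L U ∧ IsWeakSolODE3 a b c m n U ∧
    IsWeakSolK a b m n (fun t x => U (x - c * t))

/-- `u = U (x + μ y - ν t)` is a weak line compacton of the `KP(m, n)` equation. -/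
def IsWeakCompactonKP (a b σ μ ν m n L : ℝ) (U : ℝ → ℝ) : Prop :=
  IsCompactProfile L U ∧ IsWeakSolODE4 a b (ν - σ * μ ^ 2) m n U ∧
    IsWeakSolKP a b σ m n (fun t x y => U (x + μ * y - ν * t))

/-- The expression `-g U + a U^m + b (U^n)''`. -/
def waveFlux (a b g m n : ℝ) (U : ℝ → ℝ) (ξ : ℝ) : ℝ :=
  -g * U ξ + a * realPow (U ξ) m + b * iteratedDeriv 2 (fun s => realPow (U s) n) ξ

/-- `U` is a strong compacton of the `K(m, n)` equation: the profile, which is zero outside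
`[-L, L]`, is `C^3` on the line (so that `U, U', U'', U'''` vanish at the end points), and
`(-c U + a U^m + b (U^n)'')' = 0` holds at every point. -/
def IsStrongCompactonK (a b c m n L : ℝ) (U : ℝ → ℝ) : Prop :=
  IsCompactProfile L U ∧ (∀ ξ, PowDefined (U ξ) m ∧ PowDefined (U ξ) n) ∧ ContDiff ℝ 3 U ∧
    ContDiff ℝ 2 (fun s => realPow (U s) n) ∧
    ∀ ξ, HasDerivAt (waveFlux a b c m n U) 0 ξ

/-- `U` is a strong line compacton of the `KP(m, n)` equation: the profile, which is zero outside
`[-L, L]`, is `C^4` on the line (so that `U, U', U'', U''', U''''` vanish at the end points), and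
`(-g U + a U^m + b (U^n)'')'' = 0` with `g = ν - σ μ²` holds at every point. -/
def IsStrongCompactonKP (a b σ μ ν m n L : ℝ) (U : ℝ → ℝ) : Prop :=
  IsCompactProfile L U ∧ (∀ ξ, PowDefined (U ξ) m ∧ PowDefined (U ξ) n) ∧ ContDiff ℝ 4 U ∧
    ContDiff ℝ 2 (fun s => realPow (U s) n) ∧
    Differentiable ℝ (waveFlux a b (ν - σ * μ ^ 2) m n U) ∧
    ∀ ξ, HasDerivAt (deriv (waveFlux a b (ν - σ * μ ^ 2) m n U)) 0 ξ

/-- `U ξ ∼ U₀ (L - |ξ|)^p` with `U₀ ≠ 0` as `ξ → ± L` from inside the interval `(-L, L)`. -/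
def HasEndBehaviour (U : ℝ → ℝ) (L p : ℝ) : Prop :=
  ∃ U₀ : ℝ, U₀ ≠ 0 ∧
    Tendsto (fun ξ => U ξ / (L - |ξ|) ^ p) (𝓝[<] L) (𝓝 U₀) ∧
    Tendsto (fun ξ => U ξ / (L - |ξ|) ^ p) (𝓝[>] (-L)) (𝓝 U₀)

/-- The cut-off `U (ξ) H (L - |ξ|)`, with the Heaviside function `H`. -/
def cutoff (L : ℝ) (U : ℝ → ℝ) (ξ : ℝ) : ℝ := if |ξ| < L then U ξ else 0

/-! ### The explicit profiles -/

/-- The fourteen families of explicit symmetric profiles. -/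
inductive Family : Type
  | zsq1 | zsq2 | cos1 | cos2 | cn1 | cn2 | sn1 | sn2
  | ratcn1 | ratcn2 | ratcn3 | ratcn4 | ratcn5 | ratcn6

/-- The square of the modulus `√2 (√3 - 1) / 4`. -/
def modMinus : ℝ := (√2 * (√3 - 1) / 4) ^ 2

/-- The square of the modulus `√2 (√3 + 1) / 4`. -/
def modPlus : ℝ := (√2 * (√3 + 1) / 4) ^ 2

/-- The half-width `L` of the support. -/
def Family.halfWidth (F : Family) (a b g m n : ℝ) : ℝ :=
  match F with
  | .zsq1 => (3 * n + 1) / ((n - 1) * |a|) * √(2 * n * |g * b| / (n + 1))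
  | .zsq2 => (n + 1) * √(n * |a * b|) / ((n - 1) * |g|)
  | .cos1 => n / (n - 1) * √(b / a) * Real.pi
  | .cos2 => 1 / (1 - m) * √(|b| / |g|) * Real.pi
  | .cn1 => √(n * |b|) / (1 - n) * ((3 * n - 1) * (n + 1) / (a * g)) ^ (1 / 4 : ℝ)
      * ellipticK ((1 / √2) ^ 2)
  | .cn2 => √(n * |b|) / (n - 1) * ((3 * n - 1) * (n + 1) / (a * g)) ^ (1 / 4 : ℝ)
      * ellipticK ((1 / √2) ^ 2)
  | .sn1 => √(2 * n * |b|) / (1 - n) * ((3 * n - 1) * (n + 1) / (a * g)) ^ (1 / 4 : ℝ)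
      * ellipticK (-1)
  | .sn2 => √(2 * n * |b|) / (n - 1) * ((3 * n - 1) * (n + 1) / (a * g)) ^ (1 / 4 : ℝ)
      * ellipticK (-1)
  | .ratcn1 | .ratcn2 => 2 / (n - 1)
      * (b ^ 3 * n ^ 3 * (n + 1) ^ 2 * (2 * n - 1) / (12 * √3 * a * g ^ 2)) ^ (1 / 6 : ℝ)
      * ellipticK modMinus
  | .ratcn3 => 1 / (1 - n)
      * (|b| ^ 3 * n ^ 3 * (n + 1) ^ 2 * (2 * n - 1) / (12 * √3 * |a| * g ^ 2)) ^ (1 / 6 : ℝ)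
      * jacobiArccn (2 - √3) modPlus
  | .ratcn4 | .ratcn5 => 2 / (1 - n)
      * (2 * |b| ^ 3 * n ^ 3 * (n + 1) * (5 * n - 1) ^ 2 / (3 * √3 * a ^ 2 * |g|)) ^ (1 / 6 : ℝ)
      * ellipticK modMinus
  | .ratcn6 => 1 / (n - 1)
      * (2 * |b| ^ 3 * n ^ 3 * (n + 1) * (5 * n - 1) ^ 2 / (3 * √3 * a ^ 2 * |g|)) ^ (1 / 6 : ℝ)
      * jacobiArccn (2 - √3) modPlus

/-- The factor multiplying `ξ` (or `ξ + L`) in the trigonometric and elliptic profiles; unused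
(zero) for the algebraic ones. -/
def Family.waveNumber (F : Family) (a b g m n : ℝ) : ℝ :=
  match F with
  | .zsq1 | .zsq2 => 0
  | .cos1 => (n - 1) / (2 * n) * √(a / b)
  | .cos2 => √(-g / (4 * b)) * (1 - m)
  | .cn1 => (1 - n) * √(-a / (n * b)) * (g / (a * (3 * n - 1) * (n + 1))) ^ (1 / 4 : ℝ)
  | .cn2 => (n - 1) * √(a / (b * n)) * (g / (a * (3 * n - 1) * (n + 1))) ^ (1 / 4 : ℝ)
  | .sn1 => (1 - n) * √(-a / (2 * b * n)) * (g / (a * (3 * n - 1) * (n + 1))) ^ (1 / 4 : ℝ)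
  | .sn2 => (n - 1) * √(a / (2 * b * n)) * (g / (a * (3 * n - 1) * (n + 1))) ^ (1 / 4 : ℝ)
  | .ratcn1 | .ratcn2 => (n - 1)
      * (12 * √3 * a * g ^ 2 / (b ^ 3 * n ^ 3 * (n + 1) ^ 2 * (2 * n - 1))) ^ (1 / 6 : ℝ)
  | .ratcn3 => (1 - n)
      * (-12 * √3 * a * g ^ 2 / (b ^ 3 * n ^ 3 * (n + 1) ^ 2 * (2 * n - 1))) ^ (1 / 6 : ℝ)
  | .ratcn4 | .ratcn5 => (1 - n)
      * (-3 * √3 * a ^ 2 * g / (2 * b ^ 3 * n ^ 3 * (n + 1) * (5 * n - 1) ^ 2)) ^ (1 / 6 : ℝ)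
  | .ratcn6 => (n - 1)
      * (3 * √3 * a ^ 2 * g / (2 * b ^ 3 * n ^ 3 * (n + 1) * (5 * n - 1) ^ 2)) ^ (1 / 6 : ℝ)

/-- The profile `U` before the cut-off. In `ratcn1`, `ratcn2`, `ratcn4`, `ratcn5` the two factors
`X ^ (r / 3) * Y ^ r` of the profile are combined to `(X ^ (1 / 3) * Y) ^ r` with the real cube
root, since `X` or `Y` or both are negative. -/
def Family.profile (F : Family) (a b g m n : ℝ) (ξ : ℝ) : ℝ :=
  let L := F.halfWidth a b g m n
  let β := F.waveNumber a b g m n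
  match F with
  | .zsq1 => (g * (3 * n + 1) / (2 * a * (n + 1))) ^ (2 / (n - 1))
      * (1 - a ^ 2 * (n + 1) * (n - 1) ^ 2 / (2 * g * b * n * (3 * n + 1) ^ 2) * ξ ^ 2)
        ^ (2 / (n - 1))
  | .zsq2 => (a * (n + 1) / (2 * g)) ^ (1 / (n - 1))
      * (1 + g ^ 2 * (n - 1) ^ 2 / (a * b * n * (n + 1) ^ 2) * ξ ^ 2) ^ (1 / (n - 1))
  | .cos1 => (2 * n * g / ((n + 1) * a)) ^ (1 / (n - 1)) * Real.cos (β * ξ) ^ (2 / (n - 1))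
  | .cos2 => (2 * a / (g * (m + 1))) ^ (1 / (1 - m)) * Real.cos (β * ξ) ^ (2 / (1 - m))
  | .cn1 => (a * (n + 1) / (g * (3 * n - 1))) ^ (1 / (2 - 2 * n))
      * jacobiCn (β * ξ) ((1 / √2) ^ 2) ^ (2 / (1 - n))
  | .cn2 => (g * (3 * n - 1) / (a * (n + 1))) ^ (1 / (2 * n - 2))
      * jacobiCn (β * ξ) ((1 / √2) ^ 2) ^ (2 / (n - 1))
  | .sn1 => (a * (n + 1) / (g * (3 * n - 1))) ^ (1 / (2 - 2 * n))
      * jacobiSn (β * (ξ + L)) (-1) ^ (2 / (1 - n))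
  | .sn2 => (g * (3 * n - 1) / (a * (n + 1))) ^ (1 / (2 * n - 2))
      * jacobiSn (β * (ξ + L)) (-1) ^ (2 / (n - 1))
  | .ratcn1 => realPow
      (realPow ((5 + 3 * √3) * g * (2 * n - 1) / (-2 * a * (n + 1))) (1 / 3)
        * ((jacobiCn (β * (ξ + L)) modMinus - 1) / (jacobiCn (β * (ξ + L)) modMinus + √3 + 2)))
      (1 / (n - 1))
  | .ratcn2 => realPow
      (realPow ((5 + 3 * √3) * g * (2 * n - 1) / (-2 * a * (n + 1))) (1 / 3)
        * ((jacobiCn (β * ξ) modMinus + 1) / (jacobiCn (β * ξ) modMinus - √3 - 2)))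
      (1 / (n - 1))
  | .ratcn3 => ((5 + 3 * √3) * a * (n + 1) / (g * (2 * n - 1))) ^ (1 / (3 - 3 * n))
      * ((jacobiCn (β * ξ) modPlus + √3 - 2) / (jacobiCn (β * ξ) modPlus + 1)) ^ (1 / (1 - n))
  | .ratcn4 =>
      (realPow ((5 + 3 * √3) * a * (n + 1) / (-2 * g * (5 * n - 1))) (1 / 3)
        * ((jacobiCn (β * (ξ + L)) modMinus - 1) / (jacobiCn (β * (ξ + L)) modMinus + √3 + 2)))
      ^ (2 / (1 - n))
  | .ratcn5 =>
      (realPow ((5 + 3 * √3) * a * (n + 1) / (-2 * g * (5 * n - 1))) (1 / 3)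
        * ((jacobiCn (β * ξ) modMinus + 1) / (jacobiCn (β * ξ) modMinus - √3 - 2)))
      ^ (2 / (1 - n))
  | .ratcn6 => ((5 + 3 * √3) * g * (5 * n - 1) / (a * (n + 1))) ^ (2 / (3 * n - 3))
      * ((jacobiCn (β * ξ) modPlus + √3 - 2) / (jacobiCn (β * ξ) modPlus + 1)) ^ (2 / (n - 1))

/-- The cut-off profile. -/
def Family.compacton (F : Family) (a b g m n : ℝ) : ℝ → ℝ :=
  cutoff (F.halfWidth a b g m n) (F.profile a b g m n)

/-- The relation between the powers `m` and `n`. -/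
def Family.Relation (F : Family) (m n : ℝ) : Prop :=
  match F with
  | .zsq1 => m = (n + 1) / 2
  | .zsq2 => m = 2 - n
  | .cos1 => m = n
  | .cos2 => n = 1
  | .cn1 | .cn2 | .sn1 | .sn2 => m = 2 * n - 1
  | .ratcn1 | .ratcn2 | .ratcn3 => m = 3 * n - 2
  | .ratcn4 | .ratcn5 | .ratcn6 => m = (3 * n - 1) / 2

/-- The relations between the signs of `a`, `b`, `g`. For `ratcn1` and `ratcn2` the sign of `g` is
that of `a` (positive profile) or the opposite one; in the latter case the profile is real,
namely negative, and a solution if `n` is an even number over an odd number. -/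
def Family.Signs (F : Family) (a b g n : ℝ) : Prop :=
  match F with
  | .zsq1 | .cos1 | .cn2 | .sn2 | .ratcn6 => 0 < a * b ∧ 0 < a * g
  | .zsq2 | .cos2 | .cn1 | .sn1 | .ratcn3 | .ratcn4 | .ratcn5 => a * b < 0 ∧ 0 < a * g
  | .ratcn1 | .ratcn2 => 0 < a * b ∧ (0 < a * g ∨ (a * g < 0 ∧ EvenOverOdd n))

/-- The equation has admissible powers and the family applies to it. -/
def Family.Admissible (F : Family) (a b g m n : ℝ) : Prop :=
  0 < m ∧ 0 < n ∧ m ≠ 1 ∧ F.Relation m n ∧ F.Signs a b g n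

/-- The power `p` in the behaviour `(L - |ξ|)^p` at the end points of the support. -/
def Family.endPower (F : Family) (m n : ℝ) : ℝ :=
  match F with
  | .zsq1 | .cos1 | .cn2 | .sn2 | .ratcn1 | .ratcn2 | .ratcn6 => 2 / (n - 1)
  | .zsq2 => 1 / (n - 1)
  | .cos2 => 2 / (1 - m)
  | .cn1 | .sn1 => 2 / (1 - n)
  | .ratcn3 => 1 / (1 - n)
  | .ratcn4 | .ratcn5 => 4 / (1 - n)

/-- The parameter region for weak compactons. -/
def Family.WeakRegion (F : Family) (m n : ℝ) : Prop :=
  match F with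
  | .zsq1 | .cos1 | .cn2 | .sn2 | .ratcn1 | .ratcn2 | .ratcn6 => 1 < n
  | .zsq2 => 1 < n ∧ n < 2
  | .cos2 => 0 < m ∧ m < 1
  | .cn1 | .sn1 => 1 / 2 < n ∧ n < 1
  | .ratcn3 => 2 / 3 < n ∧ n < 1
  | .ratcn4 | .ratcn5 => 1 / 3 < n ∧ n < 1

/-- The parameter region for strong compactons of the `K(m, n)` equation. -/
def Family.StrongRegionK (F : Family) (m n : ℝ) : Prop :=
  match F with
  | .zsq1 | .cos1 | .cn2 | .sn2 | .ratcn1 | .ratcn2 | .ratcn6 => 1 < n ∧ n < 5 / 3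
  | .zsq2 => 1 < n ∧ n < 4 / 3
  | .cos2 => 1 / 3 < m ∧ m < 1
  | .cn1 | .sn1 => 1 / 2 < n ∧ n < 1
  | .ratcn3 => 2 / 3 < n ∧ n < 1
  | .ratcn4 | .ratcn5 => 1 / 3 < n ∧ n < 1

/-- The parameter region for strong line compactons of the `KP(m, n)` equation. -/
def Family.StrongRegionKP (F : Family) (m n : ℝ) : Prop :=
  match F with
  | .zsq1 | .cos1 | .cn2 | .sn2 | .ratcn1 | .ratcn2 | .ratcn6 => 1 < n ∧ n < 3 / 2
  | .zsq2 => 1 < n ∧ n < 5 / 4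
  | .cos2 => 1 / 2 < m ∧ m < 1
  | .cn1 | .sn1 => 1 / 2 < n ∧ n < 1
  | .ratcn3 => 3 / 4 < n ∧ n < 1
  | .ratcn4 | .ratcn5 => 1 / 3 < n ∧ n < 1

/-- The family gives a weak compacton of `K(m, n)` with speed `c = g`. -/
def Family.WeakK (F : Family) (a b g m n : ℝ) : Prop :=
  IsWeakCompactonK a b g m n (F.halfWidth a b g m n) (F.compacton a b g m n)

/-- The family gives a strong compacton of `K(m, n)` with speed `c = g`. -/
def Family.StrongK (F : Family) (a b g m n : ℝ) : Prop :=
  IsStrongCompactonK a b g m n (F.halfWidth a b g m n) (F.compacton a b g m n)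

/-- The family gives a weak line compacton of `KP(m, n)` with `g = ν - σ μ²`. -/
def Family.WeakKP (F : Family) (a b σ μ ν m n : ℝ) : Prop :=
  IsWeakCompactonKP a b σ μ ν m n (F.halfWidth a b (ν - σ * μ ^ 2) m n)
    (F.compacton a b (ν - σ * μ ^ 2) m n)

/-- The family gives a strong line compacton of `KP(m, n)` with `g = ν - σ μ²`. -/
def Family.StrongKP (F : Family) (a b σ μ ν m n : ℝ) : Prop :=
  IsStrongCompactonKP a b σ μ ν m n (F.halfWidth a b (ν - σ * μ ^ 2) m n)
    (F.compacton a b (ν - σ * μ ^ 2) m n)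

/-- The families that apply to the equations with `n = 2`, for four values of `m`. -/
def Family.IsExample (F : Family) (m : ℝ) : Prop :=
  match F with
  | .zsq1 => m = 3 / 2
  | .cos1 => m = 2
  | .cn2 | .sn2 => m = 3
  | .ratcn6 => m = 5 / 2
  | _ => False

end Compacton

end

namespace Compacton

/-! ### Powers of the positive part -/

/-! Every profile is, inside its support, `C * v ^ p` with an even arch `v` that is positive on
`(-L, L)`, vanishes at the ends and satisfies `v' ^ 2 = c₀ + c₁ v ^ j`, `c₀ > 0` (`IsArch`). The
arches are a parabola (`j = 1`), a cosine (`j = 2`), a quotient of linear expressions in cn (`j =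
3`), cn with `k² = 1/2` or sn with `k² = -1` (`j = 4`), and the square root of such a quotient (`j =
6`). The second derivative of `v ^ (p n)` is then a combination of just two powers of `v`, with
exponents `p n - 2` and `p n - 2 + j`. So `-g U + a U ^ m + b (U ^ n)'' = 0` comes down to matching
two exponents and two coefficients (`IsBalanced`). The lower power balances `g U` in the families
with `m > 1` and `a U ^ m` in those with `m < 1`.

The arch crosses zero at `±L` with nonzero slope, so near the support the cut-off equals `C * max v
0 ^ p` and is exactly as smooth as the `p`-th power of the positive part. Since `p n > 2`, the
function `U ^ n` is `C²` on the line, and the equation, with zero constants of integration, holds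
everywhere (`IsArch.isWave`). This gives the weak equations: two integrations by parts put
derivatives on `U ^ n` only, never on `U` (`IsWave.integral_flux`), and the remaining `t` and `y`
derivatives of the test function are traded for `x` derivatives because a travelling wave is
constant along the kernel of its phase (`IsWave.integral_ker`).

For strong compactons the only obstruction is smoothness. The profile behaves like `U₀ (L - |ξ|) ^
p`, whereas a `C^k` function that vanishes beyond `L` is `o((ξ - L) ^ k)`. Hence `U` is `C^k` iff `k
< p` (`IsArchWave.contDiff_iff`), and the strong conditions are `3 < p` and `4 < p`.

Conversely, the weak region is forced already by `0 < m` and `0 < L`, which fix the signs of the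
denominators in the half-width (`Family.Admissible.weakRegion`). -/

theorem hasDerivAt_max_zero_rpow {q : ℝ} (hq : 1 < q) (x : ℝ) :
    HasDerivAt (fun x : ℝ => max x 0 ^ q) (q * max x 0 ^ (q - 1)) x := by
  have hcont : ∀ r : ℝ, 0 < r → Continuous fun x : ℝ => max x 0 ^ r := fun r hr =>
    (continuous_id.max continuous_const).rpow_const fun _ => Or.inr hr.le
  -- At the kink `0` the derivative comes for free from the formula on both sides, since the
  -- function and the candidate derivative are continuous there.
  refine hasDerivAt_of_hasDerivAt_of_ne' (x := 0) (g := fun x => q * max x 0 ^ (q - 1)) ?_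
    (hcont q (by linarith)).continuousAt
    (continuous_const.mul (hcont (q - 1) (by linarith))).continuousAt x
  intro y hy
  rcases lt_or_gt_of_ne hy with hy | hy
  · have h : (fun x : ℝ => max x 0 ^ q) =ᶠ[𝓝 y] fun _ => 0 := by
      filter_upwards [gt_mem_nhds hy] with z hz
      rw [max_eq_right hz.le, Real.zero_rpow (by linarith)]
    simpa [max_eq_right hy.le, Real.zero_rpow (show q - 1 ≠ 0 by linarith)]
      using (hasDerivAt_const y (0 : ℝ)).congr_of_eventuallyEq h
  · have h : (fun x : ℝ => max x 0 ^ q) =ᶠ[𝓝 y] fun x => x ^ q := by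
      filter_upwards [lt_mem_nhds hy] with z hz
      rw [max_eq_left hz.le]
    simpa [max_eq_left hy.le] using
      (Real.hasDerivAt_rpow_const (p := q) (Or.inl hy.ne')).congr_of_eventuallyEq h

theorem contDiff_max_zero_rpow (k : ℕ) {q : ℝ} (hq : k < q) :
    ContDiff ℝ k fun x : ℝ => max x 0 ^ q := by
  induction k generalizing q with
  | zero =>
    have h0 : (0 : ℝ) < q := by simpa using hq
    exact contDiff_zero.2
      ((continuous_id.max continuous_const).rpow_const fun _ => Or.inr h0.le)
  | succ k ih =>
    push_cast at hq ⊢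
    have h1 : 1 < q := by have : (0 : ℝ) ≤ k := k.cast_nonneg; linarith
    rw [contDiff_succ_iff_deriv]
    refine ⟨fun x => (hasDerivAt_max_zero_rpow h1 x).differentiableAt, by simp, ?_⟩
    rw [show deriv (fun x : ℝ => max x 0 ^ q) = fun x => q * max x 0 ^ (q - 1) from
      funext fun x => (hasDerivAt_max_zero_rpow h1 x).deriv]
    exact contDiff_const.mul (ih (by linarith))

/-- All derivatives up to order `k` vanish to the right of `L`, hence at `L` by continuity, so the
Taylor polynomial at `L` is zero and only the Peano remainder is left. This bounds the smoothness of
a profile from above. -/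
theorem isLittleO_of_contDiff_of_zero_right {k : ℕ} {f : ℝ → ℝ} {L : ℝ} (hf : ContDiff ℝ k f)
    (h0 : ∀ x, L ≤ x → f x = 0) : f =o[𝓝 L] fun x => (x - L) ^ k := by
  have hz : ∀ i ≤ k, iteratedDeriv i f L = 0 := by
    intro i hi
    have hc : Continuous (iteratedDeriv i f) := hf.continuous_iteratedDeriv i (by exact_mod_cast hi)
    have hev : ∀ x ∈ Ioi L, iteratedDeriv i f x = 0 := by
      intro x hx
      have : f =ᶠ[𝓝 x] fun _ => 0 := by
        filter_upwards [lt_mem_nhds hx] with y hy using h0 y (le_of_lt hy)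
      rw [this.iteratedDeriv_eq i]
      simp
    have : L ∈ closure (Ioi L) := by simp
    exact closure_minimal (fun x hx => hev x hx) (isClosed_eq hc continuous_const) this
  have ht := taylor_isLittleO_univ (x₀ := L) hf
  have hT : ∀ x, taylorWithinEval f k univ L x = 0 := by
    intro x
    rw [taylor_within_apply]
    refine Finset.sum_eq_zero fun i hi => ?_
    rw [iteratedDerivWithin_univ, hz i (by simpa [Nat.lt_succ_iff] using hi), smul_zero]
  simpa [hT] using ht

/-! ### Arches and the smoothness of their cut-off powers. -/

/-- The function `v` is an even arch over `[-L, L]`, and solves `v' ^ 2 = c₀ + c₁ v ^ j` together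
with the derivative of this equation near this interval. -/
structure IsArch (v : ℝ → ℝ) (L c₀ c₁ : ℝ) (j : ℕ) : Prop where
  L_pos : 0 < L
  c₀_pos : 0 < c₀
  j_ne : j ≠ 0
  even : ∀ x, v (-x) = v x
  pos : ∀ x, |x| < L → 0 < v x
  zero : v L = 0
  -- The equation is required beyond the end points, so that `v` is smooth at `±L` and really
  -- crosses zero there.
  ode : ∃ R, L < R ∧ ∃ v' : ℝ → ℝ, ∀ x, |x| < R → HasDerivAt v (v' x) x ∧
    HasDerivAt v' (c₁ * j / 2 * v x ^ (j - 1)) x ∧ v' x ^ 2 = c₀ + c₁ * v x ^ j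

namespace IsArch

variable {v : ℝ → ℝ} {L c₀ c₁ : ℝ} {j : ℕ}

/-- The squared slope at `L` is `c₀ > 0`, and a positive slope would make `v` negative just to the
left of `L`. -/
theorem exists_deriv (h : IsArch v L c₀ c₁ j) : ∃ d < 0, HasDerivAt v d L := by
  obtain ⟨R, hR, v', hv⟩ := h.ode
  have hL : |L| < R := by rwa [abs_of_pos h.L_pos]
  obtain ⟨h1, -, h3⟩ := hv L hL
  refine ⟨v' L, ?_, h1⟩
  have hne : v' L ≠ 0 := by
    intro h0
    rw [h0, h.zero, zero_pow h.j_ne] at h3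
    have := h.c₀_pos
    simp at h3; linarith
  refine lt_of_le_of_ne ?_ hne
  by_contra! hpos
  have hs := (hasDerivAt_iff_tendsto_slope.1 h1).mono_left
    (nhdsWithin_mono L (show Iio L ⊆ {L}ᶜ from fun x hx => ne_of_lt hx))
  have e1 : ∀ᶠ x in 𝓝[<] L, 0 < slope v L x := hs.eventually (lt_mem_nhds hpos)
  have e2 : ∀ᶠ x in 𝓝[<] L, -L < x :=
    nhdsWithin_le_nhds (lt_mem_nhds (by linarith [h.L_pos]))
  obtain ⟨x, hx, hx2, hx3⟩ := (e1.and (e2.and self_mem_nhdsWithin)).exists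
  have hxL : x < L := hx3
  have := h.pos x (abs_lt.2 ⟨hx2, hxL⟩)
  rw [slope_def_field, h.zero, div_pos_iff] at hx
  rcases hx with hx | hx <;> linarith [hx.1, hx.2]

/-- The sign change of `v` at `±L` performs the cut-off, which reduces smoothness at the ends to
that of `max x 0 ^ p`. The identity is local: further out a periodic `v` becomes positive again. -/
theorem eventually_eq_max (h : IsArch v L c₀ c₁ j) (C p : ℝ) (hp : p ≠ 0) {x : ℝ}
    (hx : |x| ≤ L) :
    cutoff L (fun x => C * v x ^ p) =ᶠ[𝓝 x] fun x => C * max (v x) 0 ^ p := by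
  have hin : ∀ y, |y| < L → cutoff L (fun x => C * v x ^ p) y = C * max (v y) 0 ^ p := by
    intro y hy
    rw [cutoff, if_pos hy, max_eq_left (h.pos y hy).le]
  have hend : ∀ᶠ y in 𝓝 L, cutoff L (fun x => C * v x ^ p) y = C * max (v y) 0 ^ p := by
    obtain ⟨d, hd, hv⟩ := h.exists_deriv
    have hs := hasDerivAt_iff_tendsto_slope.1 hv
    have e1 : ∀ᶠ y in 𝓝[≠] L, slope v L y < 0 := hs.eventually (gt_mem_nhds hd)
    rw [eventually_nhdsWithin_iff] at e1
    filter_upwards [e1, lt_mem_nhds h.L_pos] with y hy hy0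
    by_cases hyL : |y| < L
    · exact hin y hyL
    · rw [abs_of_pos hy0] at hyL
      have hv0 : v y ≤ 0 := by
        rcases eq_or_ne y L with rfl | hne
        · exact h.zero.le
        · have hlt : 0 < y - L := by
            rcases lt_or_gt_of_ne hne with h' | h' <;> linarith
          have := hy hne
          rw [slope_def_field, h.zero, div_neg_iff] at this
          rcases this with h' | h' <;> linarith [h'.1, h'.2]
      rw [cutoff, if_neg (by rwa [abs_of_pos hy0]), max_eq_right hv0, Real.zero_rpow hp, mul_zero]
  rcases hx.lt_or_eq with hx | hx
  · filter_upwards [continuous_abs.continuousAt.eventually (gt_mem_nhds hx)] with y hy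
      using hin y hy
  · rcases abs_cases x with ⟨h1, -⟩ | ⟨h1, -⟩
    · rw [show x = L by linarith]; exact hend
    · rw [show x = -L by linarith]
      have ht : Tendsto (fun y : ℝ => -y) (𝓝 (-L)) (𝓝 L) := by
        simpa using (continuous_neg (G := ℝ)).tendsto (-L)
      filter_upwards [ht.eventually hend] with y hy
      rw [h.even] at hy
      rw [← hy]
      simp only [cutoff, abs_neg, h.even]

/-- Bootstrapping: the derivative of `v` is `v'` and that of `v'` is a polynomial in `v`, so both
gain one order of smoothness at each step. -/
theorem contDiffOn (h : IsArch v L c₀ c₁ j) (k : ℕ) : ∃ R, L < R ∧ ContDiffOn ℝ k v (Ioo (-R) R) := by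
  obtain ⟨R, hR, v', hv⟩ := h.ode
  refine ⟨R, hR, ?_⟩
  have hd : EqOn (deriv v) v' (Ioo (-R) R) := fun x hx => (hv x (abs_lt.2 hx)).1.deriv
  have hd' : EqOn (deriv v') (fun x => c₁ * j / 2 * v x ^ (j - 1)) (Ioo (-R) R) :=
    fun x hx => (hv x (abs_lt.2 hx)).2.1.deriv
  have hdv : DifferentiableOn ℝ v (Ioo (-R) R) := fun x hx =>
    (hv x (abs_lt.2 hx)).1.differentiableAt.differentiableWithinAt
  have hdv' : DifferentiableOn ℝ v' (Ioo (-R) R) := fun x hx =>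
    (hv x (abs_lt.2 hx)).2.1.differentiableAt.differentiableWithinAt
  suffices ContDiffOn ℝ k v (Ioo (-R) R) ∧ ContDiffOn ℝ k v' (Ioo (-R) R) from this.1
  induction k with
  | zero =>
    exact ⟨contDiffOn_zero.2 hdv.continuousOn, contDiffOn_zero.2 hdv'.continuousOn⟩
  | succ k ih =>
    push_cast
    rw [contDiffOn_succ_iff_deriv_of_isOpen isOpen_Ioo,
      contDiffOn_succ_iff_deriv_of_isOpen isOpen_Ioo]
    exact ⟨⟨hdv, by simp, ih.2.congr hd⟩,
      ⟨hdv', by simp, (contDiffOn_const.mul (ih.1.pow _)).congr hd'⟩⟩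

theorem contDiffAt (h : IsArch v L c₀ c₁ j) (k : ℕ) {x : ℝ} (hx : |x| ≤ L) :
    ContDiffAt ℝ k v x := by
  obtain ⟨R, hR, hv⟩ := h.contDiffOn k
  exact hv.contDiffAt (isOpen_Ioo.mem_nhds (abs_lt.1 (hx.trans_lt hR)))

theorem contDiff_cutoff (h : IsArch v L c₀ c₁ j) (C : ℝ) {p : ℝ} {k : ℕ} (hp : k < p) :
    ContDiff ℝ k (cutoff L fun x => C * v x ^ p) := by
  have hp0 : p ≠ 0 := (lt_of_le_of_lt k.cast_nonneg hp).ne'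
  refine contDiff_iff_contDiffAt.2 fun x => ?_
  by_cases hx : |x| ≤ L
  · refine ContDiffAt.congr_of_eventuallyEq ?_ (h.eventually_eq_max C p hp0 hx)
    exact contDiffAt_const.mul
      ((contDiff_max_zero_rpow k hp).contDiffAt.comp x (h.contDiffAt k hx))
  · refine (contDiffAt_const (c := (0 : ℝ))).congr_of_eventuallyEq ?_
    filter_upwards [continuous_abs.continuousAt.eventually (lt_mem_nhds (not_le.1 hx))] with y hy
    rw [cutoff, if_neg (not_lt.2 (le_of_lt hy))]

theorem continuous_cutoff (h : IsArch v L c₀ c₁ j) (C : ℝ) {p : ℝ} (hp : 0 < p) :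
    Continuous (cutoff L fun x => C * v x ^ p) :=
  contDiff_zero.1 (h.contDiff_cutoff (k := 0) C (by simpa using hp))

theorem support_cutoff (h : IsArch v L c₀ c₁ j) {C : ℝ} (hC : C ≠ 0) (p : ℝ) :
    Function.support (cutoff L fun x => C * v x ^ p) = Ioo (-L) L := by
  ext x
  rw [Function.mem_support, mem_Ioo, ← abs_lt, cutoff]
  split_ifs with hx
  · simp [hx, hC, (Real.rpow_pos_of_pos (h.pos x hx) p).ne']
  · simp [hx]

theorem isCompactProfile (h : IsArch v L c₀ c₁ j) {C p : ℝ} (hC : C ≠ 0) (hp : 0 < p) :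
    IsCompactProfile L (cutoff L fun x => C * v x ^ p) := by
  refine ⟨h.L_pos, h.continuous_cutoff C hp, ?_⟩
  rw [tsupport, h.support_cutoff hC, closure_Ioo (by linarith [h.L_pos])]

theorem cutoff_even (h : IsArch v L c₀ c₁ j) (C p ξ : ℝ) :
    cutoff L (fun x => C * v x ^ p) (-ξ) = cutoff L (fun x => C * v x ^ p) ξ := by
  simp only [cutoff, abs_neg, h.even]

theorem hasEndBehaviour (h : IsArch v L c₀ c₁ j) {C : ℝ} (hC : C ≠ 0) (p : ℝ) :
    HasEndBehaviour (cutoff L fun x => C * v x ^ p) L p := by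
  obtain ⟨d, hd, hv⟩ := h.exists_deriv
  have hs := (hasDerivAt_iff_tendsto_slope.1 hv).mono_left
    (nhdsWithin_mono L (show Iio L ⊆ {L}ᶜ from fun x hx => ne_of_lt hx))
  have h1 : Tendsto (fun ξ => cutoff L (fun x => C * v x ^ p) ξ / (L - |ξ|) ^ p) (𝓝[<] L)
      (𝓝 (C * (-d) ^ p)) := by
    -- Since `v L = 0`, the quotient `v x / (L - x)` is minus the slope of `v` between `x` and `L`,
    -- which tends to `-d > 0`.
    have : Tendsto (fun x => C * (-slope v L x) ^ p) (𝓝[<] L) (𝓝 (C * (-d) ^ p)) :=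
      (hs.neg.rpow_const (Or.inl (by linarith))).const_mul C
    refine this.congr' ?_
    filter_upwards [self_mem_nhdsWithin, nhdsWithin_le_nhds (lt_mem_nhds h.L_pos)] with x hx hx0
    have hxL : x < L := hx
    have hx1 : |x| < L := by rwa [abs_of_pos hx0]
    rw [cutoff, if_pos hx1, abs_of_pos hx0, mul_div_assoc,
      ← Real.div_rpow (h.pos x hx1).le (by linarith), slope_def_field, h.zero, ← div_neg]
    simp
  refine ⟨C * (-d) ^ p, mul_ne_zero hC (Real.rpow_pos_of_pos (by linarith) p).ne', h1, ?_⟩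
  have ht : Tendsto (fun y : ℝ => -y) (𝓝[>] (-L)) (𝓝[<] L) := by
    simpa using tendsto_neg_nhdsGT (a := -L)
  refine (h1.comp ht).congr fun x => ?_
  simp only [Function.comp, h.cutoff_even, abs_neg]

/-- If `p ≤ k`, then within distance `1` of `L` division by `(L - x) ^ p` gives at most the result
of division by `(L - x) ^ k`, which tends to zero for a `C^k` profile. This contradicts `U₀ ≠ 0`. -/
theorem lt_of_contDiff_cutoff (h : IsArch v L c₀ c₁ j) {C p : ℝ} (hC : C ≠ 0) {k : ℕ}
    (hk : ContDiff ℝ k (cutoff L fun x => C * v x ^ p)) : k < p := by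
  by_contra! hp
  obtain ⟨U₀, hU, h1, -⟩ := h.hasEndBehaviour hC p
  have h2 := isLittleO_of_contDiff_of_zero_right (L := L) hk (fun x hx => by
    rw [cutoff, if_neg (not_lt.2 (hx.trans (le_abs_self x)))])
  have h3 := (h2.tendsto_div_nhds_zero.mono_left (nhdsWithin_le_nhds (s := Iio L))).abs
  have ev : ∀ᶠ x in 𝓝[<] L, |cutoff L (fun x => C * v x ^ p) x / (L - |x|) ^ p| ≤
      |cutoff L (fun x => C * v x ^ p) x / (x - L) ^ k| := by
    filter_upwards [self_mem_nhdsWithin, nhdsWithin_le_nhds (lt_mem_nhds h.L_pos),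
      nhdsWithin_le_nhds (lt_mem_nhds (show L - 1 < L by linarith))] with x hx hx0 hx1
    have hxL : 0 < L - x := sub_pos.2 hx
    rw [abs_div, abs_div, abs_of_pos hx0]
    refine div_le_div_of_nonneg_left (abs_nonneg _) (by
      have := sub_neg.2 (show x < L from hx)
      exact abs_pos.2 (pow_ne_zero _ this.ne)) ?_
    rw [abs_pow, abs_sub_comm, abs_of_pos hxL, abs_of_pos (Real.rpow_pos_of_pos hxL p),
      ← Real.rpow_natCast]
    exact Real.rpow_le_rpow_of_exponent_ge hxL (by linarith) hp
  have h4 := squeeze_zero' (Eventually.of_forall fun _ => abs_nonneg _) ev (by simpa using h3)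
  have h5 := tendsto_nhds_unique h4 h1.abs
  exact hU (abs_eq_zero.1 h5.symm)

/-- Second derivative of a power of an arch in the interior. -/
theorem iteratedDeriv_two_rpow (h : IsArch v L c₀ c₁ j) (D q : ℝ) {x : ℝ} (hx : |x| < L) :
    iteratedDeriv 2 (cutoff L fun x => D * v x ^ q) x =
      D * (q * (q - 1) * c₀ * v x ^ (q - 2) + q * (q - 1 + j / 2) * c₁ * v x ^ (q - 2 + j)) := by
  obtain ⟨R, hR, v', hv⟩ := h.ode
  have hnb : ∀ᶠ y in 𝓝 x, |y| < L := continuous_abs.continuousAt.eventually (gt_mem_nhds hx)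
  have e1 : ∀ᶠ y in 𝓝 x, HasDerivAt (cutoff L fun x => D * v x ^ q)
      (D * (v' y * q * v y ^ (q - 1))) y := by
    filter_upwards [hnb] with y hy
    have : cutoff L (fun x => D * v x ^ q) =ᶠ[𝓝 y] fun x => D * v x ^ q := by
      filter_upwards [continuous_abs.continuousAt.eventually (gt_mem_nhds hy)] with z hz
      rw [cutoff, if_pos hz]
    exact (((hv y (hy.trans hR)).1.rpow_const (Or.inl (h.pos y hy).ne')).const_mul
      D).congr_of_eventuallyEq this
  have e2 : deriv (cutoff L fun x => D * v x ^ q) =ᶠ[𝓝 x]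
      fun y => D * (v' y * q * v y ^ (q - 1)) := e1.mono fun y hy => hy.deriv
  rw [iteratedDeriv_succ, iteratedDeriv_one, e2.deriv_eq]
  obtain ⟨d1, d2, d3⟩ := hv x (hx.trans hR)
  have hp := h.pos x hx
  have d4 := ((d2.mul_const q).mul (d1.rpow_const (p := q - 1) (Or.inl hp.ne'))).const_mul D
  refine d4.deriv.trans ?_
  -- With `j = i + 1` the truncated exponent `j - 1` becomes `i`. It remains to replace `v' ^ 2` by
  -- `c₀ + c₁ v ^ j`, which leaves only two powers of `v`.
  obtain ⟨i, rfl⟩ := Nat.exists_eq_succ_of_ne_zero h.j_ne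
  have r1 : v x ^ (q - 1) = v x ^ (q - 2) * v x := by
    rw [← Real.rpow_add_one hp.ne']; ring_nf
  have r2 : v x ^ (q - 2 + (i.succ : ℕ)) = v x ^ (q - 2) * v x ^ i * v x := by
    rw [Real.rpow_add_natCast hp.ne', pow_succ, mul_assoc]
  have r3 : q - 1 - 1 = q - 2 := by ring
  rw [r3, r2, r1]
  simp only [Nat.succ_eq_add_one, Nat.add_sub_cancel] at d3 ⊢
  have : v' x * q * ((v' x * (q - 1)) * v x ^ (q - 2)) =
    q * (q - 1) * v x ^ (q - 2) * (c₀ + c₁ * v x ^ (i + 1)) := by rw [← d3]; ring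
  linear_combination D * this

end IsArch
/-! ### Directional derivatives of test functions -/

section Directional

variable {E : Type*} [NormedAddCommGroup E] [NormedSpace ℝ E]

/-- Derivative of `ψ` in the direction `w`. -/
noncomputable def dirDeriv (w : E) (ψ : E → ℝ) (x : E) : ℝ := fderiv ℝ ψ x w

theorem dirDeriv_add_smul (w₁ w₂ : E) (c : ℝ) (ψ : E → ℝ) (x : E) :
    dirDeriv (w₁ + c • w₂) ψ x = dirDeriv w₁ ψ x + c * dirDeriv w₂ ψ x := by
  simp [dirDeriv]

/-- A test function. -/
structure IsTest (ψ : E → ℝ) : Prop where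
  smooth : ContDiff ℝ ∞ ψ
  compact : HasCompactSupport ψ

namespace IsTest

variable {ψ : E → ℝ}

theorem dir (h : IsTest ψ) (w : E) : IsTest (dirDeriv w ψ) :=
  ⟨(h.smooth.fderiv_right (m := ∞) (by simp)).clm_apply contDiff_const,
    h.compact.fderiv_apply (𝕜 := ℝ) w⟩

theorem differentiable (h : IsTest ψ) : Differentiable ℝ ψ := h.smooth.differentiable (by simp)

theorem integrable_mul [MeasurableSpace E] [BorelSpace E] {μ : Measure E}
    [IsFiniteMeasureOnCompacts μ] (h : IsTest ψ) {f : E → ℝ} (hf : Continuous f) :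
    Integrable (fun x => f x * ψ x) μ :=
  (hf.mul h.smooth.continuous).integrable_of_hasCompactSupport h.compact.mul_left

theorem dirDeriv_comm (h : IsTest ψ) (w₁ w₂ : E) (x : E) :
    dirDeriv w₁ (dirDeriv w₂ ψ) x =
      dirDeriv w₂ (dirDeriv w₁ ψ) x := by
  have hs : IsSymmSndFDerivAt ℝ ψ x :=
    h.smooth.contDiffAt.isSymmSndFDerivAt (by
      simpa using WithTop.coe_le_coe.2 (le_top (a := (2 : ℕ∞))))
  have hd : DifferentiableAt ℝ (fderiv ℝ ψ) x :=
    (h.smooth.fderiv_right (m := ∞) (by simp)).differentiable (by simp) x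
  have key : ∀ u w : E, dirDeriv u (dirDeriv w ψ) x =
      fderiv ℝ (fderiv ℝ ψ) x u w := by
    intro u w
    change fderiv ℝ (fun y => fderiv ℝ ψ y w) x u = _
    rw [fderiv_clm_apply hd (differentiableAt_const w)]
    simp
  rw [key, key, hs.eq]

/-- Translates the coordinate derivatives of the weak formulations into iterated directional
derivatives, for which integration by parts is available. -/
theorem iteratedDeriv_line (h : IsTest ψ) (q w : E) (k : ℕ) (s : ℝ) :
    iteratedDeriv k (fun s : ℝ => ψ (q + s • w)) s = (dirDeriv w)^[k] ψ (q + s • w) := by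
  have hd : ∀ {χ : E → ℝ}, IsTest χ → ∀ s : ℝ,
      deriv (fun s : ℝ => χ (q + s • w)) s = dirDeriv w χ (q + s • w) := by
    intro χ hχ s
    have h1 : HasDerivAt (fun s : ℝ => q + s • w) w s := by
      simpa using ((hasDerivAt_id s).smul_const w).const_add q
    exact ((hχ.differentiable _).hasFDerivAt.comp_hasDerivAt s h1).deriv
  induction k generalizing ψ with
  | zero => simp
  | succ k ih =>
    rw [iteratedDeriv_succ', show deriv (fun s : ℝ => ψ (q + s • w)) =
      fun s => dirDeriv w ψ (q + s • w) from funext (hd h), ih (h.dir w),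
      Function.iterate_succ_apply]

end IsTest

variable [FiniteDimensional ℝ E] [MeasurableSpace E] [BorelSpace E] {μ : Measure E}
  [μ.IsAddHaarMeasure]

/-- Only the derivative of `f` along `w` is needed. This is what admits profiles that are merely
continuous. -/
theorem IsTest.integral_mul_dirDeriv {ψ f f' : E → ℝ} {w : E} (h : IsTest ψ) (hf : Continuous f)
    (hf' : Continuous f') (hd : ∀ x, HasLineDerivAt ℝ f (f' x) x w) :
    ∫ x, f x * dirDeriv w ψ x ∂μ = -∫ x, f' x * ψ x ∂μ :=
  integral_bilinear_hasLineDerivAt_right_eq_neg_left_of_integrable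
    (B := ContinuousLinearMap.mul ℝ ℝ) (h.integrable_mul hf') ((h.dir w).integrable_mul hf)
    (h.integrable_mul hf) (fun x _ => hd x)
    (fun x _ => (h.differentiable x).hasFDerivAt.hasLineDerivAt w)

end Directional

theorem hasLineDerivAt_comp_clm {E : Type*} [NormedAddCommGroup E] [NormedSpace ℝ E]
    {f : ℝ → ℝ} {f' : ℝ} (l : E →L[ℝ] ℝ) {x : E} (hf : HasDerivAt f f' (l x)) (w : E) :
    HasLineDerivAt ℝ (fun x => f (l x)) (f' * l w) x w :=
  (hf.comp_hasFDerivAt x l.hasFDerivAt).hasLineDerivAt w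

/-- A function of `l x` is invariant in the directions of the kernel of `l`, even if it is merely
continuous. -/
theorem hasLineDerivAt_zero_of_ker {E : Type*} [NormedAddCommGroup E] [NormedSpace ℝ E]
    (f : ℝ → ℝ) (l : E →L[ℝ] ℝ) (x : E) {w : E} (hw : l w = 0) :
    HasLineDerivAt ℝ (fun x => f (l x)) 0 x w := by
  simp [HasLineDerivAt, hw, hasDerivAt_const]

/-! ### Travelling waves -/

/-- A continuous bounded profile, with continuous real power `U ^ m` and twice continuously
differentiable real power `U ^ n`, that solves `-g U + a U ^ m + b (U ^ n)'' = 0`. -/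
structure IsWave (a b g m n : ℝ) (U : ℝ → ℝ) : Prop where
  m_pos : 0 < m
  powDefined : ∀ ξ, PowDefined (U ξ) m ∧ PowDefined (U ξ) n
  cont : Continuous U
  bounded : ∃ B : ℝ, ∀ ξ, |U ξ| ≤ B
  cont_m : Continuous fun ξ => realPow (U ξ) m
  contDiff_n : ContDiff ℝ 2 fun ξ => realPow (U ξ) n
  eqn : ∀ ξ, b * iteratedDeriv 2 (fun ξ => realPow (U ξ) n) ξ = g * U ξ - a * realPow (U ξ) m

namespace IsWave

variable {a b g m n : ℝ} {U : ℝ → ℝ}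

theorem waveFlux_eq_zero (h : IsWave a b g m n U) : waveFlux a b g m n U = fun _ => 0 := by
  funext ξ
  rw [waveFlux, h.eqn]; ring

theorem hasDerivAt_n (h : IsWave a b g m n U) (ξ : ℝ) :
    HasDerivAt (fun ξ => realPow (U ξ) n) (deriv (fun ξ => realPow (U ξ) n) ξ) ξ :=
  (h.contDiff_n.differentiable (by simp) ξ).hasDerivAt

theorem hasDerivAt_deriv_n (h : IsWave a b g m n U) (ξ : ℝ) :
    HasDerivAt (deriv fun ξ => realPow (U ξ) n)
      (iteratedDeriv 2 (fun ξ => realPow (U ξ) n) ξ) ξ := by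
  have h1 : ContDiff ℝ (1 + 1) fun ξ => realPow (U ξ) n := by
    simpa [one_add_one_eq_two] using h.contDiff_n
  rw [contDiff_succ_iff_deriv] at h1
  rw [iteratedDeriv_succ, iteratedDeriv_one]
  exact (h1.2.2.differentiable (by simp) ξ).hasDerivAt

section

variable {E : Type*} [NormedAddCommGroup E] [NormedSpace ℝ E] [FiniteDimensional ℝ E]
  [MeasurableSpace E] [BorelSpace E] {μ : Measure E} [μ.IsAddHaarMeasure]

/-- Weak form of the wave equation against test functions on a space in which the wave variable is
the linear functional `l`. -/
theorem integral_flux (h : IsWave a b g m n U) (l : E →L[ℝ] ℝ) {w : E} (hw : l w = 1)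
    {ψ : E → ℝ} (hψ : IsTest ψ) :
    ∫ x, b * realPow (U (l x)) n * dirDeriv w (dirDeriv w ψ) x ∂μ =
      ∫ x, (g * U (l x) - a * realPow (U (l x)) m) * ψ x ∂μ := by
  set G : ℝ → ℝ := fun ξ => realPow (U ξ) n with hG
  have c0 : Continuous fun x => G (l x) := h.contDiff_n.continuous.comp l.continuous
  have c1 : Continuous fun x => deriv G (l x) := by
    have := h.contDiff_n.continuous_iteratedDeriv 1 (by norm_num)
    rw [iteratedDeriv_one] at this
    exact this.comp l.continuous
  have c2 : Continuous fun x => iteratedDeriv 2 G (l x) :=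
    (h.contDiff_n.continuous_iteratedDeriv 2 le_rfl).comp l.continuous
  have d0 : ∀ x, HasLineDerivAt ℝ (fun x => G (l x)) (deriv G (l x)) x w := fun x => by
    simpa [hw] using hasLineDerivAt_comp_clm l (h.hasDerivAt_n (l x)) w
  have d1 : ∀ x, HasLineDerivAt ℝ (fun x => deriv G (l x)) (iteratedDeriv 2 G (l x)) x w :=
    fun x => by simpa [hw] using hasLineDerivAt_comp_clm l (h.hasDerivAt_deriv_n (l x)) w
  -- Both integrations by parts move derivatives onto `U ^ n`, which is `C²`; `U` and `U ^ m` are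
  -- never differentiated.
  have i1 := (hψ.dir w).integral_mul_dirDeriv (μ := μ) c0 c1 d0
  have i2 := hψ.integral_mul_dirDeriv (μ := μ) c1 c2 d1
  simp only [mul_assoc]
  rw [integral_const_mul]
  change b * ∫ x, G (l x) * dirDeriv w (dirDeriv w ψ) x ∂μ = _
  rw [i1, i2, neg_neg, ← integral_const_mul]
  refine integral_congr_ae (Eventually.of_forall fun x => ?_)
  change b * (iteratedDeriv 2 G (l x) * ψ x) = _
  rw [← mul_assoc, h.eqn]

/-- The wave is constant along the kernel of its phase `l`. This exchanges derivatives of the test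
function in `t` and `y` for derivatives in `x`. -/
theorem integral_ker (h : IsWave a b g m n U) (l : E →L[ℝ] ℝ) {w : E} (hw : l w = 0)
    {ψ : E → ℝ} (hψ : IsTest ψ) : ∫ x, U (l x) * dirDeriv w ψ x ∂μ = 0 := by
  rw [hψ.integral_mul_dirDeriv (f := fun x => U (l x)) (f' := fun _ => 0)
    (h.cont.comp l.continuous) continuous_const
    fun x => hasLineDerivAt_zero_of_ker U l x hw]
  simp

end

theorem isWeakSolODE3 (h : IsWave a b g m n U) : IsWeakSolODE3 a b g m n U := by
  intro φ hφ hc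
  have ht : IsTest φ := ⟨hφ, hc⟩
  have e1 : ∀ ξ, deriv φ ξ = dirDeriv 1 φ ξ := fun ξ => by simp [dirDeriv]
  have e3 : ∀ ξ, iteratedDeriv 3 φ ξ = dirDeriv 1 (dirDeriv 1 (dirDeriv 1 φ)) ξ := fun ξ => by
    simpa using ht.iteratedDeriv_line 0 1 3 ξ
  simp only [e1, e3]
  have ht1 := ht.dir 1
  have ht3 := (ht1.dir 1).dir 1
  have i1 : Integrable fun ξ => (-g * U ξ + a * realPow (U ξ) m) * dirDeriv 1 φ ξ :=
    ht1.integrable_mul (by have := h.cont; have := h.cont_m; fun_prop)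
  have i3 : Integrable fun ξ => b * realPow (U ξ) n * dirDeriv 1 (dirDeriv 1 (dirDeriv 1 φ)) ξ :=
    ht3.integrable_mul (continuous_const.mul h.contDiff_n.continuous)
  refine ⟨i1.fun_add i3, ?_⟩
  rw [integral_add i1 i3]
  have := h.integral_flux (μ := volume) (.id ℝ ℝ) (w := 1) (by simp) ht1
  simp only [ContinuousLinearMap.id_apply] at this
  rw [this, ← integral_add i1]
  · simp [← add_mul]
  · exact ht1.integrable_mul (by have := h.cont; have := h.cont_m; fun_prop)

theorem isWeakSolODE4 (h : IsWave a b g m n U) : IsWeakSolODE4 a b g m n U := by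
  intro φ hφ hc
  have ht : IsTest φ := ⟨hφ, hc⟩
  have hd : deriv φ = dirDeriv 1 φ := funext fun ξ => by simp [dirDeriv]
  -- The fourth-order weak form is the third-order one tested with `φ'`.
  have := h.isWeakSolODE3 (deriv φ) (hd ▸ (ht.dir 1).smooth) (hd ▸ (ht.dir 1).compact)
  have e2 : iteratedDeriv 2 φ = deriv (deriv φ) := by rw [iteratedDeriv_succ', iteratedDeriv_one]
  have e4 : iteratedDeriv 4 φ = iteratedDeriv 3 (deriv φ) := iteratedDeriv_succ'
  simpa only [e2, e4] using this

/-- The constant does not depend on the argument `f`; with `f` the phase at time `t` this is the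
uniformity in `t`. -/
theorem exists_lintegral_le (h : IsWave a b g m n U) {X : Type*} [MeasurableSpace X]
    {μ : Measure X} {S : Set X} (hS : μ S ≠ ⊤) :
    ∃ C : ℝ, ∀ f : X → ℝ, ∫⁻ x in S, ‖U (f x)‖ₑ ^ (max m n) ∂μ ≤ ENNReal.ofReal C := by
  obtain ⟨B, hB⟩ := h.bounded
  have hmn : 0 ≤ max m n := h.m_pos.le.trans (le_max_left _ _)
  have hfin : ENNReal.ofReal B ^ (max m n) * μ S ≠ ⊤ :=
    ENNReal.mul_ne_top (ENNReal.rpow_ne_top_of_nonneg hmn ENNReal.ofReal_ne_top) hS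
  refine ⟨(ENNReal.ofReal B ^ (max m n) * μ S).toReal, fun f => ?_⟩
  rw [ENNReal.ofReal_toReal hfin]
  calc ∫⁻ x in S, ‖U (f x)‖ₑ ^ (max m n) ∂μ
      ≤ ∫⁻ _ in S, ENNReal.ofReal B ^ (max m n) ∂μ := by
        refine lintegral_mono fun x => ENNReal.rpow_le_rpow ?_ hmn
        rw [Real.enorm_eq_ofReal_abs]
        exact ENNReal.ofReal_le_ofReal (hB _)
    _ = _ := by simp

theorem isWeakSolK (h : IsWave a b g m n U) :
    IsWeakSolK a b m n (fun t x => U (x - g * t)) := by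
  have : (volume : Measure (ℝ × ℝ)).IsAddHaarMeasure :=
    Measure.prod.instIsAddHaarMeasure _ _
  let l : ℝ × ℝ →L[ℝ] ℝ := .snd ℝ ℝ ℝ - g • .fst ℝ ℝ ℝ
  have hl : ∀ p : ℝ × ℝ, U (p.2 - g * p.1) = U (l p) := fun p => by simp [l]
  refine ⟨fun t x => h.powDefined _, ?_, fun R => ?_, fun ψ hψ hc => ?_⟩
  · simp only [hl]
    exact (h.cont.comp l.continuous).aestronglyMeasurable
  · obtain ⟨C, hC⟩ := h.exists_lintegral_le (μ := volume) (S := Icc (-R) R) (by simp)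
    exact ⟨C, Eventually.of_forall fun t => hC fun x => x - g * t⟩
  have ht : IsTest ψ := ⟨hψ, hc⟩
  have et : ∀ p : ℝ × ℝ, deriv (fun t => ψ (t, p.2)) p.1 = dirDeriv (1, 0) ψ p := fun p => by
    simpa using ht.iteratedDeriv_line (0, p.2) (1, 0) 1 p.1
  have ex : ∀ p : ℝ × ℝ, deriv (fun x => ψ (p.1, x)) p.2 = dirDeriv (0, 1) ψ p := fun p => by
    simpa using ht.iteratedDeriv_line (p.1, 0) (0, 1) 1 p.2
  have ex3 : ∀ p : ℝ × ℝ, iteratedDeriv 3 (fun x => ψ (p.1, x)) p.2 =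
      dirDeriv (0, 1) (dirDeriv (0, 1) (dirDeriv (0, 1) ψ)) p := fun p => by
    simpa using ht.iteratedDeriv_line (p.1, 0) (0, 1) 3 p.2
  simp only [hl, et, ex, ex3]
  have hU := h.cont.comp l.continuous
  have hUm := h.cont_m.comp l.continuous
  have hUn := h.contDiff_n.continuous.comp l.continuous
  simp only [Function.comp_def] at hU hUm hUn
  have tx := ht.dir (0, 1)
  have i1 : Integrable fun p : ℝ × ℝ => U (l p) * dirDeriv (1, 0) ψ p :=
    (ht.dir _).integrable_mul hU
  have i2 : Integrable fun p : ℝ × ℝ => a * realPow (U (l p)) m * dirDeriv (0, 1) ψ p :=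
    tx.integrable_mul (hUm.const_mul a)
  have i3 : Integrable fun p : ℝ × ℝ => b * realPow (U (l p)) n *
      dirDeriv (0, 1) (dirDeriv (0, 1) (dirDeriv (0, 1) ψ)) p :=
    ((tx.dir _).dir _).integrable_mul (hUn.const_mul b)
  have i4 : Integrable fun p : ℝ × ℝ =>
      (g * U (l p) - a * realPow (U (l p)) m) * dirDeriv (0, 1) ψ p :=
    tx.integrable_mul ((hU.const_mul g).sub (hUm.const_mul a))
  have i12 := i1.fun_add i2
  refine ⟨i12.fun_add i3, ?_⟩
  rw [integral_add i12 i3, h.integral_flux l (by simp [l]) tx,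
    ← integral_add i12 i4]
  -- What remains is `U` times `ψ_t + g ψ_x`, a derivative along a direction on which the phase `x -
  -- g t` is constant.
  refine Eq.trans ?_
    (h.integral_ker (μ := volume) l (w := (1, 0) + g • (0, 1)) (by simp [l]) ht)
  refine integral_congr_ae (Eventually.of_forall fun p => ?_)
  simp only [dirDeriv_add_smul]
  ring

theorem isWeakSolKP {σ μ ν : ℝ} (h : IsWave a b (ν - σ * μ ^ 2) m n U) :
    IsWeakSolKP a b σ m n (fun t x y => U (x + μ * y - ν * t)) := by
  have : (volume : Measure (ℝ × ℝ)).IsAddHaarMeasure :=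
    Measure.prod.instIsAddHaarMeasure _ _
  have : (volume : Measure (ℝ × ℝ × ℝ)).IsAddHaarMeasure :=
    Measure.prod.instIsAddHaarMeasure _ _
  let l : ℝ × ℝ × ℝ →L[ℝ] ℝ := (.fst ℝ ℝ ℝ ∘L .snd ℝ ℝ (ℝ × ℝ)) +
    μ • (.snd ℝ ℝ ℝ ∘L .snd ℝ ℝ (ℝ × ℝ)) - ν • .fst ℝ ℝ (ℝ × ℝ)
  have hl : ∀ p : ℝ × ℝ × ℝ, U (p.2.1 + μ * p.2.2 - ν * p.1) = U (l p) := fun p => by simp [l]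
  refine ⟨fun t x y => h.powDefined _, ?_, fun R => ?_, fun ψ hψ hc => ?_⟩
  · simp only [hl]
    exact (h.cont.comp l.continuous).aestronglyMeasurable
  · obtain ⟨C, hC⟩ := h.exists_lintegral_le (μ := volume) (S := Icc (-R) R ×ˢ Icc (-R) R)
      (isCompact_Icc.prod isCompact_Icc).measure_ne_top
    exact ⟨C, Eventually.of_forall fun t => hC fun q => q.1 + μ * q.2 - ν * t⟩
  have ht : IsTest ψ := ⟨hψ, hc⟩
  set et : ℝ × ℝ × ℝ := (1, 0, 0) with het
  set ex : ℝ × ℝ × ℝ := (0, 1, 0) with hex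
  set ey : ℝ × ℝ × ℝ := (0, 0, 1) with hey
  have tx := ht.dir ex
  have txx := tx.dir ex
  have ty := ht.dir ey
  have dx : ∀ p : ℝ × ℝ × ℝ, deriv (fun x => ψ (p.1, x, p.2.2)) p.2.1 = dirDeriv ex ψ p :=
    fun p => by simpa [ex] using ht.iteratedDeriv_line (p.1, 0, p.2.2) ex 1 p.2.1
  have dtx : ∀ p : ℝ × ℝ × ℝ, deriv (fun t => deriv (fun x => ψ (t, x, p.2.2)) p.2.1) p.1 =
      dirDeriv et (dirDeriv ex ψ) p := fun p => by
    have : (fun t => deriv (fun x => ψ (t, x, p.2.2)) p.2.1) = fun t => dirDeriv ex ψ (t, p.2) :=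
      funext fun t => dx (t, p.2)
    rw [this]
    simpa [et, ← Prod.zero_eq_mk] using tx.iteratedDeriv_line (0, p.2) et 1 p.1
  have dyy : ∀ p : ℝ × ℝ × ℝ, iteratedDeriv 2 (fun y => ψ (p.1, p.2.1, y)) p.2.2 =
      dirDeriv ey (dirDeriv ey ψ) p := fun p => by
    simpa [ey] using ht.iteratedDeriv_line (p.1, p.2.1, 0) ey 2 p.2.2
  have dxx : ∀ p : ℝ × ℝ × ℝ, iteratedDeriv 2 (fun x => ψ (p.1, x, p.2.2)) p.2.1 =
      dirDeriv ex (dirDeriv ex ψ) p := fun p => by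
    simpa [ex] using ht.iteratedDeriv_line (p.1, 0, p.2.2) ex 2 p.2.1
  have dxxxx : ∀ p : ℝ × ℝ × ℝ, iteratedDeriv 4 (fun x => ψ (p.1, x, p.2.2)) p.2.1 =
      dirDeriv ex (dirDeriv ex (dirDeriv ex (dirDeriv ex ψ))) p := fun p => by
    simpa [ex] using ht.iteratedDeriv_line (p.1, 0, p.2.2) ex 4 p.2.1
  simp only [hl, dtx, dyy, dxx, dxxxx]
  have hU := h.cont.comp l.continuous
  have hUm := h.cont_m.comp l.continuous
  have hUn := h.contDiff_n.continuous.comp l.continuous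
  simp only [Function.comp_def] at hU hUm hUn
  have i1 : Integrable fun p => U (l p) * dirDeriv et (dirDeriv ex ψ) p :=
    (tx.dir _).integrable_mul hU
  have i2 : Integrable fun p => σ * U (l p) * dirDeriv ey (dirDeriv ey ψ) p :=
    (ty.dir _).integrable_mul (hU.const_mul σ)
  have i3 : Integrable fun p => a * realPow (U (l p)) m * dirDeriv ex (dirDeriv ex ψ) p :=
    txx.integrable_mul (hUm.const_mul a)
  have i4 : Integrable fun p => b * realPow (U (l p)) n *
      dirDeriv ex (dirDeriv ex (dirDeriv ex (dirDeriv ex ψ))) p :=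
    ((txx.dir _).dir _).integrable_mul (hUn.const_mul b)
  have i5 : Integrable fun p => ((ν - σ * μ ^ 2) * U (l p) - a * realPow (U (l p)) m) *
      dirDeriv ex (dirDeriv ex ψ) p :=
    txx.integrable_mul ((hU.const_mul _).sub (hUm.const_mul a))
  have i123 := (i1.fun_add i2).fun_add i3
  refine ⟨i123.fun_add i4, ?_⟩
  have lx : l ex = 1 := by simp [l, ex]
  -- The directions `∂_t + ν ∂_x` and `∂_y - μ ∂_x` span the kernel of the phase. The second is used
  -- twice, to replace `ψ_yy` by `μ ψ_xy` and then by `μ² ψ_xx`; this produces `g = ν - σ μ²`.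
  have k1 := h.integral_ker (μ := volume) l (w := et + ν • ex) (by simp [l, ex, et]) tx
  have k2 := h.integral_ker (μ := volume) l (w := ey + (-μ) • ex) (by simp [l, ex, ey]) ty
  have k3 := h.integral_ker (μ := volume) l (w := ey + (-μ) • ex) (by simp [l, ex, ey]) tx
  have j1 : Integrable fun p => U (l p) * dirDeriv (et + ν • ex) (dirDeriv ex ψ) p :=
    (tx.dir _).integrable_mul hU
  have j2 : Integrable fun p => U (l p) * dirDeriv (ey + (-μ) • ex) (dirDeriv ey ψ) p :=
    (ty.dir _).integrable_mul hU
  have j3 : Integrable fun p => U (l p) * dirDeriv (ey + (-μ) • ex) (dirDeriv ex ψ) p :=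
    (tx.dir _).integrable_mul hU
  rw [integral_add i123 i4, h.integral_flux l lx txx,
    ← integral_add i123 i5]
  calc _ = ∫ p, (U (l p) * dirDeriv (et + ν • ex) (dirDeriv ex ψ) p +
        (σ * (U (l p) * dirDeriv (ey + (-μ) • ex) (dirDeriv ey ψ) p) +
        σ * μ * (U (l p) * dirDeriv (ey + (-μ) • ex) (dirDeriv ex ψ) p))) := by
        refine integral_congr_ae (Eventually.of_forall fun p => ?_)
        simp only [dirDeriv_add_smul, ht.dirDeriv_comm ex ey]
        ring
    _ = 0 := by
        rw [integral_add j1 ((j2.const_mul _).fun_add (j3.const_mul _)),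
          integral_add (j2.const_mul _) (j3.const_mul _), integral_const_mul, integral_const_mul,
          k1, k2, k3]
        simp

end IsWave
-- Amplitudes of either sign and the passage from arches to travelling waves.
theorem EvenOverOdd.oddDen {r : ℝ} (h : EvenOverOdd r) : OddDen r := by
  obtain ⟨q, hq, ho, -⟩ := h
  exact ⟨q, hq, ho⟩

/-- The amplitude `C` is positive, or negative with an even exponent `r`. -/
def SignOK (C r : ℝ) : Prop := 0 < C ∨ C < 0 ∧ EvenOverOdd r

theorem SignOK.powDefined {C r y : ℝ} (h : SignOK C r) (hy : 0 ≤ y) : PowDefined (C * y) r := by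
  rcases h with h | h
  · exact Or.inl (by positivity)
  · exact Or.inr h.2.oddDen

theorem SignOK.realPow_mul {C r y : ℝ} (h : SignOK C r) (hr : 0 < r) (hy : 0 ≤ y) :
    realPow (C * y) r = |C| ^ r * y ^ r := by
  rcases h with h | ⟨h, h2⟩
  · rw [realPow, if_pos (by positivity), abs_of_pos h, Real.mul_rpow h.le hy]
  · rcases hy.eq_or_lt with rfl | hy
    · simp [realPow, Real.zero_rpow hr.ne']
    · rw [realPow, if_neg (not_le.2 (mul_neg_of_neg_of_pos h hy)), if_pos h2, abs_mul,
        Real.mul_rpow (abs_nonneg C) (abs_nonneg y), abs_of_pos hy]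

/-- The relations between the coefficients of the arch equation `v' ^ 2 = c₀ + c₁ v ^ j` and those
of the wave equation that make `C v ^ p` a travelling wave. -/
structure IsBalanced (a b g m n C p c₀ c₁ : ℝ) (j : ℕ) : Prop where
  m_pos : 0 < m
  n_pos : 0 < n
  p_pos : 0 < p
  -- This makes `U ^ n` twice continuously differentiable across the end points.
  two_lt : 2 < p * n
  sign_m : SignOK C m
  sign_n : SignOK C n
  balance : ∀ y : ℝ, 0 < y → b * |C| ^ n * (p * n * (p * n - 1) * c₀ * y ^ (p * n - 2) +
      p * n * (p * n - 1 + j / 2) * c₁ * y ^ (p * n - 2 + j)) =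
    g * C * y ^ p - a * |C| ^ m * y ^ (p * m)

section

variable {v : ℝ → ℝ} {L c₀ c₁ a b g m n C p : ℝ} {j : ℕ}

theorem IsArch.realPow_cutoff (h : IsArch v L c₀ c₁ j) {r : ℝ} (hr : 0 < r)
    (hC : SignOK C r) :
    (fun ξ => realPow (cutoff L (fun x => C * v x ^ p) ξ) r) =
      cutoff L fun x => |C| ^ r * v x ^ (p * r) := by
  funext ξ
  simp only [cutoff]
  split_ifs with hξ
  · have := h.pos ξ hξ
    rw [hC.realPow_mul hr (Real.rpow_nonneg this.le p), ← Real.rpow_mul this.le]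
  · simp [realPow, Real.zero_rpow hr.ne']

theorem IsArch.powDefined_cutoff (h : IsArch v L c₀ c₁ j) {r : ℝ} (hC : SignOK C r) (ξ : ℝ) :
    PowDefined (cutoff L (fun x => C * v x ^ p) ξ) r := by
  simp only [cutoff]
  split_ifs with hξ
  · exact hC.powDefined (Real.rpow_nonneg (h.pos ξ hξ).le p)
  · exact Or.inl le_rfl

theorem IsArch.isWave (h : IsArch v L c₀ c₁ j) (hb : IsBalanced a b g m n C p c₀ c₁ j) :
    IsWave a b g m n (cutoff L fun x => C * v x ^ p) := by
  have em := h.realPow_cutoff (p := p) hb.m_pos hb.sign_m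
  have en := h.realPow_cutoff (p := p) hb.n_pos hb.sign_n
  have cU := h.continuous_cutoff C hb.p_pos
  have cm := h.continuous_cutoff (|C| ^ m) (mul_pos hb.p_pos hb.m_pos)
  have cn : ContDiff ℝ 2 (cutoff L fun x => |C| ^ n * v x ^ (p * n)) :=
    h.contDiff_cutoff (k := 2) (|C| ^ n) (by exact_mod_cast hb.two_lt)
  refine ⟨hb.m_pos, fun ξ => ⟨h.powDefined_cutoff hb.sign_m ξ, h.powDefined_cutoff hb.sign_n ξ⟩,
    cU, ?_, em ▸ cm, en ▸ cn, ?_⟩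
  · have hc : HasCompactSupport (cutoff L fun x => C * v x ^ p) :=
      HasCompactSupport.intro isCompact_Icc (K := Icc (-L) L) fun x hx => by
        rw [cutoff, if_neg fun h' => hx (Ioo_subset_Icc_self (abs_lt.1 h'))]
    obtain ⟨B, hB⟩ := hc.exists_bound_of_continuous cU
    exact ⟨B, hB⟩
  · have em' := fun ξ => congrFun em ξ
    simp only [em', en]
    have hcl : IsClosed {ξ : ℝ | b * iteratedDeriv 2 (cutoff L fun x => |C| ^ n * v x ^ (p * n)) ξ =
        g * cutoff L (fun x => C * v x ^ p) ξ -
          a * cutoff L (fun x => |C| ^ m * v x ^ (p * m)) ξ} :=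
      isClosed_eq (continuous_const.mul (cn.continuous_iteratedDeriv 2 le_rfl))
        ((continuous_const.mul cU).sub (continuous_const.mul cm))
    -- Both sides of the equation are continuous, so the two end points can be left out: inside, the
    -- coefficients balance, and outside everything vanishes.
    have hdense : Dense ({L, -L}ᶜ : Set ℝ) := (Set.toFinite _).countable.dense_compl ℝ
    intro ξ
    refine hcl.closure_subset_iff.2 (fun x hx => ?_) (hdense ξ)
    simp only [mem_compl_iff, mem_insert_iff, mem_singleton_iff, not_or] at hx
    change b * _ = _
    rcases lt_trichotomy |x| L with hL | hL | hL
    · rw [h.iteratedDeriv_two_rpow _ _ hL, ← mul_assoc, hb.balance _ (h.pos x hL)]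
      simp only [cutoff, if_pos hL]
      ring
    · rcases abs_cases x with ⟨h1, -⟩ | ⟨h1, -⟩
      · exact absurd (h1.symm.trans hL) hx.1
      · exact absurd (by linarith) hx.2
    · have e : cutoff L (fun x => |C| ^ n * v x ^ (p * n)) =ᶠ[𝓝 x] fun _ => 0 := by
        filter_upwards [continuous_abs.continuousAt.eventually (lt_mem_nhds hL)] with y hy
        rw [cutoff, if_neg (not_lt.2 (le_of_lt hy))]
      rw [e.iteratedDeriv_eq 2]
      simp [cutoff, not_lt.2 hL.le]

end

/-- The function `U` is a cut-off power of an arch with coefficients that make it a travelling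
wave. -/
def IsArchWave (a b g m n L p : ℝ) (U : ℝ → ℝ) : Prop :=
  ∃ (v : ℝ → ℝ) (c₀ c₁ C : ℝ) (j : ℕ), IsArch v L c₀ c₁ j ∧ IsBalanced a b g m n C p c₀ c₁ j ∧
    U = cutoff L fun x => C * v x ^ p

theorem SignOK.ne_zero {C r : ℝ} (h : SignOK C r) : C ≠ 0 := by
  rcases h with h | h
  exacts [h.ne', h.1.ne]

namespace IsArchWave

variable {a b g m n L p : ℝ} {U : ℝ → ℝ}

theorem isWave (h : IsArchWave a b g m n L p U) : IsWave a b g m n U := by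
  obtain ⟨v, c₀, c₁, C, j, hv, hb, rfl⟩ := h
  exact hv.isWave hb

theorem isCompactProfile (h : IsArchWave a b g m n L p U) : IsCompactProfile L U := by
  obtain ⟨v, c₀, c₁, C, j, hv, hb, rfl⟩ := h
  exact hv.isCompactProfile hb.sign_m.ne_zero hb.p_pos

theorem contDiff_iff (h : IsArchWave a b g m n L p U) (k : ℕ) : ContDiff ℝ k U ↔ k < p := by
  obtain ⟨v, c₀, c₁, C, j, hv, hb, rfl⟩ := h
  exact ⟨hv.lt_of_contDiff_cutoff hb.sign_m.ne_zero, hv.contDiff_cutoff C⟩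

theorem even (h : IsArchWave a b g m n L p U) (ξ : ℝ) : U (-ξ) = U ξ := by
  obtain ⟨v, c₀, c₁, C, j, hv, hb, rfl⟩ := h
  exact hv.cutoff_even C p ξ

theorem hasEndBehaviour (h : IsArchWave a b g m n L p U) : HasEndBehaviour U L p := by
  obtain ⟨v, c₀, c₁, C, j, hv, hb, rfl⟩ := h
  exact hv.hasEndBehaviour hb.sign_m.ne_zero p

theorem weakK (h : IsArchWave a b g m n L p U) : IsWeakCompactonK a b g m n L U :=
  ⟨h.isCompactProfile, h.isWave.isWeakSolODE3, h.isWave.isWeakSolK⟩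

theorem weakKP {σ μ ν : ℝ} (h : IsArchWave a b (ν - σ * μ ^ 2) m n L p U) :
    IsWeakCompactonKP a b σ μ ν m n L U :=
  ⟨h.isCompactProfile, h.isWave.isWeakSolODE4, h.isWave.isWeakSolKP⟩

/-- The wave flux vanishes identically, so the differential equation imposes nothing beyond the
smoothness of `U`. -/
theorem strongK_iff (h : IsArchWave a b g m n L p U) :
    IsStrongCompactonK a b g m n L U ↔ 3 < p := by
  refine ⟨fun hs => by exact_mod_cast (h.contDiff_iff 3).1 hs.2.2.1, fun hp =>
    ⟨h.isCompactProfile, h.isWave.powDefined, (h.contDiff_iff 3).2 (by exact_mod_cast hp),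
      h.isWave.contDiff_n, fun ξ => ?_⟩⟩
  rw [h.isWave.waveFlux_eq_zero]
  exact hasDerivAt_const ξ 0

theorem strongKP_iff {σ μ ν : ℝ} (h : IsArchWave a b (ν - σ * μ ^ 2) m n L p U) :
    IsStrongCompactonKP a b σ μ ν m n L U ↔ 4 < p := by
  refine ⟨fun hs => by exact_mod_cast (h.contDiff_iff 4).1 hs.2.2.1, fun hp =>
    ⟨h.isCompactProfile, h.isWave.powDefined, (h.contDiff_iff 4).2 (by exact_mod_cast hp),
      h.isWave.contDiff_n, ?_, fun ξ => ?_⟩⟩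
  · rw [h.isWave.waveFlux_eq_zero]
    exact differentiable_const 0
  · rw [h.isWave.waveFlux_eq_zero]
    simpa using hasDerivAt_const ξ (0 : ℝ)

end IsArchWave
/-! ### Jacobi elliptic functions -/

section Jacobi

variable {M : ℝ}

theorem delta_pos (hM : M < 1) (θ : ℝ) : 0 < 1 - M * Real.sin θ ^ 2 := by
  have h1 := Real.sin_sq_le_one θ
  have h0 := sq_nonneg (Real.sin θ)
  rcases le_total M 0 with h | h <;> nlinarith

theorem continuous_ellipticIntegrand (hM : M < 1) :
    Continuous fun θ : ℝ => 1 / √(1 - M * Real.sin θ ^ 2) :=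
  continuous_const.div (by fun_prop) fun θ => (Real.sqrt_pos.2 (delta_pos hM θ)).ne'

theorem hasDerivAt_ellipticF (hM : M < 1) (φ : ℝ) :
    HasDerivAt (fun φ => ellipticF φ M) (1 / √(1 - M * Real.sin φ ^ 2)) φ :=
  intervalIntegral.integral_hasDerivAt_right
    ((continuous_ellipticIntegrand hM).intervalIntegrable _ _)
    ((continuous_ellipticIntegrand hM).stronglyMeasurableAtFilter _ _)
    (continuous_ellipticIntegrand hM).continuousAt

theorem ellipticF_zero (M : ℝ) : ellipticF 0 M = 0 := by simp [ellipticF]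

theorem ellipticF_neg (φ M : ℝ) : ellipticF (-φ) M = -ellipticF φ M := by
  have := intervalIntegral.integral_comp_neg (a := 0) (b := φ)
    (fun θ => 1 / √(1 - M * Real.sin θ ^ 2))
  simp only [Real.sin_neg, neg_sq, neg_zero] at this
  rw [ellipticF, ellipticF, this, intervalIntegral.integral_symm]

theorem ellipticF_pi_sub (hM : M < 1) (φ : ℝ) :
    ellipticF (Real.pi - φ) M = 2 * ellipticK M - ellipticF φ M := by
  have hi := fun x y => (continuous_ellipticIntegrand hM).intervalIntegrable
    (μ := volume) x y
  have h1 : ∀ x y : ℝ, ellipticF y M - ellipticF x M =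
      ∫ θ in x..y, 1 / √(1 - M * Real.sin θ ^ 2) := fun x y =>
    intervalIntegral.integral_interval_sub_left (hi _ _) (hi _ _)
  have h2 := intervalIntegral.integral_comp_sub_left (a := φ) (b := Real.pi / 2)
    (fun θ => 1 / √(1 - M * Real.sin θ ^ 2)) Real.pi
  simp only [Real.sin_pi_sub] at h2
  rw [show Real.pi - Real.pi / 2 = Real.pi / 2 by ring, ← h1, ← h1] at h2
  rw [ellipticK]
  linarith

theorem strictMono_ellipticF (hM : M < 1) : StrictMono fun φ => ellipticF φ M :=
  strictMono_of_hasDerivAt_pos (hasDerivAt_ellipticF hM) fun φ =>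
    one_div_pos.2 (Real.sqrt_pos.2 (delta_pos hM φ))

theorem ellipticK_pos (hM : M < 1) : 0 < ellipticK M := by
  rw [ellipticK, ← ellipticF_zero M]
  exact strictMono_ellipticF hM (by positivity)

/-- The integral over each period `π` equals `2 K > 0`, so the incomplete integral grows without
bound; oddness covers the negative half-line. -/
theorem surjective_ellipticF (hM : M < 1) : Function.Surjective fun φ => ellipticF φ M := by
  have hc : Continuous fun φ => ellipticF φ M :=
    continuous_iff_continuousAt.2 fun φ => (hasDerivAt_ellipticF hM φ).continuousAt
  have hk : ∀ k : ℕ, k * ellipticK M ≤ ellipticF (k * Real.pi) M := by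
    intro k
    induction k with
    | zero => simp [ellipticF_zero]
    | succ k ih =>
      have h1 := ellipticF_pi_sub hM (-(k * Real.pi))
      rw [ellipticF_neg] at h1
      have := ellipticK_pos hM
      push_cast
      rw [show ((k : ℝ) + 1) * Real.pi = Real.pi - -(k * Real.pi) by ring, h1]
      linarith
  have ht : Tendsto (fun φ => ellipticF φ M) atTop atTop := by
    refine tendsto_atTop_atTop_of_monotone (strictMono_ellipticF hM).monotone fun B => ?_
    obtain ⟨k, hkB⟩ := exists_nat_gt (B / ellipticK M)
    refine ⟨k * Real.pi, le_trans ?_ (hk k)⟩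
    rw [div_lt_iff₀ (ellipticK_pos hM)] at hkB
    exact hkB.le
  refine hc.surjective ht ?_
  have : (fun φ => ellipticF φ M) = fun φ => -ellipticF (-φ) M :=
    funext fun φ => by rw [ellipticF_neg, neg_neg]
  rw [this]
  exact tendsto_neg_atTop_atBot.comp (ht.comp tendsto_neg_atBot_atTop)

theorem ellipticF_jacobiAm (hM : M < 1) (z : ℝ) : ellipticF (jacobiAm z M) M = z :=
  Function.invFun_eq (surjective_ellipticF hM z)

theorem jacobiAm_ellipticF (hM : M < 1) (φ : ℝ) : jacobiAm (ellipticF φ M) M = φ :=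
  (strictMono_ellipticF hM).injective (ellipticF_jacobiAm hM _)

theorem strictMono_jacobiAm (hM : M < 1) : StrictMono fun z => jacobiAm z M := by
  intro x y hxy
  rw [← ellipticF_jacobiAm hM x, ← ellipticF_jacobiAm hM y] at hxy
  exact (strictMono_ellipticF hM).lt_iff_lt.1 hxy

theorem jacobiAm_neg (hM : M < 1) (z : ℝ) : jacobiAm (-z) M = -jacobiAm z M := by
  apply (strictMono_ellipticF hM).injective
  simp only [ellipticF_neg, ellipticF_jacobiAm hM]

theorem jacobiAm_two_K_sub (hM : M < 1) (z : ℝ) :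
    jacobiAm (2 * ellipticK M - z) M = Real.pi - jacobiAm z M := by
  apply (strictMono_ellipticF hM).injective
  simp only [ellipticF_pi_sub hM, ellipticF_jacobiAm hM]

theorem jacobiAm_zero (hM : M < 1) : jacobiAm 0 M = 0 := by
  simpa [ellipticF_zero] using jacobiAm_ellipticF hM 0

theorem jacobiAm_K (hM : M < 1) : jacobiAm (ellipticK M) M = Real.pi / 2 :=
  jacobiAm_ellipticF hM _

theorem jacobiAm_two_K (hM : M < 1) : jacobiAm (2 * ellipticK M) M = Real.pi := by
  simpa [jacobiAm_zero hM] using jacobiAm_two_K_sub hM 0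

theorem abs_jacobiAm_lt (hM : M < 1) {z φ : ℝ} (h : |z| < ellipticF φ M) :
    |jacobiAm z M| < φ := by
  rw [abs_lt] at h ⊢
  have h1 := strictMono_jacobiAm hM h.1
  have h2 := strictMono_jacobiAm hM h.2
  simp only [jacobiAm_neg hM, jacobiAm_ellipticF hM] at h1 h2
  exact ⟨h1, h2⟩

/-- The inverse function rule; continuity of the amplitude comes from its being monotone and
surjective. -/
theorem hasDerivAt_jacobiAm (hM : M < 1) (z : ℝ) :
    HasDerivAt (fun z => jacobiAm z M) (√(1 - M * Real.sin (jacobiAm z M) ^ 2)) z := by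
  have hs : Function.Surjective fun z => jacobiAm z M := fun φ => ⟨_, jacobiAm_ellipticF hM φ⟩
  have hc : Continuous fun z => jacobiAm z M :=
    (strictMono_jacobiAm hM).monotone.continuous_of_surjective hs
  have := HasDerivAt.of_local_left_inverse (f := fun φ => ellipticF φ M)
    (g := fun z => jacobiAm z M) (a := z) hc.continuousAt (hasDerivAt_ellipticF hM _)
    (one_div_pos.2 (Real.sqrt_pos.2 (delta_pos hM _))).ne'
    (Eventually.of_forall fun z => ellipticF_jacobiAm hM z)
  simpa using this

/-- The product `sn dn`. -/
noncomputable def jacobiSnDn (z M : ℝ) : ℝ :=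
  Real.sin (jacobiAm z M) * √(1 - M * Real.sin (jacobiAm z M) ^ 2)

/-- The product `cn dn`. -/
noncomputable def jacobiCnDn (z M : ℝ) : ℝ :=
  Real.cos (jacobiAm z M) * √(1 - M * Real.sin (jacobiAm z M) ^ 2)

theorem hasDerivAt_sqrt_delta (hM : M < 1) (z : ℝ) :
    HasDerivAt (fun z => √(1 - M * Real.sin (jacobiAm z M) ^ 2))
      (-M * Real.sin (jacobiAm z M) * Real.cos (jacobiAm z M)) z := by
  have hp := delta_pos hM (jacobiAm z M)
  have h := ((((hasDerivAt_jacobiAm hM z).sin.pow 2).const_mul M).const_sub 1).sqrt hp.ne'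
  refine h.congr_deriv ?_
  have hs := (Real.sqrt_pos.2 hp).ne'
  simp only [Pi.pow_apply]
  rw [div_eq_iff (by positivity)]
  push_cast
  ring

theorem hasDerivAt_jacobiCn (hM : M < 1) (z : ℝ) :
    HasDerivAt (fun z => jacobiCn z M) (-jacobiSnDn z M) z :=
  (hasDerivAt_jacobiAm hM z).cos.congr_deriv (by rw [jacobiSnDn]; ring)

theorem hasDerivAt_jacobiSn (hM : M < 1) (z : ℝ) :
    HasDerivAt (fun z => jacobiSn z M) (jacobiCnDn z M) z :=
  (hasDerivAt_jacobiAm hM z).sin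

theorem jacobiSnDn_sq (hM : M < 1) (z : ℝ) : jacobiSnDn z M ^ 2 =
    (1 - jacobiCn z M ^ 2) * (1 - M + M * jacobiCn z M ^ 2) := by
  rw [jacobiSnDn, mul_pow, Real.sq_sqrt (delta_pos hM _).le, jacobiCn, Real.sin_sq]
  ring

theorem jacobiCnDn_sq (hM : M < 1) (z : ℝ) : jacobiCnDn z M ^ 2 =
    (1 - jacobiSn z M ^ 2) * (1 - M * jacobiSn z M ^ 2) := by
  rw [jacobiCnDn, mul_pow, Real.sq_sqrt (delta_pos hM _).le, jacobiSn, Real.cos_sq']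

theorem hasDerivAt_jacobiSnDn (hM : M < 1) (z : ℝ) :
    HasDerivAt (fun z => jacobiSnDn z M)
      (jacobiCn z M * (1 - 2 * M * (1 - jacobiCn z M ^ 2))) z := by
  have hp := Real.sq_sqrt (delta_pos hM (jacobiAm z M)).le
  refine ((hasDerivAt_jacobiSn hM z).mul (hasDerivAt_sqrt_delta hM z)).congr_deriv ?_
  simp only [jacobiCnDn, jacobiSn, jacobiCn]
  have hc := Real.sin_sq (jacobiAm z M)
  linear_combination Real.cos (jacobiAm z M) * hp - 2 * M * Real.cos (jacobiAm z M) * hc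

theorem hasDerivAt_jacobiCnDn (hM : M < 1) (z : ℝ) :
    HasDerivAt (fun z => jacobiCnDn z M)
      (-jacobiSn z M * (1 + M - 2 * M * jacobiSn z M ^ 2)) z := by
  have hp := Real.sq_sqrt (delta_pos hM (jacobiAm z M)).le
  refine ((hasDerivAt_jacobiCn hM z).mul (hasDerivAt_sqrt_delta hM z)).congr_deriv ?_
  simp only [jacobiSnDn, jacobiSn, jacobiCn]
  have hc := Real.cos_sq' (jacobiAm z M)
  linear_combination -Real.sin (jacobiAm z M) * hp - M * Real.sin (jacobiAm z M) * hc

/-- The function `cos (am / 2)`, an odd square root of `(1 + cn) / 2` near `2 K`. -/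
noncomputable def jacobiHalf (z M : ℝ) : ℝ := Real.cos (jacobiAm z M / 2)

/-- The factor in the derivative of `cos (am / 2)`. -/
noncomputable def jacobiHalfAux (z M : ℝ) : ℝ :=
  Real.sin (jacobiAm z M / 2) * √(1 - M * Real.sin (jacobiAm z M) ^ 2)

theorem two_mul_jacobiHalf_sq (z M : ℝ) : 2 * jacobiHalf z M ^ 2 = 1 + jacobiCn z M := by
  have := Real.cos_two_mul (jacobiAm z M / 2)
  rw [mul_div_cancel₀ _ two_ne_zero] at this
  rw [jacobiCn, this, jacobiHalf]
  ring

theorem hasDerivAt_jacobiHalf (hM : M < 1) (z : ℝ) :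
    HasDerivAt (fun z => jacobiHalf z M) (-(1 / 2) * jacobiHalfAux z M) z :=
  ((hasDerivAt_jacobiAm hM z).div_const 2).cos.congr_deriv (by rw [jacobiHalfAux]; ring)

theorem sin_jacobiAm_eq (z M : ℝ) : Real.sin (jacobiAm z M) =
    2 * Real.sin (jacobiAm z M / 2) * jacobiHalf z M := by
  rw [jacobiHalf, ← Real.sin_two_mul, mul_div_cancel₀ _ two_ne_zero]

theorem jacobiHalfAux_sq (hM : M < 1) (z : ℝ) : jacobiHalfAux z M ^ 2 =
    (1 - jacobiHalf z M ^ 2) * (1 - 4 * M * jacobiHalf z M ^ 2 * (1 - jacobiHalf z M ^ 2)) := by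
  have h1 : Real.sin (jacobiAm z M / 2) ^ 2 = 1 - jacobiHalf z M ^ 2 := Real.sin_sq _
  rw [jacobiHalfAux, mul_pow, Real.sq_sqrt (delta_pos hM _).le, sin_jacobiAm_eq, mul_pow, mul_pow,
    h1]
  ring

theorem hasDerivAt_jacobiHalfAux (hM : M < 1) (z : ℝ) :
    HasDerivAt (fun z => jacobiHalfAux z M)
      (jacobiHalf z M * (1 / 2 * (1 - 4 * M * jacobiHalf z M ^ 2 * (1 - jacobiHalf z M ^ 2)) -
        2 * M * (1 - jacobiHalf z M ^ 2) * (2 * jacobiHalf z M ^ 2 - 1))) z := by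
  have hp := Real.sq_sqrt (delta_pos hM (jacobiAm z M)).le
  have h1 : Real.sin (jacobiAm z M / 2) ^ 2 = 1 - jacobiHalf z M ^ 2 := Real.sin_sq _
  have h2 : Real.cos (jacobiAm z M) = 2 * jacobiHalf z M ^ 2 - 1 := by
    rw [two_mul_jacobiHalf_sq, jacobiCn]; ring
  refine ((((hasDerivAt_jacobiAm hM z).div_const 2).sin).mul
    (hasDerivAt_sqrt_delta hM z)).congr_deriv ?_
  rw [h2]
  change jacobiHalf z M * _ * _ + _ = _
  rw [sin_jacobiAm_eq] at hp ⊢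
  generalize √(1 - M * (2 * Real.sin (jacobiAm z M / 2) * jacobiHalf z M) ^ 2) = Δ at hp ⊢
  generalize jacobiHalf z M = χ at *
  generalize Real.sin (jacobiAm z M / 2) = s at *
  linear_combination χ / 2 * hp - (2 * M * χ ^ 3 + 2 * M * χ * (2 * χ ^ 2 - 1)) * h1

theorem jacobiCn_neg (hM : M < 1) (z : ℝ) : jacobiCn (-z) M = jacobiCn z M := by
  rw [jacobiCn, jacobiAm_neg hM, Real.cos_neg, jacobiCn]

theorem jacobiHalf_neg (hM : M < 1) (z : ℝ) : jacobiHalf (-z) M = jacobiHalf z M := by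
  rw [jacobiHalf, jacobiAm_neg hM, neg_div, Real.cos_neg, jacobiHalf]

theorem jacobiSn_two_K_sub (hM : M < 1) (z : ℝ) :
    jacobiSn (2 * ellipticK M - z) M = jacobiSn z M := by
  rw [jacobiSn, jacobiAm_two_K_sub hM, Real.sin_pi_sub, jacobiSn]

theorem jacobiCn_add_two_K (hM : M < 1) (z : ℝ) :
    jacobiCn (z + 2 * ellipticK M) M = -jacobiCn z M := by
  rw [show z + 2 * ellipticK M = 2 * ellipticK M - -z by ring, jacobiCn, jacobiAm_two_K_sub hM,
    Real.cos_pi_sub, jacobiAm_neg hM, Real.cos_neg, jacobiCn]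

theorem jacobiCn_le_one (z M : ℝ) : jacobiCn z M ≤ 1 := Real.cos_le_one _

theorem jacobiCn_pos (hM : M < 1) {z : ℝ} (hz : |z| < ellipticK M) : 0 < jacobiCn z M :=
  Real.cos_pos_of_mem_Ioo (abs_lt.1 (by simpa using abs_jacobiAm_lt hM (φ := Real.pi / 2) hz))

theorem ellipticF_pi (hM : M < 1) : ellipticF Real.pi M = 2 * ellipticK M := by
  simpa [ellipticF_zero] using ellipticF_pi_sub hM 0

theorem jacobiHalf_pos (hM : M < 1) {z : ℝ} (hz : |z| < 2 * ellipticK M) : 0 < jacobiHalf z M := by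
  have := abs_lt.1 (abs_jacobiAm_lt hM (φ := Real.pi) (ellipticF_pi hM ▸ hz))
  exact Real.cos_pos_of_mem_Ioo ⟨by linarith, by linarith⟩

theorem jacobiSn_pos (hM : M < 1) {z : ℝ} (h0 : 0 < z) (h1 : z < 2 * ellipticK M) :
    0 < jacobiSn z M := by
  have a1 := strictMono_jacobiAm hM h0
  have a2 := strictMono_jacobiAm hM h1
  simp only [jacobiAm_zero hM, jacobiAm_two_K hM] at a1 a2
  exact Real.sin_pos_of_pos_of_lt_pi a1 a2

theorem jacobiCn_jacobiArccn (hM : M < 1) {x : ℝ} (h1 : -1 ≤ x) (h2 : x ≤ 1) :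
    jacobiCn (jacobiArccn x M) M = x := by
  rw [jacobiCn, jacobiArccn, jacobiAm_ellipticF hM, Real.cos_arccos h1 h2]

theorem lt_jacobiCn (hM : M < 1) {x z : ℝ} (h1 : -1 ≤ x) (h2 : x ≤ 1)
    (hz : |z| < jacobiArccn x M) : x < jacobiCn z M := by
  have := abs_jacobiAm_lt hM hz
  rw [jacobiCn, ← Real.cos_abs]
  conv_lhs => rw [← Real.cos_arccos h1 h2]
  exact Real.cos_lt_cos_of_nonneg_of_le_pi (abs_nonneg _) (Real.arccos_le_pi x) this

theorem jacobiArccn_pos (hM : M < 1) {x : ℝ} (hx : x < 1) : 0 < jacobiArccn x M := by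
  rw [jacobiArccn, ← ellipticF_zero M]
  exact strictMono_ellipticF hM (Real.arccos_pos.2 hx)

theorem jacobiArccn_lt (hM : M < 1) {x : ℝ} (hx : -1 < x) :
    jacobiArccn x M < 2 * ellipticK M := by
  rw [jacobiArccn, ← ellipticF_pi hM]
  exact strictMono_ellipticF hM (by
    rw [← Real.arccos_neg_one]
    by_cases h : x ≤ 1
    · exact Real.strictAntiOn_arccos ⟨le_rfl, by norm_num⟩ ⟨hx.le, h⟩ hx
    · rw [Real.arccos_of_one_le (le_of_not_ge h), Real.arccos_neg_one]; exact Real.pi_pos)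

end Jacobi
/-! ### The arches of the explicit families -/

theorem sq_sqrt_three : √3 ^ 2 = (3 : ℝ) := Real.sq_sqrt (by norm_num)

theorem one_lt_sqrt_three : (1 : ℝ) < √3 := by
  rw [Real.lt_sqrt (by norm_num)]; norm_num

theorem sqrt_three_lt_two : √3 < (2 : ℝ) := by
  rw [Real.sqrt_lt' (by norm_num)]; norm_num

theorem modMinus_eq : modMinus = (2 - √3) / 4 := by
  have h2 : √2 ^ 2 = (2 : ℝ) := Real.sq_sqrt (by norm_num)
  rw [modMinus, div_pow, mul_pow, h2]
  linear_combination (1 / 8) * sq_sqrt_three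

theorem modPlus_eq : modPlus = (2 + √3) / 4 := by
  have h2 : √2 ^ 2 = (2 : ℝ) := Real.sq_sqrt (by norm_num)
  rw [modPlus, div_pow, mul_pow, h2]
  linear_combination (1 / 8) * sq_sqrt_three

theorem modMinus_lt : modMinus < 1 := by
  rw [modMinus_eq]; linarith [one_lt_sqrt_three]

theorem modPlus_lt : modPlus < 1 := by
  rw [modPlus_eq]; linarith [sqrt_three_lt_two]

theorem abs_mul_lt_of_mul_eq {β L K x : ℝ} (hβ : 0 < β) (hL : β * L = K) (hx : |x| < L) :
    |β * x| < K := by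
  rw [abs_mul, abs_of_pos hβ, ← hL]
  exact mul_lt_mul_of_pos_left hx hβ

theorem hasDerivAt_comp_mul {f : ℝ → ℝ} {f' : ℝ} (β x : ℝ) (h : HasDerivAt f f' (β * x)) :
    HasDerivAt (fun x => f (β * x)) (f' * β) x := by
  have := h.comp x ((hasDerivAt_id x).const_mul β)
  simpa [Function.comp_def] using this

variable {β L : ℝ}

theorem isArch_parabola {κ : ℝ} (hL : 0 < L) (hκ : κ * L ^ 2 = 1) :
    IsArch (fun x => 1 - κ * x ^ 2) L (4 * κ) (-4 * κ) 1 := by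
  have hκ0 : 0 < κ := by
    by_contra! h
    nlinarith [sq_nonneg L, mul_nonneg (neg_nonneg.2 h) (sq_nonneg L)]
  refine ⟨hL, by positivity, one_ne_zero, fun x => by ring, fun x hx => ?_, by linarith,
    L + 1, by linarith, fun x => -2 * κ * x, fun x _ => ⟨?_, ?_, by ring⟩⟩
  · have : x ^ 2 < L ^ 2 := sq_lt_sq' (abs_lt.1 hx).1 (abs_lt.1 hx).2
    nlinarith
  · have := (((hasDerivAt_id x).pow 2).const_mul κ).const_sub 1
    exact this.congr_deriv (by simp; ring)
  · have := (hasDerivAt_id x).const_mul (-2 * κ)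
    exact this.congr_deriv (by norm_num; ring)

theorem isArch_cos (hL : 0 < L) (hβ : 0 < β) (hK : β * L = Real.pi / 2) :
    IsArch (fun x => Real.cos (β * x)) L (β ^ 2) (-β ^ 2) 2 := by
  refine ⟨hL, by positivity, two_ne_zero, fun x => by simp, fun x hx => ?_, by simp [hK],
    L + 1, by linarith, fun x => -β * Real.sin (β * x), fun x _ => ⟨?_, ?_, ?_⟩⟩
  · exact Real.cos_pos_of_mem_Ioo (abs_lt.1 (abs_mul_lt_of_mul_eq hβ hK hx))
  · exact (hasDerivAt_comp_mul β x (Real.hasDerivAt_cos _)).congr_deriv (by ring)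
  · exact ((hasDerivAt_comp_mul β x (Real.hasDerivAt_sin _)).const_mul (-β)).congr_deriv
      (by norm_num; ring)
  · rw [mul_pow, Real.sin_sq]; ring

/-- At `M = 1/2` the product `(1 - c²)(1/2 + c²/2)` in the equation for cn is `(1 - c⁴) / 2`,
without a quadratic term. -/
theorem isArch_jacobiCn {M : ℝ} (hM : M = 1 / 2) (hL : 0 < L) (hβ : 0 < β)
    (hK : β * L = ellipticK M) :
    IsArch (fun x => jacobiCn (β * x) M) L (β ^ 2 / 2) (-(β ^ 2 / 2)) 4 := by
  have hM1 : M < 1 := by rw [hM]; norm_num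
  refine ⟨hL, by positivity, by norm_num, fun x => by rw [mul_neg, jacobiCn_neg hM1],
    fun x hx => jacobiCn_pos hM1 (abs_mul_lt_of_mul_eq hβ hK hx), by
      simp only [hK, jacobiCn, jacobiAm_K hM1, Real.cos_pi_div_two],
    L + 1, by linarith, fun x => -β * jacobiSnDn (β * x) M, fun x _ => ⟨?_, ?_, ?_⟩⟩
  · exact (hasDerivAt_comp_mul β x (hasDerivAt_jacobiCn hM1 _)).congr_deriv (by ring)
  · exact ((hasDerivAt_comp_mul β x (hasDerivAt_jacobiSnDn hM1 _)).const_mul (-β)).congr_deriv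
      (by rw [hM]; norm_num; ring)
  · rw [mul_pow, jacobiSnDn_sq hM1, hM]; ring

/-- At `M = -1` the product `(1 - s²)(1 + s²)` is `1 - s⁴`. The shift by `L = K / β` centres the
arch of sn over `[0, 2 K]` at the origin. -/
theorem isArch_jacobiSn (hL : 0 < L) (hβ : 0 < β) (hK : β * L = ellipticK (-1)) :
    IsArch (fun x => jacobiSn (β * (x + L)) (-1)) L (β ^ 2) (-β ^ 2) 4 := by
  have hM1 : (-1 : ℝ) < 1 := by norm_num
  have hd : ∀ {f : ℝ → ℝ} {f' x : ℝ}, HasDerivAt f f' (β * (x + L)) →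
      HasDerivAt (fun x => f (β * (x + L))) (f' * β) x := fun h =>
    (hasDerivAt_comp_mul β _ h).comp_add_const _ _
  refine ⟨hL, by positivity, by norm_num, fun x => ?_, fun x hx => ?_, ?_,
    L + 1, by linarith, fun x => β * jacobiCnDn (β * (x + L)) (-1), fun x _ => ⟨?_, ?_, ?_⟩⟩
  · rw [← jacobiSn_two_K_sub hM1, ← hK]
    congr 1
    ring
  · obtain ⟨h1, h2⟩ := abs_lt.1 hx
    refine jacobiSn_pos hM1 (mul_pos hβ (by linarith)) ?_
    rw [← hK]
    nlinarith
  · rw [show β * (L + L) = 2 * ellipticK (-1) by rw [← hK]; ring, jacobiSn, jacobiAm_two_K hM1,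
      Real.sin_pi]
  · exact (hd (hasDerivAt_jacobiSn hM1 _)).congr_deriv (by ring)
  · exact ((hd (hasDerivAt_jacobiCnDn hM1 _)).const_mul β).congr_deriv (by norm_num; ring)
  · rw [mul_pow, jacobiCnDn_sq hM1]; ring

theorem jacobiHalf_den_pos (z M : ℝ) : 0 < 3 + √3 - 2 * jacobiHalf z M ^ 2 := by
  rw [two_mul_jacobiHalf_sq]
  linarith [one_lt_sqrt_three, jacobiCn_le_one z M]

/-- The quotient in `ratcn2` and `ratcn5` has double zeros at `±L`, since `1 + cn` does. An arch
needs simple zeros, so a square root is taken, smoothly through `1 + cn = 2 cos² (am / 2)`. For the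
modulus `k₋` only the powers `v ^ 0` and `v ^ 6` survive in `v' ^ 2`. -/
theorem isArch_jacobiHalf (hL : 0 < L) (hβ : 0 < β) (hK : β * L = 2 * ellipticK modMinus) :
    IsArch (fun x => jacobiHalf (β * x) modMinus / √(3 + √3 - 2 * jacobiHalf (β * x) modMinus ^ 2))
      L (β ^ 2 * (3 - √3) / 24) (-β ^ 2 * (3 + 2 * √3) / 6) 6 := by
  have hM := modMinus_lt
  have h3 := sq_sqrt_three
  have h32 := sqrt_three_lt_two
  refine ⟨hL, ?_, by norm_num, fun x => by rw [mul_neg, jacobiHalf_neg hM],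
    fun x hx => div_pos (jacobiHalf_pos hM (abs_mul_lt_of_mul_eq hβ hK hx))
      (Real.sqrt_pos.2 (jacobiHalf_den_pos _ _)), ?_,
    L + 1, by linarith, fun x => -β / 2 * (3 + √3) * jacobiHalfAux (β * x) modMinus /
      √(3 + √3 - 2 * jacobiHalf (β * x) modMinus ^ 2) ^ 3, fun x _ => ?_⟩
  · have : 0 < 3 - √3 := by linarith
    positivity
  · rw [hK, jacobiHalf, jacobiAm_two_K hM, Real.cos_pi_div_two, zero_div]
  have hD := jacobiHalf_den_pos (β * x) modMinus
  have hq := Real.sqrt_pos.2 hD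
  have hq2 := Real.sq_sqrt hD.le
  have d0 := hasDerivAt_comp_mul β x (hasDerivAt_jacobiHalf hM _)
  have dA := hasDerivAt_comp_mul β x (hasDerivAt_jacobiHalfAux hM _)
  have dq := (((d0.pow 2).const_mul 2).const_sub (3 + √3)).sqrt hD.ne'
  have hA := jacobiHalfAux_sq hM (β * x)
  simp only [modMinus_eq] at *
  simp only [Pi.pow_apply] at dq
  set q := √(3 + √3 - 2 * jacobiHalf (β * x) ((2 - √3) / 4) ^ 2) with hqdef
  set χ := jacobiHalf (β * x) ((2 - √3) / 4) with hχ
  set A := jacobiHalfAux (β * x) ((2 - √3) / 4) with hAdef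
  set s := √3 with hs
  refine ⟨(d0.div dq hq.ne').congr_deriv ?_,
    ((dA.const_mul (-β / 2 * (3 + s))).div (dq.pow 3) (pow_ne_zero 3 hq.ne')).congr_deriv ?_, ?_⟩
  · simp only [← hqdef, ← hχ]
    field_simp
    norm_num
    linear_combination (-A) * hq2
  · simp only [← hqdef, ← hχ, ← hAdef, Pi.pow_apply]
    field_simp
    norm_num
    -- Clears the denominator of `v ^ 5`. What follows is a polynomial identity modulo the relations
    -- for `q²`, for `A²` and `√3² = 3`.
    have hX : q ^ 7 * (χ / q) ^ 5 = q ^ 2 * χ ^ 5 := by field_simp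
    linear_combination 48 * (3 + 2 * s) * hX + q ^ 2 * (3 + s) * 6 *
      (-(χ * (4 * (1 - χ ^ 2 * (2 - s) * (1 - χ ^ 2)) -
        4 * (2 - s) * (1 - χ ^ 2) * (2 * χ ^ 2 - 1))) * hq2 + 24 * χ * hA) + q ^ 2 *
      (72 * χ + (-288) * χ ^ 3 + 192 * χ ^ 5 + 24 * s * χ + (-96) * s * χ ^ 3 +
        72 * s * χ ^ 5) * h3
  · rw [div_pow, mul_pow, hA]
    field_simp
    linear_combination -24 * (3 - s) *
      (q ^ 4 + q ^ 2 * (3 + s - 2 * χ ^ 2) + (3 + s - 2 * χ ^ 2) ^ 2) * hq2 +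
      (216 + (-864) * χ ^ 4 + 576 * χ ^ 6 + 144 * s + (-288) * s * χ ^ 4 +
        144 * s * χ ^ 6 + 24 * s ^ 2) * h3

/-- Here the numerator has simple zeros, at `arccn (2 - √3) < 2 K`, so the quotient itself is the
arch. For the modulus `k₊` its equation contains only `v ^ 0` and `v ^ 3`. -/
theorem isArch_ratcn (hL : 0 < L) (hβ : 0 < β) (hK : β * L = jacobiArccn (2 - √3) modPlus) :
    IsArch (fun x => (jacobiCn (β * x) modPlus + √3 - 2) / (jacobiCn (β * x) modPlus + 1))
      L (β ^ 2 * (2 * √3 - 3) / 6) (-β ^ 2 * (3 + √3) / 3) 3 := by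
  have hM := modPlus_lt
  have h3 := sq_sqrt_three
  have h32 := sqrt_three_lt_two
  have h31 := one_lt_sqrt_three
  have hm1 : -1 < 2 - √3 := by linarith
  have hp1 : 2 - √3 ≤ 1 := by linarith
  -- The denominator `cn + 1` vanishes at `2 K`, so the equation is available only up to `R = 2 K /
  -- β`.
  have hcn : ∀ x, |x| < 2 * ellipticK modPlus / β → 0 < jacobiCn (β * x) modPlus + 1 := by
    intro x hx
    have := jacobiHalf_pos hM (abs_mul_lt_of_mul_eq hβ (mul_div_cancel₀ _ hβ.ne') hx)
    have := two_mul_jacobiHalf_sq (β * x) modPlus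
    nlinarith
  refine ⟨hL, ?_, by norm_num, fun x => by rw [mul_neg, jacobiCn_neg hM],
    fun x hx => ?_, ?_, 2 * ellipticK modPlus / β, ?_,
    fun x => -β * (3 - √3) * jacobiSnDn (β * x) modPlus / (jacobiCn (β * x) modPlus + 1) ^ 2,
    fun x hx => ?_⟩
  · have : 0 < 2 * √3 - 3 := by nlinarith
    positivity
  · have := lt_jacobiCn hM hm1.le hp1 (abs_mul_lt_of_mul_eq hβ hK hx)
    exact div_pos (by linarith) (by linarith)
  · rw [hK, jacobiCn_jacobiArccn hM hm1.le hp1]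
    simp
  · rw [lt_div_iff₀ hβ, mul_comm, hK]
    exact jacobiArccn_lt hM hm1
  have hD := (hcn x hx).ne'
  have d0 := hasDerivAt_comp_mul β x (hasDerivAt_jacobiCn hM _)
  have dA := hasDerivAt_comp_mul β x (hasDerivAt_jacobiSnDn hM _)
  have hA := jacobiSnDn_sq hM (β * x)
  simp only [modPlus_eq] at *
  refine ⟨(((d0.add_const √3).sub_const 2).div (d0.add_const 1) hD).congr_deriv ?_,
    ((dA.const_mul (-β * (3 - √3))).div ((d0.add_const 1).pow 2)
      (pow_ne_zero 2 hD)).congr_deriv ?_, ?_⟩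
  · field_simp
    ring
  · simp only [Pi.pow_apply]
    set c := jacobiCn (β * x) ((2 + √3) / 4) with hc
    set A := jacobiSnDn (β * x) ((2 + √3) / 4) with hAdef
    set s := √3 with hs
    field_simp
    norm_num
    have hX : (c + 1) ^ 4 * ((c + s - 2) / (c + 1)) ^ 2 = (c + 1) ^ 2 * (c + s - 2) ^ 2 := by
      field_simp
    linear_combination -48 * (3 - s) * (c + 1) * hA + 12 * (3 + s) * hX +
      ((-24) + (-24) * c + 36 * c ^ 2 + 48 * c ^ 3 + 12 * c ^ 4 + 12 * s + 24 * s * c +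
        12 * s * c ^ 2) * h3
  · rw [div_pow, mul_pow, hA]
    field_simp
    generalize jacobiCn (β * x) ((2 + √3) / 4) = c
    linear_combination
      (72 + (-144) * c + (-216) * c ^ 2 + 72 * c ^ 3 + 72 * c ^ 4 + (-90) * √3 +
        108 * √3 * c ^ 2 + (-18) * √3 * c ^ 4 + 24 * √3 ^ 2 + 24 * √3 ^ 2 * c) * h3

/-! ### Balance of the coefficients -/

/-- The constant `c₀` accounts for `g U` and `c₁` for `a U ^ m`. With `|C| = B ^ p` the fractional
powers become `B ^ (p + 2)` and `B ^ (p + j)`, so after cancelling `B ^ p y ^ p` only `B ^ 2` and `B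
^ j` remain. -/
theorem IsBalanced.of_linear_term {a b g m n ε B p c₀ c₁ : ℝ} {j : ℕ} (hm : 0 < m) (hn : 0 < n)
    (hp : 0 < p) (hB : 0 < B) (hε : ε = 1 ∨ ε = -1 ∧ EvenOverOdd m ∧ EvenOverOdd n)
    (hpn : p * n = p + 2) (hpm : p * m = p + j)
    (h0 : b * ((p + 2) * (p + 1) * c₀) * B ^ 2 = ε * g)
    (h1 : b * ((p + 2) * (p + 1 + j / 2) * c₁) * B ^ 2 = -a * B ^ j) :
    IsBalanced a b g m n (ε * B ^ p) p c₀ c₁ j := by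
  have hC : 0 < B ^ p := Real.rpow_pos_of_pos hB p
  have habs : |ε * B ^ p| = B ^ p := by
    rcases hε with h | ⟨h, -⟩ <;> simp [h, abs_of_pos hC]
  have hε2 : ε * ε = 1 := by rcases hε with h | ⟨h, -⟩ <;> simp [h]
  have hs : ∀ r, (ε = 1 ∨ ε = -1 ∧ EvenOverOdd r) → SignOK (ε * B ^ p) r := by
    rintro r (h | ⟨h, hr⟩)
    · exact Or.inl (by rw [h, one_mul]; exact hC)
    · exact Or.inr ⟨by rw [h]; linarith, hr⟩
  refine ⟨hm, hn, hp, by linarith, hs m (hε.imp_right fun h => ⟨h.1, h.2.1⟩),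
    hs n (hε.imp_right fun h => ⟨h.1, h.2.2⟩), fun y hy => ?_⟩
  have e1 : p + 2 - 2 = p := by ring
  rw [habs, ← Real.rpow_mul hB.le, ← Real.rpow_mul hB.le, hpn, hpm, e1,
    Real.rpow_add_natCast hB.ne', Real.rpow_add_natCast hy.ne', Real.rpow_add hB, Real.rpow_two]
  linear_combination B ^ p * y ^ p * h0 + B ^ p * y ^ p * y ^ j * h1

/-- The roles are exchanged: `c₀` accounts for `a U ^ m` and `c₁` for `g U`. Here `q = p m` is the
smaller of the two exponents. -/
theorem IsBalanced.of_power_term {a b g m n B p q c₀ c₁ : ℝ} {j : ℕ} (hm : 0 < m) (hn : 0 < n)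
    (hp : 0 < p) (hB : 0 < B) (hpn : p * n = q + 2) (hpm : p * m = q) (hpq : p = q + j)
    (h0 : b * ((q + 2) * (q + 1) * c₀) * B ^ 2 = -a)
    (h1 : b * ((q + 2) * (q + 1 + j / 2) * c₁) * B ^ 2 = g * B ^ j) :
    IsBalanced a b g m n (B ^ p) p c₀ c₁ j := by
  have hC : 0 < B ^ p := Real.rpow_pos_of_pos hB p
  have hq : 0 < q := hpm ▸ mul_pos hp hm
  refine ⟨hm, hn, hp, by linarith, Or.inl hC, Or.inl hC, fun y hy => ?_⟩
  have e1 : q + 2 - 2 = q := by ring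
  rw [abs_of_pos hC, ← Real.rpow_mul hB.le, ← Real.rpow_mul hB.le, hpn, hpm, e1, hpq,
    Real.rpow_add_natCast hB.ne', Real.rpow_add_natCast hy.ne', Real.rpow_add hB, Real.rpow_two]
  linear_combination B ^ q * y ^ q * h0 + B ^ q * y ^ q * y ^ j * h1

theorem IsArch.isArchWave {v f : ℝ → ℝ} {a b g m n L p c₀ c₁ C : ℝ} {j : ℕ}
    (hv : IsArch v L c₀ c₁ j) (hb : IsBalanced a b g m n C p c₀ c₁ j)
    (hf : ∀ ξ, |ξ| < L → f ξ = C * v ξ ^ p) : IsArchWave a b g m n L p (cutoff L f) := by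
  refine ⟨v, c₀, c₁, C, j, hv, hb, funext fun ξ => ?_⟩
  simp only [cutoff]
  split_ifs with h
  exacts [hf ξ h, rfl]

/-! ### The explicit families -/

/-- Used to write `b` and `g` as signed positive multiples of `a`. The sign conditions then become
positivity, and `a` cancels from the amplitude and the wave number. -/
theorem exists_ratio_of_mul_pos {a x : ℝ} (h : 0 < a * x) : ∃ r, 0 < r ∧ x = r * a := by
  have ha : a ≠ 0 := left_ne_zero_of_mul h.ne'
  refine ⟨x / a, ?_, by field_simp⟩
  rw [show x / a = a * x / a ^ 2 by field_simp]
  positivity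

theorem exists_ratio_of_mul_neg {a x : ℝ} (h : a * x < 0) : ∃ r, 0 < r ∧ x = -(r * a) := by
  obtain ⟨r, hr, hx⟩ := exists_ratio_of_mul_pos (show 0 < a * -x by linarith)
  exact ⟨r, hr, by linarith⟩

variable {a b g n : ℝ}

theorem isArchWave_zsq1 (hb : 0 < a * b) (hg : 0 < a * g) (hn : 1 < n) :
    IsArchWave a b g ((n + 1) / 2) n (Family.zsq1.halfWidth a b g ((n + 1) / 2) n) (2 / (n - 1))
      (Family.zsq1.compacton a b g ((n + 1) / 2) n) := by
  have ha : a ≠ 0 := left_ne_zero_of_mul hb.ne'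
  obtain ⟨ρ, hρ, rfl⟩ := exists_ratio_of_mul_pos hb
  obtain ⟨τ, hτ, rfl⟩ := exists_ratio_of_mul_pos hg
  have hn1 : 0 < n - 1 := by linarith
  have ha' := abs_pos.2 ha
  have hgb : |τ * a * (ρ * a)| = τ * ρ * a ^ 2 := by
    rw [show τ * a * (ρ * a) = τ * ρ * a ^ 2 by ring]; exact abs_of_pos (by positivity)
  have hL : 0 < Family.zsq1.halfWidth a (ρ * a) (τ * a) ((n + 1) / 2) n := by
    simp only [Family.halfWidth, hgb]
    positivity
  have hB : τ * a * (3 * n + 1) / (2 * a * (n + 1)) = τ * (3 * n + 1) / (2 * (n + 1)) := by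
    field_simp
  refine (isArch_parabola (κ := a ^ 2 * (n + 1) * (n - 1) ^ 2 /
    (2 * (τ * a) * (ρ * a) * n * (3 * n + 1) ^ 2)) hL ?_).isArchWave
    (IsBalanced.of_linear_term (B := τ * (3 * n + 1) / (2 * (n + 1))) (ε := 1) (by positivity)
      (by positivity) (by positivity) (by positivity) (Or.inl rfl) ?_ ?_ ?_ ?_) fun ξ _ => ?_
  · simp only [Family.halfWidth, hgb]
    rw [mul_pow, Real.sq_sqrt (by positivity), div_pow, mul_pow, sq_abs]
    field_simp
  · field_simp; ring
  · field_simp; ring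
  · field_simp; ring
  · field_simp; ring
  · simp only [Family.profile, hB, one_mul]

theorem isArchWave_zsq2 (hb : a * b < 0) (hg : 0 < a * g) (hn : 1 < n) (hn2 : n < 2) :
    IsArchWave a b g (2 - n) n (Family.zsq2.halfWidth a b g (2 - n) n) (1 / (n - 1))
      (Family.zsq2.compacton a b g (2 - n) n) := by
  have ha : a ≠ 0 := left_ne_zero_of_mul hb.ne
  obtain ⟨ρ, hρ, rfl⟩ := exists_ratio_of_mul_neg hb
  obtain ⟨τ, hτ, rfl⟩ := exists_ratio_of_mul_pos hg
  have hn1 : 0 < n - 1 := by linarith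
  have hm : 0 < 2 - n := by linarith
  have ha' := abs_pos.2 ha
  have hab : |a * -(ρ * a)| = ρ * a ^ 2 := by
    rw [show a * -(ρ * a) = -(ρ * a ^ 2) by ring, abs_neg]; exact abs_of_pos (by positivity)
  have hL : 0 < Family.zsq2.halfWidth a (-(ρ * a)) (τ * a) (2 - n) n := by
    simp only [Family.halfWidth, hab, abs_mul]
    positivity
  have hB : a * (n + 1) / (2 * (τ * a)) = (n + 1) / (2 * τ) := by
    field_simp
  refine (isArch_parabola (κ := τ ^ 2 * (n - 1) ^ 2 / (ρ * n * (n + 1) ^ 2)) hL ?_).isArchWave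
    (IsBalanced.of_power_term (B := (n + 1) / (2 * τ)) (q := (2 - n) / (n - 1)) hm
      (by positivity) (by positivity) (by positivity) ?_ ?_ ?_ ?_ ?_) fun ξ _ => ?_
  · simp only [Family.halfWidth, hab]
    rw [div_pow, mul_pow, Real.sq_sqrt (by positivity), mul_pow, sq_abs]
    field_simp
  · field_simp; ring
  · field_simp
  · field_simp; push_cast; ring
  · field_simp; ring
  · field_simp; ring
  · simp only [Family.profile, hB]
    congr 2
    field_simp
    ring

theorem isArchWave_cos1 (hb : 0 < a * b) (hg : 0 < a * g) (hn : 1 < n) :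
    IsArchWave a b g n n (Family.cos1.halfWidth a b g n n) (2 / (n - 1))
      (Family.cos1.compacton a b g n n) := by
  have ha : a ≠ 0 := left_ne_zero_of_mul hb.ne'
  obtain ⟨ρ, hρ, rfl⟩ := exists_ratio_of_mul_pos hb
  obtain ⟨τ, hτ, rfl⟩ := exists_ratio_of_mul_pos hg
  have hn1 : 0 < n - 1 := by linarith
  have e1 : ρ * a / a = ρ := by field_simp
  have e2 : a / (ρ * a) = ρ⁻¹ := by field_simp
  have hρs := Real.sqrt_pos.2 hρ
  have hρ2 := Real.sq_sqrt hρ.le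
  have hL : 0 < Family.cos1.halfWidth a (ρ * a) (τ * a) n n := by
    simp only [Family.halfWidth, e1]
    positivity
  have hβ : 0 < Family.cos1.waveNumber a (ρ * a) (τ * a) n n := by
    simp only [Family.waveNumber, e2]
    positivity
  have hB : 2 * n * (τ * a) / ((n + 1) * a) = 2 * n * τ / (n + 1) := by field_simp
  have hA : 0 < 2 * n * τ / (n + 1) := by positivity
  have hAs := Real.sq_sqrt hA.le
  refine (isArch_cos hL hβ ?_).isArchWave
    (IsBalanced.of_linear_term (B := √(2 * n * τ / (n + 1))) (ε := 1) (by positivity)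
      (by positivity) (by positivity) (by positivity) (Or.inl rfl) ?_ ?_ ?_ ?_) fun ξ _ => ?_
  · simp only [Family.halfWidth, Family.waveNumber, e1, e2, Real.sqrt_inv]
    field_simp
  · field_simp; ring
  · field_simp; push_cast; ring
  · simp only [Family.waveNumber, e2, Real.sqrt_inv, hAs, mul_pow, inv_pow, hρ2]
    field_simp; ring
  · simp only [Family.waveNumber, e2, Real.sqrt_inv, hAs, mul_pow, inv_pow, hρ2]
    field_simp; push_cast; ring
  · simp only [Family.profile, hB, one_mul]
    -- The prefactor is an amplitude to the power `1 / (n - 1)`, half the end power, which is why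
    -- `B` is a square root.
    rw [Real.sqrt_eq_rpow, ← Real.rpow_mul hA.le]
    congr 2
    field_simp

theorem isArchWave_cos2 {m : ℝ} (hb : a * b < 0) (hg : 0 < a * g) (hm : 0 < m) (hm1 : m < 1) :
    IsArchWave a b g m 1 (Family.cos2.halfWidth a b g m 1) (2 / (1 - m))
      (Family.cos2.compacton a b g m 1) := by
  have ha : a ≠ 0 := left_ne_zero_of_mul hb.ne
  obtain ⟨ρ, hρ, rfl⟩ := exists_ratio_of_mul_neg hb
  obtain ⟨τ, hτ, rfl⟩ := exists_ratio_of_mul_pos hg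
  have hn1 : 0 < 1 - m := by linarith
  have ha' := abs_pos.2 ha
  have e1 : |-(ρ * a)| / |τ * a| = ρ / τ := by
    rw [abs_neg, abs_mul, abs_mul, abs_of_pos hρ, abs_of_pos hτ]; field_simp
  have e2 : -(τ * a) / (4 * -(ρ * a)) = (ρ / τ)⁻¹ / 2 ^ 2 := by field_simp; norm_num
  have hr : 0 < ρ / τ := by positivity
  have hrs := Real.sqrt_pos.2 hr
  have hr2 := Real.sq_sqrt hr.le
  have e3 : √((ρ / τ)⁻¹ / 2 ^ 2) = (√(ρ / τ))⁻¹ / 2 := by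
    rw [Real.sqrt_div' _ (by norm_num), Real.sqrt_inv, Real.sqrt_sq (by norm_num)]
  have hL : 0 < Family.cos2.halfWidth a (-(ρ * a)) (τ * a) m 1 := by
    simp only [Family.halfWidth, e1]
    positivity
  have hβ : 0 < Family.cos2.waveNumber a (-(ρ * a)) (τ * a) m 1 := by
    simp only [Family.waveNumber, e2, e3]
    positivity
  have hB : 2 * a / (τ * a * (m + 1)) = 2 / (τ * (m + 1)) := by field_simp
  have hA : 0 < 2 / (τ * (m + 1)) := by positivity
  have hAs := Real.sq_sqrt hA.le
  refine (isArch_cos hL hβ ?_).isArchWave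
    (IsBalanced.of_power_term (B := √(2 / (τ * (m + 1)))) (q := 2 * m / (1 - m)) hm
      (by positivity) (by positivity) (by positivity) ?_ ?_ ?_ ?_ ?_) fun ξ _ => ?_
  · simp only [Family.halfWidth, Family.waveNumber, e1, e2, e3]
    field_simp
  · field_simp; ring
  · field_simp
  · field_simp; push_cast; ring
  · simp only [Family.waveNumber, e2, e3, hAs, mul_pow, inv_pow, div_pow, hr2]
    field_simp; ring
  · simp only [Family.waveNumber, e2, e3, hAs, mul_pow, inv_pow, div_pow, hr2]
    field_simp; push_cast; ring
  · simp only [Family.profile, hB]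
    rw [Real.sqrt_eq_rpow, ← Real.rpow_mul hA.le]
    congr 2
    field_simp

/-! ### The families with quartic arches, cn and sn. -/

variable {a n : ℝ}

theorem sq_rpow_quarter (a : ℝ) : (a ^ 2) ^ (1 / 4 : ℝ) = √|a| := by
  rw [← sq_abs, ← Real.rpow_natCast, ← Real.rpow_mul (abs_nonneg a), Real.sqrt_eq_rpow]
  norm_num

theorem rpow_inv_natCast_pow {x : ℝ} (hx : 0 ≤ x) {k : ℕ} (hk : k ≠ 0) :
    (x ^ (1 / k : ℝ)) ^ k = x := by
  rw [← Real.rpow_natCast, ← Real.rpow_mul hx, one_div_mul_cancel (by exact_mod_cast hk),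
    Real.rpow_one]

theorem balanced_quartic_gt {ρ τ β : ℝ} (hρ : 0 < ρ) (hτ : 0 < τ) (hn : 1 < n)
    (hβ : β ^ 2 = (n - 1) ^ 2 / (ρ * n) *
      ((τ / ((3 * n - 1) * (n + 1))) ^ (1 / 4 : ℝ)) ^ 2) :
    IsBalanced a (ρ * a) (τ * a) (2 * n - 1) n
      (1 * ((τ * (3 * n - 1) / (n + 1)) ^ (1 / 4 : ℝ)) ^ (2 / (n - 1))) (2 / (n - 1))
      (β ^ 2 / 2) (-(β ^ 2 / 2)) 4 := by
  have hn1 : 0 < n - 1 := by linarith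
  have h3n : 0 < 3 * n - 1 := by linarith
  have hm : 0 < 2 * n - 1 := by linarith
  have hY : 0 < τ / ((3 * n - 1) * (n + 1)) := by positivity
  have hA : 0 < τ * (3 * n - 1) / (n + 1) := by positivity
  have hY4 := rpow_inv_natCast_pow hY.le (k := 4) (by norm_num)
  have hA4 := rpow_inv_natCast_pow hA.le (k := 4) (by norm_num)
  push_cast at hY4 hA4
  have hB := Real.rpow_pos_of_pos hA (1 / 4)
  have hη := Real.rpow_pos_of_pos hY (1 / 4)
  generalize (τ / ((3 * n - 1) * (n + 1))) ^ (1 / 4 : ℝ) = η at *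
  generalize (τ * (3 * n - 1) / (n + 1)) ^ (1 / 4 : ℝ) = B at *
  -- The quotient `B ^ 4 / η ^ 4` is the perfect square `(3 n - 1) ^ 2`; comparing squares of
  -- positive numbers eliminates the fourth roots.
  have hBη : B ^ 2 = (3 * n - 1) * η ^ 2 := by
    rw [← pow_left_inj₀ (by positivity) (by positivity) two_ne_zero, mul_pow, ← pow_mul,
      ← pow_mul, hY4, hA4]
    field_simp
  refine IsBalanced.of_linear_term hm (by positivity) (by positivity) hB (Or.inl rfl) ?_ ?_ ?_ ?_
  · field_simp; ring
  · field_simp; push_cast; ring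
  · rw [hβ, hBη]
    calc _ = a * (3 * n - 1) * (n + 1) * η ^ 4 := by field_simp; ring
      _ = _ := by rw [hY4]; field_simp
  · rw [show B ^ 4 = B ^ 2 * B ^ 2 by ring, hβ, hBη]
    field_simp; push_cast; ring

theorem balanced_quartic_lt {ρ τ β : ℝ} (hρ : 0 < ρ) (hτ : 0 < τ) (hn : 1 / 2 < n) (hn1 : n < 1)
    (hβ : β ^ 2 = (1 - n) ^ 2 / (ρ * n) *
      ((τ / ((3 * n - 1) * (n + 1))) ^ (1 / 4 : ℝ)) ^ 2) :
    IsBalanced a (-(ρ * a)) (τ * a) (2 * n - 1) n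
      ((((n + 1) / (τ * (3 * n - 1))) ^ (1 / 4 : ℝ)) ^ (2 / (1 - n))) (2 / (1 - n))
      (β ^ 2 / 2) (-(β ^ 2 / 2)) 4 := by
  have hn1 : 0 < 1 - n := by linarith
  have h3n : 0 < 3 * n - 1 := by linarith
  have hm : 0 < 2 * n - 1 := by linarith
  have hn0 : 0 < n := by linarith
  have hY : 0 < τ / ((3 * n - 1) * (n + 1)) := by positivity
  have hA : 0 < (n + 1) / (τ * (3 * n - 1)) := by positivity
  have hY4 := rpow_inv_natCast_pow hY.le (k := 4) (by norm_num)
  have hA4 := rpow_inv_natCast_pow hA.le (k := 4) (by norm_num)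
  push_cast at hY4 hA4
  have hB := Real.rpow_pos_of_pos hA (1 / 4)
  have hη := Real.rpow_pos_of_pos hY (1 / 4)
  generalize (τ / ((3 * n - 1) * (n + 1))) ^ (1 / 4 : ℝ) = η at *
  generalize ((n + 1) / (τ * (3 * n - 1))) ^ (1 / 4 : ℝ) = B at *
  -- Here `B ^ 4 / η ^ 4` is the perfect square `((n + 1) / τ) ^ 2`.
  have hBη : B ^ 2 = (n + 1) / τ * η ^ 2 := by
    rw [← pow_left_inj₀ (by positivity) (by positivity) two_ne_zero, mul_pow, ← pow_mul,
      ← pow_mul, hY4, hA4]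
    field_simp
  refine IsBalanced.of_power_term (q := 2 * (2 * n - 1) / (1 - n)) hm hn0 (by positivity) hB
    ?_ ?_ ?_ ?_ ?_
  · field_simp; ring
  · field_simp
  · field_simp; push_cast; ring
  · rw [hβ, hBη]
    calc _ = -(a * (3 * n - 1) * ((n + 1) / τ) * η ^ 4) := by field_simp; ring
      _ = _ := by rw [hY4]; field_simp
  · rw [show B ^ 4 = B ^ 2 * B ^ 2 by ring, hβ, hBη]
    field_simp; push_cast; ring

/-- The factor `√|a|` split off here cancels against the one in `√(n |b|)`, and the rest is the
inverse of the root in the wave number. -/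
theorem quarter_root_width {τ : ℝ} (ha : a ≠ 0) (hτ : 0 < τ) (hn : 0 < 3 * n - 1) :
    ((3 * n - 1) * (n + 1) / (a * (τ * a))) ^ (1 / 4 : ℝ) =
      ((τ / ((3 * n - 1) * (n + 1))) ^ (1 / 4 : ℝ))⁻¹ * (√|a|)⁻¹ := by
  have hn1 : 0 < n + 1 := by linarith
  rw [← sq_rpow_quarter, ← Real.inv_rpow (by positivity), ← Real.inv_rpow (by positivity),
    ← Real.mul_rpow (by positivity) (by positivity)]
  congr 1
  field_simp

theorem isArchWave_cn2 {b g : ℝ} (hb : 0 < a * b) (hg : 0 < a * g) (hn : 1 < n) :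
    IsArchWave a b g (2 * n - 1) n (Family.cn2.halfWidth a b g (2 * n - 1) n) (2 / (n - 1))
      (Family.cn2.compacton a b g (2 * n - 1) n) := by
  have ha : a ≠ 0 := left_ne_zero_of_mul hb.ne'
  obtain ⟨ρ, hρ, rfl⟩ := exists_ratio_of_mul_pos hb
  obtain ⟨τ, hτ, rfl⟩ := exists_ratio_of_mul_pos hg
  have hn1 : 0 < n - 1 := by linarith
  have h3n : 0 < 3 * n - 1 := by linarith
  have ha' := Real.sqrt_pos.2 (abs_pos.2 ha)
  have hr : 0 < ρ * n := by positivity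
  have hrs := Real.sqrt_pos.2 hr
  have hW := quarter_root_width ha hτ h3n
  have hY : 0 < τ / ((3 * n - 1) * (n + 1)) := by positivity
  have hη := Real.rpow_pos_of_pos hY (1 / 4)
  have hA : 0 < τ * (3 * n - 1) / (n + 1) := by positivity
  have hM : ((1 / √2) ^ 2 : ℝ) = 1 / 2 := by rw [div_pow, Real.sq_sqrt (by norm_num)]; norm_num
  have hK := ellipticK_pos (show ((1 / √2) ^ 2 : ℝ) < 1 by rw [hM]; norm_num)
  have hLe : Family.cn2.halfWidth a (ρ * a) (τ * a) (2 * n - 1) n =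
      √(ρ * n) / (n - 1) * ((τ / ((3 * n - 1) * (n + 1))) ^ (1 / 4 : ℝ))⁻¹ *
        ellipticK ((1 / √2) ^ 2) := by
    simp only [Family.halfWidth, hW]
    rw [abs_mul, abs_of_pos hρ, show n * (ρ * |a|) = ρ * n * |a| by ring, Real.sqrt_mul hr.le]
    field_simp
  have hβe : Family.cn2.waveNumber a (ρ * a) (τ * a) (2 * n - 1) n =
      (n - 1) * (√(ρ * n))⁻¹ * (τ / ((3 * n - 1) * (n + 1))) ^ (1 / 4 : ℝ) := by
    simp only [Family.waveNumber]
    rw [← Real.sqrt_inv, show a / (ρ * a * n) = (ρ * n)⁻¹ by field_simp,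
      show τ * a / (a * (3 * n - 1) * (n + 1)) = τ / ((3 * n - 1) * (n + 1)) by field_simp]
  refine (isArch_jacobiCn hM (by rw [hLe]; positivity)
    (β := Family.cn2.waveNumber a (ρ * a) (τ * a) (2 * n - 1) n) (by rw [hβe]; positivity)
    ?_).isArchWave (balanced_quartic_gt hρ hτ hn ?_) fun ξ _ => ?_
  · rw [hLe, hβe]
    generalize (τ / ((3 * n - 1) * (n + 1))) ^ (1 / 4 : ℝ) = η at hη ⊢
    field_simp
  · rw [hβe, mul_pow, mul_pow, inv_pow, Real.sq_sqrt hr.le, ← div_eq_mul_inv]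
  · simp only [Family.profile]
    rw [show τ * a * (3 * n - 1) / (a * (n + 1)) = τ * (3 * n - 1) / (n + 1) by field_simp,
      one_mul, ← Real.rpow_mul hA.le]
    congr 2
    field_simp
    ring

theorem isArchWave_sn2 {b g : ℝ} (hb : 0 < a * b) (hg : 0 < a * g) (hn : 1 < n) :
    IsArchWave a b g (2 * n - 1) n (Family.sn2.halfWidth a b g (2 * n - 1) n) (2 / (n - 1))
      (Family.sn2.compacton a b g (2 * n - 1) n) := by
  have ha : a ≠ 0 := left_ne_zero_of_mul hb.ne'
  obtain ⟨ρ, hρ, rfl⟩ := exists_ratio_of_mul_pos hb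
  obtain ⟨τ, hτ, rfl⟩ := exists_ratio_of_mul_pos hg
  have hn1 : 0 < n - 1 := by linarith
  have h3n : 0 < 3 * n - 1 := by linarith
  have ha' := Real.sqrt_pos.2 (abs_pos.2 ha)
  have hr : 0 < 2 * ρ * n := by positivity
  have hrs := Real.sqrt_pos.2 hr
  have hW := quarter_root_width ha hτ h3n
  have hY : 0 < τ / ((3 * n - 1) * (n + 1)) := by positivity
  have hη := Real.rpow_pos_of_pos hY (1 / 4)
  have hA : 0 < τ * (3 * n - 1) / (n + 1) := by positivity
  have hK := ellipticK_pos (show (-1 : ℝ) < 1 by norm_num)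
  have hLe : Family.sn2.halfWidth a (ρ * a) (τ * a) (2 * n - 1) n =
      √(2 * ρ * n) / (n - 1) * ((τ / ((3 * n - 1) * (n + 1))) ^ (1 / 4 : ℝ))⁻¹ *
        ellipticK (-1) := by
    simp only [Family.halfWidth, hW]
    rw [abs_mul, abs_of_pos hρ, show 2 * n * (ρ * |a|) = 2 * ρ * n * |a| by ring,
      Real.sqrt_mul hr.le]
    field_simp
  have hβe : Family.sn2.waveNumber a (ρ * a) (τ * a) (2 * n - 1) n =
      (n - 1) * (√(2 * ρ * n))⁻¹ * (τ / ((3 * n - 1) * (n + 1))) ^ (1 / 4 : ℝ) := by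
    simp only [Family.waveNumber]
    rw [← Real.sqrt_inv, show a / (2 * (ρ * a) * n) = (2 * ρ * n)⁻¹ by field_simp,
      show τ * a / (a * (3 * n - 1) * (n + 1)) = τ / ((3 * n - 1) * (n + 1)) by field_simp]
  set β := Family.sn2.waveNumber a (ρ * a) (τ * a) (2 * n - 1) n with hβ
  -- The sn arch has `c₀ = β ^ 2` where the cn arch has `β ^ 2 / 2`, so the balance for cn is reused
  -- with `√2 β`.
  have hb2 := balanced_quartic_gt (a := a) (β := √2 * β) hρ hτ hn (by
    rw [hβe]
    simp only [mul_pow, inv_pow, Real.sq_sqrt hr.le, Real.sq_sqrt zero_le_two]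
    field_simp)
  rw [show (√2 * β) ^ 2 / 2 = β ^ 2 by rw [mul_pow, Real.sq_sqrt zero_le_two]; ring] at hb2
  refine (isArch_jacobiSn (by rw [hLe]; positivity) (β := β) (by rw [hβe]; positivity)
    ?_).isArchWave hb2 fun ξ _ => ?_
  · rw [hLe, hβe]
    generalize (τ / ((3 * n - 1) * (n + 1))) ^ (1 / 4 : ℝ) = η at hη ⊢
    field_simp
  · simp only [Family.profile]
    rw [show τ * a * (3 * n - 1) / (a * (n + 1)) = τ * (3 * n - 1) / (n + 1) by field_simp,
      one_mul, ← Real.rpow_mul hA.le]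
    congr 2
    field_simp
    ring

theorem isArchWave_cn1 {b g : ℝ} (hb : a * b < 0) (hg : 0 < a * g) (hn : 1 / 2 < n)
    (hn1 : n < 1) :
    IsArchWave a b g (2 * n - 1) n (Family.cn1.halfWidth a b g (2 * n - 1) n) (2 / (1 - n))
      (Family.cn1.compacton a b g (2 * n - 1) n) := by
  have ha : a ≠ 0 := left_ne_zero_of_mul hb.ne
  obtain ⟨ρ, hρ, rfl⟩ := exists_ratio_of_mul_neg hb
  obtain ⟨τ, hτ, rfl⟩ := exists_ratio_of_mul_pos hg
  have hn0 : 0 < n := by linarith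
  have hn1' : 0 < 1 - n := by linarith
  have h3n : 0 < 3 * n - 1 := by linarith
  have ha' := Real.sqrt_pos.2 (abs_pos.2 ha)
  have hr : 0 < ρ * n := by positivity
  have hrs := Real.sqrt_pos.2 hr
  have hW := quarter_root_width ha hτ h3n
  have hY : 0 < τ / ((3 * n - 1) * (n + 1)) := by positivity
  have hη := Real.rpow_pos_of_pos hY (1 / 4)
  have hA : 0 < (n + 1) / (τ * (3 * n - 1)) := by positivity
  have hM : ((1 / √2) ^ 2 : ℝ) = 1 / 2 := by rw [div_pow, Real.sq_sqrt (by norm_num)]; norm_num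
  have hK := ellipticK_pos (show ((1 / √2) ^ 2 : ℝ) < 1 by rw [hM]; norm_num)
  have hLe : Family.cn1.halfWidth a (-(ρ * a)) (τ * a) (2 * n - 1) n =
      √(ρ * n) / (1 - n) * ((τ / ((3 * n - 1) * (n + 1))) ^ (1 / 4 : ℝ))⁻¹ *
        ellipticK ((1 / √2) ^ 2) := by
    simp only [Family.halfWidth, hW]
    rw [abs_neg, abs_mul, abs_of_pos hρ, show n * (ρ * |a|) = ρ * n * |a| by ring,
      Real.sqrt_mul hr.le]
    field_simp
  have hβe : Family.cn1.waveNumber a (-(ρ * a)) (τ * a) (2 * n - 1) n =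
      (1 - n) * (√(ρ * n))⁻¹ * (τ / ((3 * n - 1) * (n + 1))) ^ (1 / 4 : ℝ) := by
    simp only [Family.waveNumber]
    rw [← Real.sqrt_inv, show -a / (n * -(ρ * a)) = (ρ * n)⁻¹ by field_simp,
      show τ * a / (a * (3 * n - 1) * (n + 1)) = τ / ((3 * n - 1) * (n + 1)) by field_simp]
  refine (isArch_jacobiCn hM (by rw [hLe]; positivity)
    (β := Family.cn1.waveNumber a (-(ρ * a)) (τ * a) (2 * n - 1) n) (by rw [hβe]; positivity)
    ?_).isArchWave (balanced_quartic_lt hρ hτ hn hn1 ?_) fun ξ _ => ?_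
  · rw [hLe, hβe]
    generalize (τ / ((3 * n - 1) * (n + 1))) ^ (1 / 4 : ℝ) = η at hη ⊢
    field_simp
  · rw [hβe, mul_pow, mul_pow, inv_pow, Real.sq_sqrt hr.le, ← div_eq_mul_inv]
  · simp only [Family.profile]
    rw [show a * (n + 1) / (τ * a * (3 * n - 1)) = (n + 1) / (τ * (3 * n - 1)) by field_simp,
      ← Real.rpow_mul hA.le]
    congr 2
    field_simp
    ring

theorem isArchWave_sn1 {b g : ℝ} (hb : a * b < 0) (hg : 0 < a * g) (hn : 1 / 2 < n)
    (hn1 : n < 1) :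
    IsArchWave a b g (2 * n - 1) n (Family.sn1.halfWidth a b g (2 * n - 1) n) (2 / (1 - n))
      (Family.sn1.compacton a b g (2 * n - 1) n) := by
  have ha : a ≠ 0 := left_ne_zero_of_mul hb.ne
  obtain ⟨ρ, hρ, rfl⟩ := exists_ratio_of_mul_neg hb
  obtain ⟨τ, hτ, rfl⟩ := exists_ratio_of_mul_pos hg
  have hn0 : 0 < n := by linarith
  have hn1' : 0 < 1 - n := by linarith
  have h3n : 0 < 3 * n - 1 := by linarith
  have ha' := Real.sqrt_pos.2 (abs_pos.2 ha)
  have hr : 0 < 2 * ρ * n := by positivity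
  have hrs := Real.sqrt_pos.2 hr
  have hW := quarter_root_width ha hτ h3n
  have hY : 0 < τ / ((3 * n - 1) * (n + 1)) := by positivity
  have hη := Real.rpow_pos_of_pos hY (1 / 4)
  have hA : 0 < (n + 1) / (τ * (3 * n - 1)) := by positivity
  have hK := ellipticK_pos (show (-1 : ℝ) < 1 by norm_num)
  have hLe : Family.sn1.halfWidth a (-(ρ * a)) (τ * a) (2 * n - 1) n =
      √(2 * ρ * n) / (1 - n) * ((τ / ((3 * n - 1) * (n + 1))) ^ (1 / 4 : ℝ))⁻¹ *
        ellipticK (-1) := by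
    simp only [Family.halfWidth, hW]
    rw [abs_neg, abs_mul, abs_of_pos hρ, show 2 * n * (ρ * |a|) = 2 * ρ * n * |a| by ring,
      Real.sqrt_mul hr.le]
    field_simp
  have hβe : Family.sn1.waveNumber a (-(ρ * a)) (τ * a) (2 * n - 1) n =
      (1 - n) * (√(2 * ρ * n))⁻¹ * (τ / ((3 * n - 1) * (n + 1))) ^ (1 / 4 : ℝ) := by
    simp only [Family.waveNumber]
    rw [← Real.sqrt_inv, show -a / (2 * -(ρ * a) * n) = (2 * ρ * n)⁻¹ by field_simp,
      show τ * a / (a * (3 * n - 1) * (n + 1)) = τ / ((3 * n - 1) * (n + 1)) by field_simp]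
  set β := Family.sn1.waveNumber a (-(ρ * a)) (τ * a) (2 * n - 1) n with hβ
  -- Again the balance for cn is reused with `√2 β`.
  have hb2 := balanced_quartic_lt (a := a) (β := √2 * β) hρ hτ hn hn1 (by
    rw [hβe]
    simp only [mul_pow, inv_pow, Real.sq_sqrt hr.le, Real.sq_sqrt zero_le_two]
    field_simp)
  rw [show (√2 * β) ^ 2 / 2 = β ^ 2 by rw [mul_pow, Real.sq_sqrt zero_le_two]; ring] at hb2
  refine (isArch_jacobiSn (by rw [hLe]; positivity) (β := β) (by rw [hβe]; positivity)
    ?_).isArchWave hb2 fun ξ _ => ?_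
  · rw [hLe, hβe]
    generalize (τ / ((3 * n - 1) * (n + 1))) ^ (1 / 4 : ℝ) = η at hη ⊢
    field_simp
  · simp only [Family.profile]
    rw [show a * (n + 1) / (τ * a * (3 * n - 1)) = (n + 1) / (τ * (3 * n - 1)) by field_simp,
      ← Real.rpow_mul hA.le]
    congr 2
    field_simp
    ring

/-! ### Parity of numerators and denominators -/

/-- The reduced denominator divides `k`, so it is odd; then `num * k = j * den` shows that `num` and
`j` have the same parity. Parity can therefore be read off any representation with odd denominator.
-/
theorem exists_rat_of_odd_den (j : ℤ) {k : ℤ} (hk : Odd k) :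
    ∃ q : ℚ, (q : ℝ) = j / k ∧ Odd q.den ∧ (Even q.num ↔ Even j) := by
  have hk0 : k ≠ 0 := by rintro rfl; simp at hk
  have hden : Odd (Rat.divInt j k).den := by
    have h1 := Rat.den_dvd j k
    rw [← Int.odd_coe_nat]
    by_contra h
    rw [Int.not_odd_iff_even] at h
    exact Int.not_even_iff_odd.2 hk (even_iff_two_dvd.2 ((even_iff_two_dvd.1 h).trans h1))
  refine ⟨Rat.divInt j k, by rw [Rat.divInt_eq_div]; push_cast; rfl, hden, ?_⟩
  have h : (Rat.divInt j k).num * k = j * (Rat.divInt j k).den := by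
    have hd : ((Rat.divInt j k).den : ℚ) ≠ 0 := by exact_mod_cast (Rat.divInt j k).den_ne_zero
    have hkq : (k : ℚ) ≠ 0 := by exact_mod_cast hk0
    have := Rat.num_div_den (Rat.divInt j k)
    nth_rewrite 3 [Rat.divInt_eq_div] at this
    rw [div_eq_div_iff hd hkq] at this
    exact_mod_cast this
  have h1 : Even ((Rat.divInt j k).num * k) ↔ Even (Rat.divInt j k).num := by
    rw [Int.even_mul]
    simp [Int.not_even_iff_odd.2 hk]
  rw [← h1, h, Int.even_mul]
  simp [Int.even_coe_nat, Nat.not_even_iff_odd.2 hden]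

theorem evenOverOdd_iff {r : ℝ} :
    EvenOverOdd r ↔ ∃ j k : ℤ, Even j ∧ Odd k ∧ r = j / k := by
  constructor
  · rintro ⟨q, rfl, hd, hn⟩
    exact ⟨q.num, q.den, hn, by exact_mod_cast hd, by
      conv_lhs => rw [← Rat.num_div_den q]
      push_cast; rfl⟩
  · rintro ⟨j, k, hj, hk, rfl⟩
    obtain ⟨q, hq, hd, hn⟩ := exists_rat_of_odd_den j hk
    exact ⟨q, hq, hd, hn.2 hj⟩

/-- For a negative base, a power with a quotient of odd integers as exponent is negative. -/
theorem realPow_neg_of_odd_div_odd {x r : ℝ} (hx : 0 < x) {j k : ℤ} (hj : Odd j) (hk : Odd k)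
    (hr : r = j / k) : realPow (-x) r = -(x ^ r) := by
  obtain ⟨q, hq, hd, hn⟩ := exists_rat_of_odd_den j hk
  rw [← hr] at hq
  have h1 : ¬EvenOverOdd r := by
    rintro ⟨q', hq', -, hn'⟩
    have : q' = q := by exact_mod_cast hq'.trans hq.symm
    exact Int.not_even_iff_odd.2 hj (hn.1 (this ▸ hn'))
  rw [realPow, if_neg (by linarith), if_neg h1, if_pos ⟨q, hq, hd⟩, abs_neg, abs_of_pos hx]

theorem realPow_of_nonneg {x : ℝ} (hx : 0 ≤ x) (r : ℝ) : realPow x r = x ^ r := if_pos hx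

theorem realPow_neg_third {x : ℝ} (hx : 0 < x) : realPow (-x) (1 / 3) = -(x ^ (1 / 3 : ℝ)) :=
  realPow_neg_of_odd_div_odd hx (j := 1) (k := 3) odd_one (by decide) (by norm_num)

theorem EvenOverOdd.three_mul_sub_two {n : ℝ} (h : EvenOverOdd n) : EvenOverOdd (3 * n - 2) := by
  obtain ⟨j, k, hj, hk, rfl⟩ := evenOverOdd_iff.1 h
  have hk0 : (k : ℝ) ≠ 0 := by
    have : k ≠ 0 := by rintro rfl; simp at hk
    exact_mod_cast this
  refine evenOverOdd_iff.2 ⟨3 * j - 2 * k, k, (hj.mul_left 3).sub (even_two_mul k), hk, ?_⟩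
  push_cast
  field_simp

/-- For `n = j / k` with `j` even and `k` odd, `1 / (n - 1) = k / (j - k)` is a quotient of odd
integers, so the sign passes through the power. -/
theorem realPow_sign_mul {ε n T : ℝ} (hn : 1 < n) (hε : ε = 1 ∨ ε = -1 ∧ EvenOverOdd n)
    (hT : 0 < T) : realPow (ε * T) (1 / (n - 1)) = ε * T ^ (1 / (n - 1)) := by
  rcases hε with rfl | ⟨rfl, h⟩
  · rw [one_mul, one_mul, realPow_of_nonneg hT.le]
  · obtain ⟨j, k, hj, hk, rfl⟩ := evenOverOdd_iff.1 h
    have hk0 : (k : ℝ) ≠ 0 := by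
      have : k ≠ 0 := by rintro rfl; simp at hk
      exact_mod_cast this
    rw [neg_one_mul, neg_one_mul]
    refine realPow_neg_of_odd_div_odd hT hk (hj.sub_odd hk) ?_
    push_cast
    rw [div_sub_one hk0, one_div_div]

/-! ### The rational families -/

variable {a b g n : ℝ}

/-- The profile of `ratcn2` and `ratcn5` in terms of an arch. -/
theorem ratio_eq_neg_arch_sq (z : ℝ) (M : ℝ) :
    (jacobiCn z M + 1) / (jacobiCn z M - √3 - 2) =
      -(2 * (jacobiHalf z M / √(3 + √3 - 2 * jacobiHalf z M ^ 2)) ^ 2) := by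
  have hD := jacobiHalf_den_pos z M
  have hc : jacobiCn z M = 2 * jacobiHalf z M ^ 2 - 1 := by rw [two_mul_jacobiHalf_sq]; ring
  rw [div_pow, Real.sq_sqrt hD.le, hc, show 2 * jacobiHalf z M ^ 2 - 1 - √3 - 2 =
    -(3 + √3 - 2 * jacobiHalf z M ^ 2) by ring, div_neg]
  ring

/-- Because `β L = 2 K` and cn changes sign under a shift by `2 K`, `ratcn1` is the same function as
`ratcn2`, and `ratcn4` the same as `ratcn5`. -/
theorem ratio_shift (z : ℝ) :
    (jacobiCn (z + 2 * ellipticK modMinus) modMinus - 1) /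
        (jacobiCn (z + 2 * ellipticK modMinus) modMinus + √3 + 2) =
      (jacobiCn z modMinus + 1) / (jacobiCn z modMinus - √3 - 2) := by
  rw [jacobiCn_add_two_K modMinus_lt, ← neg_div_neg_eq]
  congr 1 <;> ring

/-- The profile is a power of twice the squared arch; rewritten as a power of the arch, its exponent
doubles and the amplitude base becomes `B = √(2 y)`. -/
theorem sqrt_two_mul_mul_rpow {y w : ℝ} (hy : 0 < y) (hw : 0 < w) (r : ℝ) :
    (y * (2 * w ^ 2)) ^ r = √(2 * y) ^ (2 * r) * w ^ (2 * r) := by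
  rw [← Real.mul_rpow (Real.sqrt_nonneg _) hw.le, Real.rpow_mul (by positivity), Real.rpow_two,
    mul_pow, Real.sq_sqrt (by positivity)]
  congr 1
  ring

theorem sixth_root_pos {Z : ℝ} (hZ : 0 < Z) : 0 < Z ^ (1 / 6 : ℝ) := Real.rpow_pos_of_pos hZ _

theorem sixth_root_pow {Z : ℝ} (hZ : 0 < Z) : (Z ^ (1 / 6 : ℝ)) ^ 6 = Z := by
  simpa using rpow_inv_natCast_pow hZ.le (k := 6) (by norm_num)

theorem cube_root_pow {Z : ℝ} (hZ : 0 < Z) : (Z ^ (1 / 3 : ℝ)) ^ 3 = Z := by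
  simpa using rpow_inv_natCast_pow hZ.le (k := 3) (by norm_num)

/-- These are the two coefficient conditions for the modulus `k₋`, with generic letters so that one
computation serves both `ratcn2` and `ratcn5`. -/
theorem ratio_minus_relations {ρ τ N N₁ K ζ y : ℝ} (hρ : 0 < ρ) (hτ : 0 < τ) (hN : 0 < N)
    (hN₁ : 0 < N₁) (hK : 0 < K) (hζ : 0 < ζ) (hy : 0 < y)
    (hζ6 : ζ ^ 6 = 12 * √3 * τ ^ 2 / (ρ ^ 3 * N ^ 3 * N₁ ^ 2 * K))
    (hy3 : y ^ 3 = (5 + 3 * √3) * τ * K / (2 * N₁)) :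
    ρ * N * N₁ * y * ζ ^ 2 * (3 - √3) = 6 * τ ∧
      ζ ^ 2 * ρ * N * K * (3 + 2 * √3) = 6 * y ^ 2 := by
  have hs2 := sq_sqrt_three
  have h3 : 0 < 3 - √3 := by linarith [sqrt_three_lt_two]
  have key : ρ * N * N₁ * y * ζ ^ 2 * (3 - √3) = 6 * τ := by
    -- Cubing turns `y ζ ^ 2` into the known `y ^ 3 ζ ^ 6`; the constants then combine through `√3
    -- (5 + 3√3)(3 - √3) ^ 3 = 36`.
    rw [← pow_left_inj₀ (by positivity) (by positivity) three_ne_zero]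
    calc _ = ρ ^ 3 * N ^ 3 * N₁ ^ 3 * y ^ 3 * ζ ^ 6 * (3 - √3) ^ 3 := by ring
      _ = 6 * τ ^ 3 * (√3 * (5 + 3 * √3) * (3 - √3) ^ 3) := by
          rw [hy3, hζ6]; field_simp; ring
      _ = _ := by
          linear_combination 6 * τ ^ 3 * (12 - 45 * √3 + 22 * √3 ^ 2 - 3 * √3 ^ 3) * hs2
  refine ⟨key, mul_left_cancel₀ (show N₁ * (3 - √3) * y ≠ 0 by positivity) ?_⟩
  calc _ = ρ * N * N₁ * y * ζ ^ 2 * (3 - √3) * (K * (3 + 2 * √3)) := by ring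
    _ = 6 * (N₁ * (3 - √3)) * y ^ 3 := by
        rw [key, hy3]
        field_simp
        linear_combination 3 * hs2
    _ = _ := by ring

theorem ratio_plus_relations {ρ τ N N₁ K ζ y : ℝ} (hρ : 0 < ρ) (hτ : 0 < τ) (hN : 0 < N)
    (hN₁ : 0 < N₁) (hK : 0 < K) (hζ : 0 < ζ) (hy : 0 < y)
    (hζ6 : ζ ^ 6 = 12 * √3 * τ ^ 2 / (ρ ^ 3 * N ^ 3 * N₁ ^ 2 * K))
    (hy3 : y ^ 3 = (5 + 3 * √3) * N₁ / (τ * K)) :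
    ρ * N * K * y ^ 2 * ζ ^ 2 * (2 * √3 - 3) = 6 ∧
      ρ * N * N₁ * ζ ^ 2 * (3 + √3) = 6 * τ * y := by
  have hs2 := sq_sqrt_three
  have h3 : 0 < 2 * √3 - 3 := by nlinarith [one_lt_sqrt_three]
  have key : ρ * N * K * y ^ 2 * ζ ^ 2 * (2 * √3 - 3) = 6 := by
    -- After cubing, the constants combine through `√3 (5 + 3√3) ^ 2 (2√3 - 3) ^ 3 = 18`.
    rw [← pow_left_inj₀ (by positivity) (by positivity) three_ne_zero]
    calc _ = ρ ^ 3 * N ^ 3 * K ^ 3 * (y ^ 3) ^ 2 * ζ ^ 6 * (2 * √3 - 3) ^ 3 := by ring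
      _ = 12 * (√3 * (5 + 3 * √3) ^ 2 * (2 * √3 - 3) ^ 3) := by
          rw [hy3, hζ6]; field_simp
      _ = _ := by
          linear_combination 12 * (6 + 225 * √3 - 178 * √3 ^ 2 - 84 * √3 ^ 3 + 72 * √3 ^ 4) *
            hs2
  refine ⟨key, mul_left_cancel₀ (show K * y ^ 2 * (2 * √3 - 3) ≠ 0 by positivity) ?_⟩
  calc _ = ρ * N * K * y ^ 2 * ζ ^ 2 * (2 * √3 - 3) * (N₁ * (3 + √3)) := by ring
    _ = 6 * τ * (K * (2 * √3 - 3)) * y ^ 3 := by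
        rw [key, hy3]
        field_simp
        linear_combination -6 * hs2
    _ = _ := by ring

theorem isArchWave_ratcn2 (hb : 0 < a * b) (hg : 0 < a * g ∨ a * g < 0 ∧ EvenOverOdd n)
    (hn : 1 < n) :
    IsArchWave a b g (3 * n - 2) n (Family.ratcn2.halfWidth a b g (3 * n - 2) n) (2 / (n - 1))
      (Family.ratcn2.compacton a b g (3 * n - 2) n) := by
  have ha : a ≠ 0 := left_ne_zero_of_mul hb.ne'
  obtain ⟨ρ, hρ, rfl⟩ := exists_ratio_of_mul_pos hb
  -- The sign `ε` of `g` relative to `a` is also the sign of the profile; both cases are treated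
  -- together.
  obtain ⟨ε, τ, hτ, rfl, hε⟩ : ∃ ε τ, 0 < τ ∧ g = ε * (τ * a) ∧
      (ε = 1 ∨ ε = -1 ∧ EvenOverOdd n) := by
    rcases hg with hg | ⟨hg, he⟩
    · obtain ⟨τ, hτ, h⟩ := exists_ratio_of_mul_pos hg
      exact ⟨1, τ, hτ, by rw [h, one_mul], Or.inl rfl⟩
    · obtain ⟨τ, hτ, h⟩ := exists_ratio_of_mul_neg hg
      exact ⟨-1, τ, hτ, by rw [h, neg_one_mul], Or.inr ⟨rfl, he⟩⟩
  have hε2 : ε ^ 2 = 1 := by rcases hε with h | ⟨h, -⟩ <;> simp [h]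
  have hn1 : 0 < n - 1 := by linarith
  have h2n : 0 < 2 * n - 1 := by linarith
  have hm : 0 < 3 * n - 2 := by linarith
  have hs := Real.sqrt_pos.2 (show (0 : ℝ) < 3 by norm_num)
  have hs2 := sq_sqrt_three
  have hK := ellipticK_pos modMinus_lt
  obtain ⟨Z, hZe⟩ : ∃ Z, Z = 12 * √3 * τ ^ 2 / (ρ ^ 3 * n ^ 3 * (n + 1) ^ 2 * (2 * n - 1)) :=
    ⟨_, rfl⟩
  have hZ : 0 < Z := by rw [hZe]; positivity
  obtain ⟨X, hXe⟩ : ∃ X, X = (5 + 3 * √3) * τ * (2 * n - 1) / (2 * (n + 1)) := ⟨_, rfl⟩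
  have hX : 0 < X := by rw [hXe]; positivity
  have hζ := sixth_root_pos hZ
  have hζ6 := sixth_root_pow hZ
  have hy := Real.rpow_pos_of_pos hX (1 / 3)
  have hy3 := cube_root_pow hX
  obtain ⟨key, key2⟩ := ratio_minus_relations hρ hτ (by positivity) (by positivity) h2n hζ hy
    (hζ6.trans hZe) (hy3.trans hXe)
  have hLe : Family.ratcn2.halfWidth a (ρ * a) (ε * (τ * a)) (3 * n - 2) n =
      2 / (n - 1) * (Z ^ (1 / 6 : ℝ))⁻¹ * ellipticK modMinus := by
    simp only [Family.halfWidth]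
    rw [← Real.inv_rpow hZ.le, hZe]
    congr 3
    rw [mul_pow ε, hε2]
    field_simp
  have hβe : Family.ratcn2.waveNumber a (ρ * a) (ε * (τ * a)) (3 * n - 2) n =
      (n - 1) * Z ^ (1 / 6 : ℝ) := by
    simp only [Family.waveNumber]
    rw [hZe]
    congr 2
    rw [mul_pow ε, hε2]
    field_simp
  have hXr : realPow ((5 + 3 * √3) * (ε * (τ * a)) * (2 * n - 1) / (-2 * a * (n + 1))) (1 / 3) =
      -ε * X ^ (1 / 3 : ℝ) := by
    rw [show (5 + 3 * √3) * (ε * (τ * a)) * (2 * n - 1) / (-2 * a * (n + 1)) = -ε * X by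
      rw [hXe]; field_simp]
    rcases hε with h | ⟨h, -⟩
    · rw [h, neg_one_mul, neg_one_mul, realPow_neg_third hX]
    · rw [h, neg_neg, one_mul, one_mul, realPow_of_nonneg hX.le]
  set β := Family.ratcn2.waveNumber a (ρ * a) (ε * (τ * a)) (3 * n - 2) n with hβ
  have hβ0 : 0 < β := by rw [hβe]; positivity
  have hL0 : 0 < Family.ratcn2.halfWidth a (ρ * a) (ε * (τ * a)) (3 * n - 2) n := by
    rw [hLe]; positivity
  have hβL : β * Family.ratcn2.halfWidth a (ρ * a) (ε * (τ * a)) (3 * n - 2) n =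
      2 * ellipticK modMinus := by
    rw [hLe, hβe]; field_simp
  have harch := isArch_jacobiHalf hL0 hβ0 hβL
  refine harch.isArchWave
    (IsBalanced.of_linear_term (B := √(2 * X ^ (1 / 3 : ℝ))) (ε := ε) hm (by positivity)
      (by positivity) (by positivity)
      (hε.imp_right fun h => ⟨h.1, h.2.three_mul_sub_two, h.2⟩) ?_ ?_ ?_ ?_) fun ξ hξ => ?_
  · field_simp; ring
  · field_simp; push_cast; ring
  · rw [Real.sq_sqrt (by positivity), hβe]
    generalize Z ^ (1 / 6 : ℝ) = ζ at key key2 ⊢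
    generalize X ^ (1 / 3 : ℝ) = y at key key2 ⊢
    calc _ = ρ * n * (n + 1) * y * ζ ^ 2 * (3 - √3) * (a / 6) := by field_simp; ring
      _ = ε ^ 2 * τ * a := by rw [key, hε2]; ring
      _ = _ := by ring
  · rw [show √(2 * X ^ (1 / 3 : ℝ)) ^ 6 = (√(2 * X ^ (1 / 3 : ℝ)) ^ 2) ^ 3 by ring,
      Real.sq_sqrt (by positivity), hβe]
    generalize Z ^ (1 / 6 : ℝ) = ζ at key key2 ⊢
    generalize X ^ (1 / 3 : ℝ) = y at key key2 ⊢
    calc _ = -(ζ ^ 2 * ρ * n * (2 * n - 1) * (3 + 2 * √3)) * (4 / 3 * y * a) := by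
          field_simp; push_cast; ring
      _ = _ := by rw [key2]; ring
  · have hv := harch.pos ξ hξ
    simp only [Family.profile]
    rw [hXr, ← hβ, ratio_eq_neg_arch_sq, neg_mul ε, neg_mul_neg, mul_assoc, realPow_sign_mul hn hε
      (by positivity), sqrt_two_mul_mul_rpow hy hv, mul_one_div, mul_assoc]

theorem ratcn2_waveNumber_mul_halfWidth {m : ℝ} (hb : 0 < a * b) (hg : g ≠ 0) (hn : 1 < n) :
    Family.ratcn2.waveNumber a b g m n * Family.ratcn2.halfWidth a b g m n =
      2 * ellipticK modMinus := by
  have ha : a ≠ 0 := left_ne_zero_of_mul hb.ne'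
  obtain ⟨ρ, hρ, rfl⟩ := exists_ratio_of_mul_pos hb
  have hn1 : 0 < n - 1 := by linarith
  have h2n : 0 < 2 * n - 1 := by linarith
  obtain ⟨Z, hZe⟩ : ∃ Z, Z = 12 * √3 * a * g ^ 2 /
    ((ρ * a) ^ 3 * n ^ 3 * (n + 1) ^ 2 * (2 * n - 1)) := ⟨_, rfl⟩
  have hZ : 0 < Z := by
    rw [hZe, show 12 * √3 * a * g ^ 2 / ((ρ * a) ^ 3 * n ^ 3 * (n + 1) ^ 2 * (2 * n - 1)) =
      12 * √3 * g ^ 2 / (ρ ^ 3 * a ^ 2 * n ^ 3 * (n + 1) ^ 2 * (2 * n - 1)) by field_simp]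
    positivity
  simp only [Family.waveNumber, Family.halfWidth]
  rw [← hZe, ← inv_div (12 * √3 * a * g ^ 2), ← hZe, Real.inv_rpow hZ.le]
  have := sixth_root_pos hZ
  field_simp

theorem isArchWave_ratcn1 (hb : 0 < a * b) (hg : 0 < a * g ∨ a * g < 0 ∧ EvenOverOdd n)
    (hn : 1 < n) :
    IsArchWave a b g (3 * n - 2) n (Family.ratcn1.halfWidth a b g (3 * n - 2) n) (2 / (n - 1))
      (Family.ratcn1.compacton a b g (3 * n - 2) n) := by
  have hg0 : g ≠ 0 := by
    rintro rfl
    simp at hg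
  have h := ratcn2_waveNumber_mul_halfWidth (m := 3 * n - 2) hb hg0 hn
  have hp : Family.ratcn1.profile a b g (3 * n - 2) n =
      Family.ratcn2.profile a b g (3 * n - 2) n := by
    funext ξ
    change realPow (_ * ((jacobiCn (Family.ratcn2.waveNumber a b g (3 * n - 2) n *
      (ξ + Family.ratcn2.halfWidth a b g (3 * n - 2) n)) modMinus - 1) / (jacobiCn
        (Family.ratcn2.waveNumber a b g (3 * n - 2) n *
      (ξ + Family.ratcn2.halfWidth a b g (3 * n - 2) n)) modMinus + √3 + 2))) _ = _
    rw [mul_add (Family.ratcn2.waveNumber a b g (3 * n - 2) n), h, ratio_shift]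
    rfl
  rw [Family.compacton, hp]
  exact isArchWave_ratcn2 hb hg hn

theorem ratcn5_waveNumber_mul_halfWidth {m : ℝ} (hb : a * b < 0) (hg : 0 < a * g)
    (hn : 1 / 3 < n) (hn1 : n < 1) : 0 < Family.ratcn5.waveNumber a b g m n ∧
      Family.ratcn5.waveNumber a b g m n * Family.ratcn5.halfWidth a b g m n =
        2 * ellipticK modMinus := by
  have ha : a ≠ 0 := left_ne_zero_of_mul hb.ne
  obtain ⟨ρ, hρ, rfl⟩ := exists_ratio_of_mul_neg hb
  obtain ⟨τ, hτ, rfl⟩ := exists_ratio_of_mul_pos hg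
  have hn0 : 0 < n := by linarith
  have hn1' : 0 < 1 - n := by linarith
  have h5n : 0 < 5 * n - 1 := by linarith
  have ha' := abs_pos.2 ha
  obtain ⟨Z, hZe⟩ : ∃ Z, Z = 3 * √3 * τ / (2 * ρ ^ 3 * n ^ 3 * (n + 1) * (5 * n - 1) ^ 2) :=
    ⟨_, rfl⟩
  have hZ : 0 < Z := by rw [hZe]; positivity
  have hζ := sixth_root_pos hZ
  have e1 : -3 * √3 * a ^ 2 * (τ * a) /
      (2 * (-(ρ * a)) ^ 3 * n ^ 3 * (n + 1) * (5 * n - 1) ^ 2) = Z := by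
    rw [hZe]; field_simp
  have e2 : 2 * |-(ρ * a)| ^ 3 * n ^ 3 * (n + 1) * (5 * n - 1) ^ 2 /
      (3 * √3 * a ^ 2 * |τ * a|) = Z⁻¹ := by
    rw [hZe, abs_neg, abs_mul, abs_mul, abs_of_pos hρ, abs_of_pos hτ, ← sq_abs a]
    field_simp
  simp only [Family.waveNumber, Family.halfWidth, e1, e2, Real.inv_rpow hZ.le]
  refine ⟨by positivity, ?_⟩
  field_simp

theorem isArchWave_ratcn5 (hb : a * b < 0) (hg : 0 < a * g) (hn : 1 / 3 < n) (hn1 : n < 1) :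
    IsArchWave a b g ((3 * n - 1) / 2) n (Family.ratcn5.halfWidth a b g ((3 * n - 1) / 2) n)
      (4 / (1 - n)) (Family.ratcn5.compacton a b g ((3 * n - 1) / 2) n) := by
  obtain ⟨hβ0, hβL⟩ := ratcn5_waveNumber_mul_halfWidth (m := (3 * n - 1) / 2) hb hg hn hn1
  have hK := ellipticK_pos modMinus_lt
  have hL0 : 0 < Family.ratcn5.halfWidth a b g ((3 * n - 1) / 2) n :=
    pos_of_mul_pos_right (by rw [hβL]; positivity) hβ0.le
  have harch := isArch_jacobiHalf hL0 hβ0 hβL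
  have ha : a ≠ 0 := left_ne_zero_of_mul hb.ne
  obtain ⟨ρ, hρ, rfl⟩ := exists_ratio_of_mul_neg hb
  obtain ⟨τ, hτ, rfl⟩ := exists_ratio_of_mul_pos hg
  have hn0 : 0 < n := by linarith
  have hn1' : 0 < 1 - n := by linarith
  have h5n : 0 < 5 * n - 1 := by linarith
  have h3n : 0 < 3 * n - 1 := by linarith
  obtain ⟨Z, hZe⟩ : ∃ Z, Z = 3 * √3 * τ / (2 * ρ ^ 3 * n ^ 3 * (n + 1) * (5 * n - 1) ^ 2) :=
    ⟨_, rfl⟩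
  have hZ : 0 < Z := by rw [hZe]; positivity
  obtain ⟨Y, hYe⟩ : ∃ Y, Y = (5 + 3 * √3) * (n + 1) / (2 * τ * (5 * n - 1)) := ⟨_, rfl⟩
  have hY : 0 < Y := by rw [hYe]; positivity
  have hζ := sixth_root_pos hZ
  have hy := Real.rpow_pos_of_pos hY (1 / 3)
  -- Since the roles of `g U` and `a U ^ m` are exchanged, the relations are used with `2 ρ / τ` and
  -- `1 / τ` in place of `ρ` and `τ`; this substitution reproduces `Z` and `Y`.
  obtain ⟨key, key2⟩ := ratio_minus_relations (ρ := 2 * ρ / τ) (τ := τ⁻¹) (N := n)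
    (N₁ := 5 * n - 1) (K := n + 1) (by positivity) (by positivity) hn0 h5n (by positivity) hζ hy
    (by rw [sixth_root_pow hZ, hZe]; field_simp; norm_num)
    (by rw [cube_root_pow hY, hYe]; field_simp)
  have hβe : Family.ratcn5.waveNumber a (-(ρ * a)) (τ * a) ((3 * n - 1) / 2) n =
      (1 - n) * Z ^ (1 / 6 : ℝ) := by
    simp only [Family.waveNumber]
    rw [hZe]
    congr 2
    field_simp
  have hYr : realPow ((5 + 3 * √3) * a * (n + 1) / (-2 * (τ * a) * (5 * n - 1))) (1 / 3) =
      -Y ^ (1 / 3 : ℝ) := by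
    rw [show (5 + 3 * √3) * a * (n + 1) / (-2 * (τ * a) * (5 * n - 1)) = -Y by
      rw [hYe]; field_simp, realPow_neg_third hY]
  refine harch.isArchWave
    (IsBalanced.of_power_term (B := √(2 * Y ^ (1 / 3 : ℝ))) (q := 2 * (3 * n - 1) / (1 - n))
      (by positivity) hn0 (by positivity) (by positivity) ?_ ?_ ?_ ?_ ?_) fun ξ hξ => ?_
  · field_simp; ring
  · field_simp; norm_num; ring
  · field_simp; push_cast; ring
  · rw [Real.sq_sqrt (by positivity), hβe]
    generalize Z ^ (1 / 6 : ℝ) = ζ at key key2 ⊢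
    generalize Y ^ (1 / 3 : ℝ) = y at key key2 ⊢
    calc _ = -(2 * ρ / τ * n * (5 * n - 1) * y * ζ ^ 2 * (3 - √3) * (a * τ / 6)) := by
          field_simp; ring
      _ = _ := by rw [key]; field_simp
  · rw [show √(2 * Y ^ (1 / 3 : ℝ)) ^ 6 = (√(2 * Y ^ (1 / 3 : ℝ)) ^ 2) ^ 3 by ring,
      Real.sq_sqrt (by positivity), hβe]
    generalize Z ^ (1 / 6 : ℝ) = ζ at key key2 ⊢
    generalize Y ^ (1 / 3 : ℝ) = y at key key2 ⊢
    calc _ = ζ ^ 2 * (2 * ρ / τ) * n * (n + 1) * (3 + 2 * √3) * (4 / 3 * y * a * τ) := by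
          field_simp; push_cast; ring
      _ = _ := by rw [key2]; ring
  · have hv := harch.pos ξ hξ
    simp only [Family.profile]
    rw [hYr, ratio_eq_neg_arch_sq, neg_mul_neg, sqrt_two_mul_mul_rpow hy hv,
      show 2 * (2 / (1 - n)) = 4 / (1 - n) by ring]

theorem isArchWave_ratcn4 (hb : a * b < 0) (hg : 0 < a * g) (hn : 1 / 3 < n) (hn1 : n < 1) :
    IsArchWave a b g ((3 * n - 1) / 2) n (Family.ratcn4.halfWidth a b g ((3 * n - 1) / 2) n)
      (4 / (1 - n)) (Family.ratcn4.compacton a b g ((3 * n - 1) / 2) n) := by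
  obtain ⟨-, h⟩ := ratcn5_waveNumber_mul_halfWidth (m := (3 * n - 1) / 2) hb hg hn hn1
  have hp : Family.ratcn4.profile a b g ((3 * n - 1) / 2) n =
      Family.ratcn5.profile a b g ((3 * n - 1) / 2) n := by
    funext ξ
    change (_ * ((jacobiCn (Family.ratcn5.waveNumber a b g ((3 * n - 1) / 2) n *
      (ξ + Family.ratcn5.halfWidth a b g ((3 * n - 1) / 2) n)) modMinus - 1) / (jacobiCn
        (Family.ratcn5.waveNumber a b g ((3 * n - 1) / 2) n *
      (ξ + Family.ratcn5.halfWidth a b g ((3 * n - 1) / 2) n)) modMinus + √3 + 2))) ^ _ = _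
    rw [mul_add (Family.ratcn5.waveNumber a b g ((3 * n - 1) / 2) n), h, ratio_shift]
    rfl
  rw [Family.compacton, hp]
  exact isArchWave_ratcn5 hb hg hn hn1

/-! ### The rational families with modulus `k₊`. -/

theorem jacobiArccn_modPlus_pos : 0 < jacobiArccn (2 - √3) modPlus :=
  jacobiArccn_pos modPlus_lt (by linarith [one_lt_sqrt_three])

theorem isArchWave_ratcn3 (hb : a * b < 0) (hg : 0 < a * g) (hn : 2 / 3 < n) (hn1 : n < 1) :
    IsArchWave a b g (3 * n - 2) n (Family.ratcn3.halfWidth a b g (3 * n - 2) n)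
      (1 / (1 - n)) (Family.ratcn3.compacton a b g (3 * n - 2) n) := by
  have ha : a ≠ 0 := left_ne_zero_of_mul hb.ne
  obtain ⟨ρ, hρ, rfl⟩ := exists_ratio_of_mul_neg hb
  obtain ⟨τ, hτ, rfl⟩ := exists_ratio_of_mul_pos hg
  have hn0 : 0 < n := by linarith
  have hn1' : 0 < 1 - n := by linarith
  have h2n : 0 < 2 * n - 1 := by linarith
  have hm : 0 < 3 * n - 2 := by linarith
  have ha' := abs_pos.2 ha
  have hK := jacobiArccn_modPlus_pos
  obtain ⟨Z, hZe⟩ : ∃ Z, Z = 12 * √3 * τ ^ 2 / (ρ ^ 3 * n ^ 3 * (n + 1) ^ 2 * (2 * n - 1)) :=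
    ⟨_, rfl⟩
  have hZ : 0 < Z := by rw [hZe]; positivity
  obtain ⟨Y, hYe⟩ : ∃ Y, Y = (5 + 3 * √3) * (n + 1) / (τ * (2 * n - 1)) := ⟨_, rfl⟩
  have hY : 0 < Y := by rw [hYe]; positivity
  have hζ := sixth_root_pos hZ
  have hy := Real.rpow_pos_of_pos hY (1 / 3)
  obtain ⟨key, key2⟩ := ratio_plus_relations hρ hτ hn0 (by positivity) h2n hζ hy
    ((sixth_root_pow hZ).trans hZe) ((cube_root_pow hY).trans hYe)
  have hβe : Family.ratcn3.waveNumber a (-(ρ * a)) (τ * a) (3 * n - 2) n =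
      (1 - n) * Z ^ (1 / 6 : ℝ) := by
    simp only [Family.waveNumber]
    rw [hZe]
    congr 2
    field_simp
  have hLe : Family.ratcn3.halfWidth a (-(ρ * a)) (τ * a) (3 * n - 2) n =
      1 / (1 - n) * (Z ^ (1 / 6 : ℝ))⁻¹ * jacobiArccn (2 - √3) modPlus := by
    simp only [Family.halfWidth]
    rw [← Real.inv_rpow hZ.le, hZe, abs_neg, abs_mul, abs_of_pos hρ, mul_pow τ, ← sq_abs a]
    congr 3
    field_simp
  set β := Family.ratcn3.waveNumber a (-(ρ * a)) (τ * a) (3 * n - 2) n with hβ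
  have harch := isArch_ratcn (L := Family.ratcn3.halfWidth a (-(ρ * a)) (τ * a) (3 * n - 2) n)
    (by rw [hLe]; positivity) (β := β) (by rw [hβe]; positivity)
    (by rw [hLe, hβe]; field_simp)
  refine harch.isArchWave
    (IsBalanced.of_power_term (B := Y ^ (1 / 3 : ℝ)) (q := (3 * n - 2) / (1 - n))
      (by positivity) hn0 (by positivity) (by positivity) ?_ ?_ ?_ ?_ ?_) fun ξ hξ => ?_
  · field_simp; ring
  · field_simp
  · field_simp; push_cast; ring
  · rw [hβe]
    generalize Z ^ (1 / 6 : ℝ) = ζ at key key2 ⊢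
    generalize Y ^ (1 / 3 : ℝ) = y at key key2 ⊢
    calc _ = -(ρ * n * (2 * n - 1) * y ^ 2 * ζ ^ 2 * (2 * √3 - 3) * (a / 6)) := by
          field_simp; ring
      _ = _ := by rw [key]; field_simp
  · rw [hβe]
    generalize Z ^ (1 / 6 : ℝ) = ζ at key key2 ⊢
    generalize Y ^ (1 / 3 : ℝ) = y at key key2 ⊢
    calc _ = ρ * n * (n + 1) * ζ ^ 2 * (3 + √3) * (a * y ^ 2 / 6) := by
          field_simp; push_cast; ring
      _ = _ := by rw [key2]; ring
  · simp only [Family.profile]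
    rw [← hβ, show (5 + 3 * √3) * a * (n + 1) / (τ * a * (2 * n - 1)) = Y by
      rw [hYe]; field_simp, ← Real.rpow_mul hY.le]
    congr 2
    field_simp

theorem isArchWave_ratcn6 (hb : 0 < a * b) (hg : 0 < a * g) (hn : 1 < n) :
    IsArchWave a b g ((3 * n - 1) / 2) n (Family.ratcn6.halfWidth a b g ((3 * n - 1) / 2) n)
      (2 / (n - 1)) (Family.ratcn6.compacton a b g ((3 * n - 1) / 2) n) := by
  have ha : a ≠ 0 := left_ne_zero_of_mul hb.ne'
  obtain ⟨ρ, hρ, rfl⟩ := exists_ratio_of_mul_pos hb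
  obtain ⟨τ, hτ, rfl⟩ := exists_ratio_of_mul_pos hg
  have hn0 : 0 < n := by linarith
  have hn1' : 0 < n - 1 := by linarith
  have h5n : 0 < 5 * n - 1 := by linarith
  have hm : 0 < 3 * n - 1 := by linarith
  have ha' := abs_pos.2 ha
  have hK := jacobiArccn_modPlus_pos
  obtain ⟨Z, hZe⟩ : ∃ Z, Z = 3 * √3 * τ / (2 * ρ ^ 3 * n ^ 3 * (n + 1) * (5 * n - 1) ^ 2) :=
    ⟨_, rfl⟩
  have hZ : 0 < Z := by rw [hZe]; positivity
  obtain ⟨Y, hYe⟩ : ∃ Y, Y = (5 + 3 * √3) * τ * (5 * n - 1) / (n + 1) := ⟨_, rfl⟩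
  have hY : 0 < Y := by rw [hYe]; positivity
  have hζ := sixth_root_pos hZ
  have hy := Real.rpow_pos_of_pos hY (1 / 3)
  -- The same substitution `2 ρ / τ`, `1 / τ` carries the relations of `ratcn3` over to `ratcn6`.
  obtain ⟨key, key2⟩ := ratio_plus_relations (ρ := 2 * ρ / τ) (τ := τ⁻¹) (N := n)
    (N₁ := 5 * n - 1) (K := n + 1) (by positivity) (by positivity) hn0 h5n (by positivity) hζ hy
    (by rw [sixth_root_pow hZ, hZe]; field_simp; norm_num)
    (by rw [cube_root_pow hY, hYe]; field_simp)
  have hβe : Family.ratcn6.waveNumber a (ρ * a) (τ * a) ((3 * n - 1) / 2) n =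
      (n - 1) * Z ^ (1 / 6 : ℝ) := by
    simp only [Family.waveNumber]
    rw [hZe]
    congr 2
    field_simp
  have hLe : Family.ratcn6.halfWidth a (ρ * a) (τ * a) ((3 * n - 1) / 2) n =
      1 / (n - 1) * (Z ^ (1 / 6 : ℝ))⁻¹ * jacobiArccn (2 - √3) modPlus := by
    simp only [Family.halfWidth]
    rw [← Real.inv_rpow hZ.le, hZe, abs_mul, abs_mul, abs_of_pos hρ, abs_of_pos hτ, ← sq_abs a]
    congr 3
    field_simp
  set β := Family.ratcn6.waveNumber a (ρ * a) (τ * a) ((3 * n - 1) / 2) n with hβ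
  have harch := isArch_ratcn
    (L := Family.ratcn6.halfWidth a (ρ * a) (τ * a) ((3 * n - 1) / 2) n)
    (by rw [hLe]; positivity) (β := β) (by rw [hβe]; positivity)
    (by rw [hLe, hβe]; field_simp)
  refine harch.isArchWave
    (IsBalanced.of_linear_term (B := Y ^ (1 / 3 : ℝ)) (ε := 1) (by positivity) hn0 (by positivity)
      (by positivity) (Or.inl rfl) ?_ ?_ ?_ ?_) fun ξ hξ => ?_
  · field_simp; ring
  · field_simp; push_cast; ring
  · rw [hβe]
    generalize Z ^ (1 / 6 : ℝ) = ζ at key key2 ⊢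
    generalize Y ^ (1 / 3 : ℝ) = y at key key2 ⊢
    calc _ = 2 * ρ / τ * n * (n + 1) * y ^ 2 * ζ ^ 2 * (2 * √3 - 3) * (a * τ / 6) := by
          field_simp; ring
      _ = _ := by rw [key]; field_simp
  · rw [hβe]
    generalize Z ^ (1 / 6 : ℝ) = ζ at key key2 ⊢
    generalize Y ^ (1 / 3 : ℝ) = y at key key2 ⊢
    calc _ = -(2 * ρ / τ * n * (5 * n - 1) * ζ ^ 2 * (3 + √3)) * (a * τ * y ^ 2 / 6) := by
          field_simp; push_cast; ring
      _ = _ := by rw [key2]; field_simp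
  · simp only [Family.profile]
    rw [← hβ, show (5 + 3 * √3) * (τ * a) * (5 * n - 1) / (a * (n + 1)) = Y by
      rw [hYe]; field_simp, ← Real.rpow_mul hY.le, one_mul]
    congr 2
    field_simp

/-! ### The parameter regions -/

variable {a b g m n σ μ ν : ℝ}

theorem Family.Admissible.isArchWave {F : Family} (h : F.Admissible a b g m n)
    (hw : F.WeakRegion m n) :
    IsArchWave a b g m n (F.halfWidth a b g m n) (F.endPower m n) (F.compacton a b g m n) := by
  obtain ⟨hm, hn, -, hr, hs⟩ := h
  cases F <;> simp only [Family.Relation] at hr <;> subst hr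
  · exact isArchWave_zsq1 hs.1 hs.2 hw
  · exact isArchWave_zsq2 hs.1 hs.2 hw.1 hw.2
  · exact isArchWave_cos1 hs.1 hs.2 hw
  · exact isArchWave_cos2 hs.1 hs.2 hw.1 hw.2
  · exact isArchWave_cn1 hs.1 hs.2 hw.1 hw.2
  · exact isArchWave_cn2 hs.1 hs.2 hw
  · exact isArchWave_sn1 hs.1 hs.2 hw.1 hw.2
  · exact isArchWave_sn2 hs.1 hs.2 hw
  · exact isArchWave_ratcn1 hs.1 hs.2 hw
  · exact isArchWave_ratcn2 hs.1 hs.2 hw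
  · exact isArchWave_ratcn3 hs.1 hs.2 hw.1 hw.2
  · exact isArchWave_ratcn4 hs.1 hs.2 hw.1 hw.2
  · exact isArchWave_ratcn5 hs.1 hs.2 hw.1 hw.2
  · exact isArchWave_ratcn6 hs.1 hs.2 hw

theorem den_pos_of_div_mul_pos {x y t : ℝ} (h : 0 < x / y * t) (hx : 0 ≤ x) (ht : 0 ≤ t) : 0 < y := by
  by_contra! hy
  exact absurd h (not_lt.2
    (mul_nonpos_of_nonpos_of_nonneg (div_nonpos_of_nonneg_of_nonpos hx hy) ht))

theorem den_pos_of_div_mul_mul_pos {x y t s : ℝ} (h : 0 < x / y * t * s) (hx : 0 ≤ x) (ht : 0 ≤ t)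
    (hs : 0 ≤ s) : 0 < y :=
  den_pos_of_div_mul_pos (by rwa [mul_assoc] at h) hx (mul_nonneg ht hs)

/-- All factors of the half-width other than the denominator `n - 1`, `1 - n` or `1 - m` are
nonnegative, so `0 < L` decides on which side of `1` the parameter lies; in the excluded case `n =
1` division by zero gives `L = 0`. The remaining bounds come from `0 < m`. -/
theorem Family.Admissible.weakRegion {F : Family} (h : F.Admissible a b g m n)
    (hL : 0 < F.halfWidth a b g m n) : F.WeakRegion m n := by
  obtain ⟨hm, hn, -, hr, hs⟩ := h
  have hK1 := (ellipticK_pos (show ((1 / √2) ^ 2 : ℝ) < 1 by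
    rw [div_pow, Real.sq_sqrt (by norm_num)]; norm_num)).le
  have hK2 := (ellipticK_pos (show (-1 : ℝ) < 1 by norm_num)).le
  have hK3 := (ellipticK_pos modMinus_lt).le
  have hK4 := jacobiArccn_modPlus_pos.le
  have hpi := Real.pi_pos.le
  cases F <;> simp only [Family.Relation] at hr <;> simp only [Family.halfWidth] at hL <;>
    simp only [Family.WeakRegion] <;> simp only [Family.Signs] at hs
  · have h1 := den_pos_of_div_mul_pos hL (by positivity) (by positivity)
    linarith [pos_of_mul_pos_left h1 (abs_nonneg a)]
  · rw [← mul_one ((n + 1) * √(n * |a * b|) / ((n - 1) * |g|))] at hL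
    have h1 := den_pos_of_div_mul_pos hL (by positivity) zero_le_one
    exact ⟨by linarith [pos_of_mul_pos_left h1 (abs_nonneg g)], by linarith⟩
  · linarith [den_pos_of_div_mul_mul_pos hL hn.le (by positivity) hpi]
  · exact ⟨hm, by linarith [den_pos_of_div_mul_mul_pos hL zero_le_one (by positivity) hpi]⟩
  · have h3 : 0 < 3 * n - 1 := by linarith
    have := hs.2
    exact ⟨by linarith, by
      linarith [den_pos_of_div_mul_mul_pos hL (by positivity) (by positivity) hK1]⟩
  · have h3 : 0 < 3 * n - 1 := by linarith
    have := hs.2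
    linarith [den_pos_of_div_mul_mul_pos hL (by positivity) (by positivity) hK1]
  · have h3 : 0 < 3 * n - 1 := by linarith
    have := hs.2
    exact ⟨by linarith, by
      linarith [den_pos_of_div_mul_mul_pos hL (by positivity) (by positivity) hK2]⟩
  · have h3 : 0 < 3 * n - 1 := by linarith
    have := hs.2
    linarith [den_pos_of_div_mul_mul_pos hL (by positivity) (by positivity) hK2]
  iterate 2
    have h2 : 0 < 2 * n - 1 := by linarith
    have hab := hs.1
    -- Rewriting `b ^ 3 / a` as `(a b) b ^ 2 / a ^ 2` exposes its sign.
    have e : b ^ 3 * n ^ 3 * (n + 1) ^ 2 * (2 * n - 1) / (12 * √3 * a * g ^ 2) =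
        (a * b) * b ^ 2 * n ^ 3 * (n + 1) ^ 2 * (2 * n - 1) / (12 * √3 * a ^ 2 * g ^ 2) := by
      have := left_ne_zero_of_mul hab.ne'
      rcases eq_or_ne g 0 with rfl | hg
      · simp
      · field_simp
    rw [e] at hL
    linarith [den_pos_of_div_mul_mul_pos hL zero_le_two (by positivity) hK3]
  · have h2 : 0 < 2 * n - 1 := by linarith
    exact ⟨by linarith, by
      linarith [den_pos_of_div_mul_mul_pos hL zero_le_one (by positivity) hK4]⟩
  iterate 2
    exact ⟨by linarith, by
      linarith [den_pos_of_div_mul_mul_pos hL zero_le_two (by positivity) hK3]⟩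
  · linarith [den_pos_of_div_mul_mul_pos hL zero_le_one (by positivity) hK4]

/-- The denominator of the end power is positive in the weak region, so the inequality can be
cleared. For `cn1`, `sn1`, `ratcn3`, `ratcn4` and `ratcn5` it holds on the whole region and adds
nothing. -/
theorem Family.strongRegionK_iff (F : Family) :
    F.StrongRegionK m n ↔ F.WeakRegion m n ∧ 3 < F.endPower m n := by
  cases F <;> simp only [Family.StrongRegionK, Family.WeakRegion, Family.endPower] <;>
    constructor
  all_goals first
    | (rintro ⟨⟨h1, h2⟩, h3⟩
       rw [lt_div_iff₀ (by linarith)] at h3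
       exact ⟨by linarith, by linarith⟩)
    | (rintro ⟨h1, h2⟩
       rw [lt_div_iff₀ (by linarith)] at h2
       exact ⟨by linarith, by linarith⟩)
    | (rintro ⟨h1, h2⟩
       rw [lt_div_iff₀ (by linarith)]
       first
        | exact ⟨by linarith, by linarith⟩
        | exact ⟨⟨by linarith, by linarith⟩, by linarith⟩)

theorem Family.strongRegionKP_iff (F : Family) :
    F.StrongRegionKP m n ↔ F.WeakRegion m n ∧ 4 < F.endPower m n := by
  cases F <;> simp only [Family.StrongRegionKP, Family.WeakRegion, Family.endPower] <;>
    constructor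
  all_goals first
    | (rintro ⟨⟨h1, h2⟩, h3⟩
       rw [lt_div_iff₀ (by linarith)] at h3
       exact ⟨by linarith, by linarith⟩)
    | (rintro ⟨h1, h2⟩
       rw [lt_div_iff₀ (by linarith)] at h2
       exact ⟨by linarith, by linarith⟩)
    | (rintro ⟨h1, h2⟩
       rw [lt_div_iff₀ (by linarith)]
       first
        | exact ⟨by linarith, by linarith⟩
        | exact ⟨⟨by linarith, by linarith⟩, by linarith⟩)

theorem Family.Admissible.weakK_iff {F : Family} (h : F.Admissible a b g m n) :
    F.WeakK a b g m n ↔ F.WeakRegion m n :=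
  ⟨fun hw => h.weakRegion hw.1.1, fun hw => (h.isArchWave hw).weakK⟩

theorem Family.Admissible.strongK_iff {F : Family} (h : F.Admissible a b g m n) :
    F.StrongK a b g m n ↔ F.StrongRegionK m n := by
  rw [F.strongRegionK_iff]
  exact ⟨fun hs => have hw := h.weakRegion hs.1.1
    ⟨hw, (h.isArchWave hw).strongK_iff.1 hs⟩, fun hs => (h.isArchWave hs.1).strongK_iff.2 hs.2⟩

theorem Family.Admissible.weakKP_iff {F : Family} (h : F.Admissible a b (ν - σ * μ ^ 2) m n) :
    F.WeakKP a b σ μ ν m n ↔ F.WeakRegion m n :=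
  ⟨fun hw => h.weakRegion hw.1.1, fun hw => (h.isArchWave hw).weakKP⟩

theorem Family.Admissible.strongKP_iff {F : Family} (h : F.Admissible a b (ν - σ * μ ^ 2) m n) :
    F.StrongKP a b σ μ ν m n ↔ F.StrongRegionKP m n := by
  rw [F.strongRegionKP_iff]
  exact ⟨fun hs => have hw := h.weakRegion hs.1.1
    ⟨hw, (h.isArchWave hw).strongKP_iff.1 hs⟩, fun hs => (h.isArchWave hs.1).strongKP_iff.2 hs.2⟩

/-! ### The examples with `n = 2`. -/

theorem Family.admissible_of_isExample (F : Family) (hb : 0 < a * b) (hg : 0 < a * g)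
    (hF : F.IsExample m) : F.Admissible a b g m 2 := by
  cases F <;> simp only [Family.IsExample] at hF <;> subst hF <;>
    refine ⟨by norm_num, by norm_num, by norm_num, ?_, hb, hg⟩ <;>
    norm_num [Family.Relation]

/-- With `n = 2` and `a b > 0`, the families requiring `a b < 0` drop out by sign, and `ratcn1` and
`ratcn2` would need `m = 4`. -/
theorem Family.Admissible.isExample {F : Family} (h : F.Admissible a b g m 2) (hb : 0 < a * b)
    (hm : m = 3 / 2 ∨ m = 2 ∨ m = 3 ∨ m = 5 / 2) : F.IsExample m := by
  obtain ⟨hm0, -, -, hr, hs⟩ := h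
  cases F <;> simp only [Family.Relation, Family.Signs, Family.IsExample] at * <;>
    first
    | linarith
    | linarith [hs.1]
    | (exfalso; rcases hm with h | h | h | h <;> linarith)

theorem Family.IsExample.weakRegion {F : Family} (h : F.IsExample m) : F.WeakRegion m 2 := by
  cases F <;> simp only [Family.IsExample] at h <;> norm_num [Family.WeakRegion]

theorem Family.IsExample.not_strongRegionK {F : Family} (h : F.IsExample m) :
    ¬F.StrongRegionK m 2 := by
  cases F <;> simp only [Family.IsExample] at h <;> norm_num [Family.StrongRegionK]

theorem Family.IsExample.not_strongRegionKP {F : Family} (h : F.IsExample m) :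
    ¬F.StrongRegionKP m 2 := by
  cases F <;> simp only [Family.IsExample] at h <;> norm_num [Family.StrongRegionKP]

end Compacton

theorem mainTheorem4 :
    -- on the parameter region: symmetry and end point behaviour of the profile
    (∀ (F : Compacton.Family) (a b g m n : ℝ), F.Admissible a b g m n → F.WeakRegion m n →
      (∀ ξ, F.compacton a b g m n (-ξ) = F.compacton a b g m n ξ) ∧
      Compacton.HasEndBehaviour (F.compacton a b g m n) (F.halfWidth a b g m n)
        (F.endPower m n)) ∧
    -- existence conditions for the `K(m, n)` equation, with speed `c = g`
    (∀ (F : Compacton.Family) (a b g m n : ℝ), F.Admissible a b g m n →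
      (F.WeakK a b g m n ↔ F.WeakRegion m n) ∧
      (F.StrongK a b g m n ↔ F.StrongRegionK m n)) ∧
    -- existence conditions for the `KP(m, n)` equation, with `g = ν - σ μ²`
    (∀ (F : Compacton.Family) (a b σ μ ν m n : ℝ), σ ^ 2 = 1 →
      F.Admissible a b (ν - σ * μ ^ 2) m n →
      (F.WeakKP a b σ μ ν m n ↔ F.WeakRegion m n) ∧
      (F.StrongKP a b σ μ ν m n ↔ F.StrongRegionKP m n)) ∧
    -- the examples with `n = 2` of equations having only weak explicit compactons
    (∀ (F : Compacton.Family) (a b g m : ℝ), 0 < a * b → 0 < a * g → F.IsExample m →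
      F.Admissible a b g m 2) ∧
    (∀ (F : Compacton.Family) (a b g m : ℝ), 0 < a * b →
      (m = 3 / 2 ∨ m = 2 ∨ m = 3 ∨ m = 5 / 2) → F.Admissible a b g m 2 →
      F.IsExample m ∧ F.WeakK a b g m 2 ∧ ¬ F.StrongK a b g m 2 ∧
      ∀ σ μ ν : ℝ, σ ^ 2 = 1 → ν - σ * μ ^ 2 = g →
        F.WeakKP a b σ μ ν m 2 ∧ ¬ F.StrongKP a b σ μ ν m 2) ∧
    -- the example with `n = 1`, `m = 1 / 4`
    (∀ a b g : ℝ, a * b < 0 → 0 < a * g →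
      Compacton.Family.cos2.Admissible a b g (1 / 4) 1 ∧
      Compacton.Family.cos2.WeakK a b g (1 / 4) 1 ∧
      ¬ Compacton.Family.cos2.StrongK a b g (1 / 4) 1 ∧
      ∀ σ μ ν : ℝ, σ ^ 2 = 1 → ν - σ * μ ^ 2 = g →
        Compacton.Family.cos2.WeakKP a b σ μ ν (1 / 4) 1 ∧
        ¬ Compacton.Family.cos2.StrongKP a b σ μ ν (1 / 4) 1) := by 
  open Compacton in
  refine ⟨fun F a b g m n h hw => ⟨(h.isArchWave hw).even, (h.isArchWave hw).hasEndBehaviour⟩,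
    fun F a b g m n h => ⟨h.weakK_iff, h.strongK_iff⟩,
    fun F a b σ μ ν m n _ h => ⟨h.weakKP_iff, h.strongKP_iff⟩,
    fun F a b g m => F.admissible_of_isExample, fun F a b g m hb hm h => ?_,
    fun a b g hb hg => ?_⟩
  · have he := h.isExample hb hm
    refine ⟨he, h.weakK_iff.2 he.weakRegion, fun hs => he.not_strongRegionK (h.strongK_iff.1 hs),
      fun σ μ ν _ hg => ?_⟩
    subst hg
    exact ⟨h.weakKP_iff.2 he.weakRegion,
      fun hs => he.not_strongRegionKP (h.strongKP_iff.1 hs)⟩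
  · have h : Family.cos2.Admissible a b g (1 / 4) 1 :=
      ⟨by norm_num, by norm_num, by norm_num, rfl, hb, hg⟩
    have hw : Family.cos2.WeakRegion (1 / 4) 1 := by norm_num [Family.WeakRegion]
    refine ⟨h, h.weakK_iff.2 hw, fun hs => ?_, fun σ μ ν _ hg' => ?_⟩
    · have := (h.strongK_iff.1 hs).1
      norm_num at this
    · subst hg'
      refine ⟨h.weakKP_iff.2 hw, fun hs => ?_⟩
      have := (h.strongKP_iff.1 hs).1
      norm_num at this
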